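/- **Setting.** Let $k$ be a commutative ring, $\mathcal C$ a small category and $\mathbb A:\mathcal C^{op}\to k\text{-alg}$ a presheaf of associative unital $k$-algebras. Write $\mathbb A^i=\mathbb A(i)$ for $i\in\mathcal C$. A (left) $\mathbb A$-module $\mathbb M$ is a presheaf of abelian groups on $\mathcal C$ with a left $\mathbb A^i$-module structure on each $\mathbb M^i$ such that, for every $v:h\to i$ in $\mathcal C$, the restriction map $\mathbb M^i\to\mathbb M^h$ is linear along $\mathbb A(v):\mathbb A^i\to\mathbb A^h$; maps $\eta$ of $\mathbb A$-modules are natural transformations with all components $\eta^i$ being $\mathbb A^i$-linear. They form the abelian category $\mathbb A\text{-mod}$. Such a map $\eta:\mathbb M\to\mathbb N$ is *allowable* if for every $i$ there is a $k$-linear map $s^i:\mathbb N^i\to\mathbb M^i$ (not required to be natural in $i$) with $\eta^i s^i\eta^i=\eta^i$. *Subdivision.* The subdivision $\mathcal C'$ is the category whose objects are all functors $\sigma:[p]\to\mathcal C$, $p\ge 0$, where $[p]=\{0<\dots<p\}$. For $\tau:[p]\to\mathcal C$ and $\sigma:[q]\to\mathcal C$, a morphism $\tau\to\sigma$ is a morphism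 $v:\tau(0)\to\sigma(0)$ of $\mathcal C$ for which there is a strictly increasing $f:[q]\to[p]$ with $\sigma=\tau\circ f$ and $v=\tau(0\to f(0))$; composition is that of $\mathcal C$. Let $\mathbf d:\mathcal C'\to\mathcal C$ be the functor $\tau\mapsto\tau(0)$, $v\mapsto v$, let $\mathbb A'=\mathbf d^*\mathbb A=\mathbb A\circ\mathbf d^{op}$, and let $\mathbf d^*:\mathbb A\text{-mod}\to\mathbb A'\text{-mod}$, $\mathbb M\mapsto\mathbb M'=\mathbf d^*\mathbb M$, be given by $(\mathbb M')^\tau=\mathbb M^{\tau(0)}$. *Relative derived category.* Let $\mathcal K^-(\mathbb A\text{-mod})$ be the category of complexes $\mathbb M_\bullet=(\cdots\to\mathbb M_{n+1}\to\mathbb M_n\to\cdots)$, $n\in\mathbb Z$, of $\mathbb A$-modules that are bounded on the right ($\mathbb M_n=0$ for $n\ll0$), with homotopy classes of maps of complexes as morphisms. A map of complexes $\mathbb M_\bullet\to\mathbb N_\bullet$ is a *relative quasi-isomorphism* if, for every $i\in\mathcal C$, the cone of $\mathbb M^i_\bullet\to\mathbb N^i_\bullet$ is contractible as a complex of $k$-modules.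 Let $\mathcal D_k^-(\mathbb A\text{-mod})$ be the localization of $\mathcal K^-(\mathbb A\text{-mod})$ at the class of relative quasi-isomorphisms; define $\mathcal D_k^-(\mathbb A'\text{-mod})$ in the same way. **Theorem.** The functor $\mathbf d^*:\mathbb A\text{-mod}\to\mathbb A'\text{-mod}$ is exact and preserves allowable maps, and applying it termwise preserves relative quasi-isomorphisms. The induced functor $$\mathbf d^*:\mathcal D_k^-(\mathbb A\text{-mod})\longrightarrow\mathcal D_k^-(\mathbb A'\text{-mod})$$ is full and faithful: for all $\mathbb M_\bullet,\mathbb N_\bullet$ in $\mathcal D_k^-(\mathbb A\text{-mod})$ the map $$\mathrm{Mor}_{\mathcal D_k^-(\mathbb A\text{-mod})}(\mathbb M_\bullet,\mathbb N_\bullet)\longrightarrow\mathrm{Mor}_{\mathcal D_k^-(\mathbb A'\text{-mod})}(\mathbb M'_\bullet,\mathbb N'_\bullet)$$ is a bijection. The same holds if, throughout, only complexes $\cdots\to\mathbb M_1\to\mathbb M_0\to0$ (that is, with $\mathbb M_n=0$ for all $n<0$) are used in place of all complexes bounded on the right. -/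

import Mathlib

open CategoryTheory CategoryTheory.Limits Opposite

universe u

noncomputable section

namespace DiagramOfAlgebras

/-! ## The subdivision of a small category -/

section Subdivision

variable (C : Type u) [SmallCategory C]

/-- Objects of the subdivision `C'`: the simplices of `C`, i.e. functors `[p] ⥤ C` with `p ≥ 0`
(degenerate ones included). -/
structure Simplex where
  /-- the dimension `p` -/
  dim : ℕ
  /-- the functor `[p] ⥤ C`, where `[p] = {0 < ⋯ < p}` -/
  functor : Fin (dim + 1) ⥤ C

variable {C}

namespace Simplex

/-- `v : τ(0) ⟶ σ(0)` underlies a map `τ ⟶ σ` of the subdivision: there is a strictly monotone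
`f : [q] → [p]` such that `σ = τ ∘ f` and `v = τ(0 → f 0)`. (The `eqToHom` is the identification
`τ(f 0) = σ(0)`.) -/
def IsFaceMap (τ σ : Simplex C) (v : τ.functor.obj 0 ⟶ σ.functor.obj 0) : Prop :=
  ∃ (f : Fin (σ.dim + 1) → Fin (τ.dim + 1)) (hf : StrictMono f)
    (h : hf.monotone.functor ⋙ τ.functor = σ.functor),
    v = τ.functor.map (homOfLE (Fin.zero_le (f 0))) ≫ eqToHom (Functor.congr_obj h 0)

lemma isFaceMap_id (τ : Simplex C) : IsFaceMap τ τ (𝟙 _) :=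
  ⟨id, strictMono_id, rfl, (τ.functor.map_id 0).symm.trans (Category.comp_id _).symm⟩

lemma comp_aux {p q r : ℕ} {τ : Fin (p + 1) ⥤ C} {σ : Fin (q + 1) ⥤ C} {ω : Fin (r + 1) ⥤ C}
    {f : Fin (q + 1) → Fin (p + 1)} {g : Fin (r + 1) → Fin (q + 1)}
    (hf : StrictMono f) (hg : StrictMono g)
    (h : hf.monotone.functor ⋙ τ = σ) (h' : hg.monotone.functor ⋙ σ = ω) :
    ∃ h'' : (hf.comp hg).monotone.functor ⋙ τ = ω,
      (τ.map (homOfLE (Fin.zero_le (f 0))) ≫ eqToHom (Functor.congr_obj h 0)) ≫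
        σ.map (homOfLE (Fin.zero_le (g 0))) ≫ eqToHom (Functor.congr_obj h' 0) =
      τ.map (homOfLE (Fin.zero_le (f (g 0)))) ≫ eqToHom (Functor.congr_obj h'' 0) := by
  subst h
  subst h'
  refine ⟨rfl, ?_⟩
  refine (congrArg₂ (· ≫ ·) (Category.comp_id _) (Category.comp_id _)).trans ?_
  exact (τ.map_comp _ _).symm.trans (Category.comp_id _).symm

lemma isFaceMap_comp {τ σ ω : Simplex C} {u : τ.functor.obj 0 ⟶ σ.functor.obj 0}
    {v : σ.functor.obj 0 ⟶ ω.functor.obj 0} (hu : IsFaceMap τ σ u) (hv : IsFaceMap σ ω v) :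
    IsFaceMap τ ω (u ≫ v) := by
  obtain ⟨f, hf, h, rfl⟩ := hu
  obtain ⟨g, hg, h', rfl⟩ := hv
  obtain ⟨h'', e⟩ := comp_aux hf hg h h'
  exact ⟨f ∘ g, hf.comp hg, h'', e⟩

/-- The subdivision `C'` of `C`: a map `τ ⟶ σ` is a triple `[τ, σ, v]`, and
`[τ, σ, u] ≫ [σ, ω, v] = [τ, ω, u ≫ v]`. -/
instance : SmallCategory (Simplex C) where
  Hom τ σ := { v : τ.functor.obj 0 ⟶ σ.functor.obj 0 // IsFaceMap τ σ v }
  id τ := ⟨𝟙 _, isFaceMap_id τ⟩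
  comp u v := ⟨u.1 ≫ v.1, isFaceMap_comp u.2 v.2⟩
  id_comp u := Subtype.ext (Category.id_comp u.1)
  comp_id u := Subtype.ext (Category.comp_id u.1)
  assoc u v w := Subtype.ext (Category.assoc u.1 v.1 w.1)

end Simplex

variable (C)

/-- The functor `d : C' ⥤ C`, `τ ↦ τ(0)`, `[τ, σ, v] ↦ v`. -/
def initialVertex : Simplex C ⥤ C where
  obj τ := τ.functor.obj 0
  map v := v.1
  map_id _ := rfl
  map_comp _ _ := rfl

end Subdivision

/-! ## Diagrams of algebras, their modules, and allowable maps

A diagram over `C` is a functor `A : Cᵒᵖ ⥤ AlgCat k` (presheaf of associative unital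
`k`-algebras). -/

section Modules

variable {C : Type u} [SmallCategory C] {k : Type u} [CommRing k]

/-- The category of left modules over the diagram `A`: presheaves of abelian groups `M` such that
each `M i` is a left `A i`-module and each restriction map is linear along that of `A`. -/
abbrev AMod (A : Cᵒᵖ ⥤ AlgCat.{u} k) : Type (u + 1) :=
  PresheafOfModules.{u} (A ⋙ forget₂ (AlgCat.{u} k) RingCat.{u})

variable (A : Cᵒᵖ ⥤ AlgCat.{u} k)

/-- The functor `M ↦ M i`, where `M i` is regarded as a `k`-module through `k → A i`. -/
def evalK (i : C) : AMod A ⥤ ModuleCat.{u} k :=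
  PresheafOfModules.evaluation (A ⋙ forget₂ (AlgCat.{u} k) RingCat.{u}) (op i) ⋙
    ModuleCat.restrictScalars (algebraMap k (A.obj (op i)))

instance (i : C) : (evalK A i).Additive := by
  unfold evalK
  infer_instance

variable {A} in
/-- `η` is allowable if each `η i` has a `k`-linear (not necessarily natural) splitting map `s`
with `η i ∘ s ∘ η i = η i`. -/
def Allowable {M N : AMod A} (η : M ⟶ N) : Prop :=
  ∀ i : C, ∃ s : (evalK A i).obj N ⟶ (evalK A i).obj M,
    (evalK A i).map η ≫ s ≫ (evalK A i).map η = (evalK A i).map η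

/-- The subdivided diagram `A' = d^* A` over `C'`. -/
abbrev subdivision : (Simplex C)ᵒᵖ ⥤ AlgCat.{u} k :=
  (initialVertex C).op ⋙ A

/-- The functor `d^* : A-mod ⥤ A'-mod`, `(d^* M) τ = M (d τ)`. -/
def dStar : AMod A ⥤ AMod (subdivision A) :=
  PresheafOfModules.pushforward₀ (initialVertex C)
    (A ⋙ forget₂ (AlgCat.{u} k) RingCat.{u})

instance : (dStar A).Additive where

end Modules

/-! ## Complexes bounded on the right and the relative derived category

Complexes are indexed cohomologically by `ℤ`: the term `M_n` of the complex
`⋯ ⟶ M_1 ⟶ M_0 ⟶ 0` is `M.X (-n)`. -/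

section Derived

variable {C : Type u} [SmallCategory C] {k : Type u} [CommRing k]

/-- Complexes `M` for which there is `n ∈ S` with `M.X i = 0` for all `i > n`, as objects of the
homotopy category. Two cases are of interest: `S = Set.univ` (complexes bounded on the right) and
`S = {0}` (complexes `⋯ ⟶ M_1 ⟶ M_0 ⟶ 0`). -/
def rightBounded (V : Type*) [Category* V] [Preadditive V] (S : Set ℤ) :
    ObjectProperty (HomotopyCategory V (ComplexShape.up ℤ)) :=
  fun M => ∃ n ∈ S, ∀ i : ℤ, n < i → IsZero (M.as.X i)

variable (A : Cᵒᵖ ⥤ AlgCat.{u} k) (S : Set ℤ)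

/-- The homotopy category of complexes of `A`-modules that are right bounded in the sense given
by `S`: a full subcategory of the category of complexes and homotopy classes of maps. -/
abbrev KMinus : Type (u + 1) := (rightBounded (AMod A) S).FullSubcategory

variable {A} in
/-- A map of complexes of `A`-modules is a relative quasi-isomorphism if for every `i` the cone of
`φ i`, considered as a complex of `k`-modules, is contractible. -/
def IsRelQuasiIso {M N : CochainComplex (AMod A) ℤ} (φ : M ⟶ N) : Prop :=
  ∀ i : C, Nonempty (Homotopy
    (𝟙 (CochainComplex.mappingCone
      (((evalK A i).mapHomologicalComplex (ComplexShape.up ℤ)).map φ))) 0)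

/-- The class `Σ` of (homotopy classes of) relative quasi-isomorphisms. -/
def relQuasiIso : MorphismProperty (KMinus A S) :=
  fun M N f => ∃ φ : M.obj.as ⟶ N.obj.as,
    (HomotopyCategory.quotient (AMod A) (ComplexShape.up ℤ)).map φ = f.hom ∧ IsRelQuasiIso φ

/-- The relative derived category: the localization of the homotopy category at `Σ`. -/
abbrev RelDerived : Type (u + 1) := (relQuasiIso A S).Localization

/-- `d^*` on homotopy categories of right bounded complexes. -/
def dStarK : KMinus A S ⥤ KMinus (subdivision A) S :=
  (rightBounded (AMod (subdivision A)) S).lift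
    ((rightBounded (AMod A) S).ι ⋙ (dStar A).mapHomotopyCategory (ComplexShape.up ℤ))
    (by
      rintro ⟨M, n, hn, h⟩
      exact ⟨n, hn, fun i hi => (dStar A).map_isZero (h i hi)⟩)

lemma isRelQuasiIso_dStar {M N : CochainComplex (AMod A) ℤ} {φ : M ⟶ N} (h : IsRelQuasiIso φ) :
    IsRelQuasiIso (((dStar A).mapHomologicalComplex (ComplexShape.up ℤ)).map φ) :=
  fun τ => h ((initialVertex C).obj τ)

lemma relQuasiIso_dStarK {M N : KMinus A S} {f : M ⟶ N} (hf : relQuasiIso A S f) :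
    relQuasiIso (subdivision A) S ((dStarK A S).map f) := by
  obtain ⟨φ, hφ, h⟩ := hf
  refine ⟨((dStar A).mapHomologicalComplex (ComplexShape.up ℤ)).map φ, ?_,
    isRelQuasiIso_dStar A h⟩
  change _ = ((dStar A).mapHomotopyCategory (ComplexShape.up ℤ)).map f.hom
  rw [← hφ]
  rfl

/-- The functor induced by `d^*` on relative derived categories: the unique functor whose
composition with the localization functor is `d^*` followed by the localization functor. -/
def dStarD : RelDerived A S ⥤ RelDerived (subdivision A) S :=
  Localization.Construction.lift (dStarK A S ⋙ (relQuasiIso (subdivision A) S).Q)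
    (fun _ _ _ hf => (relQuasiIso (subdivision A) S).Q_inverts _ (relQuasiIso_dStarK A S hf))

end Derived

end DiagramOfAlgebras

end

noncomputable section

namespace DiagramOfAlgebras

section LocalizationLemma

variable {K K' K'' D D' D'' : Type*} [Category* K] [Category* K'] [Category* K'']
  [Category* D] [Category* D'] [Category* D'']

/-- The map on morphisms between objects of the form `L.obj X` induced by a functor `Fb` between
localizations which lifts `F`. -/
def liftedMap {L : K ⥤ D} {L' : K' ⥤ D'} {F : K ⥤ K'} {Fb : D ⥤ D'} (c : L ⋙ Fb ≅ F ⋙ L')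
    {X Y : K} (g : L.obj X ⟶ L.obj Y) : L'.obj (F.obj X) ⟶ L'.obj (F.obj Y) :=
  c.inv.app X ≫ Fb.map g ≫ c.hom.app Y

section

variable {L : K ⥤ D} {L' : K' ⥤ D'} {L'' : K'' ⥤ D''} {F : K ⥤ K'} {Fb : D ⥤ D'}
  (c : L ⋙ Fb ≅ F ⋙ L') {G : K' ⥤ K''} {Gb : D' ⥤ D''} (c' : L' ⋙ Gb ≅ G ⋙ L'')

lemma liftedMap_comp {X Y Z : K} (g : L.obj X ⟶ L.obj Y) (h : L.obj Y ⟶ L.obj Z) :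
    liftedMap c (g ≫ h) = liftedMap c g ≫ liftedMap c h := by
  simp [liftedMap]

lemma liftedMap_map {X Y : K} (f : X ⟶ Y) :
    liftedMap c (L.map f) = L'.map (F.map f) := by
  have := c.hom.naturality f
  dsimp at this
  simp [liftedMap, this]

lemma liftedMap_isoInv {X Y : K} (g : L.obj X ⟶ L.obj Y) [IsIso g] :
    liftedMap c g ≫ liftedMap c (inv g) = 𝟙 _ ∧ liftedMap c (inv g) ≫ liftedMap c g = 𝟙 _ := by
  simp [liftedMap]

/-- Composition of squares of functors. -/
def liftingComp : L ⋙ (Fb ⋙ Gb) ≅ (F ⋙ G) ⋙ L'' :=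
  NatIso.ofComponents (fun X => Gb.mapIso (c.app X) ≪≫ c'.app (F.obj X)) (fun {X Y} f => by
    have h := congr(Gb.map $(c.hom.naturality f))
    have h' := c'.hom.naturality (F.map f)
    dsimp at h h' ⊢
    simp only [Functor.map_comp] at h
    rw [← Category.assoc, h, Category.assoc, h', Category.assoc])

lemma liftedMap_liftingComp {X Y : K} (g : L.obj X ⟶ L.obj Y) :
    liftedMap (liftingComp c c') g = liftedMap c' (liftedMap c g) := by
  simp [liftedMap, liftingComp]

variable (L) in
lemma liftedMap_id {X Y : K} (g : L.obj X ⟶ L.obj Y) :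
    liftedMap (F := 𝟭 K) (Fb := 𝟭 D) (L.rightUnitor ≪≫ L.leftUnitor.symm) g = g := by
  simp [liftedMap]

lemma liftedMap_naturality (W : MorphismProperty K) [L.IsLocalization W] {G : K ⥤ K'}
    {Gb : D ⥤ D'} (c' : L ⋙ Gb ≅ G ⋙ L') (τ : F ⟶ G) {X Y : K} (g : L.obj X ⟶ L.obj Y) :
    liftedMap c g ≫ L'.map (τ.app Y) = L'.map (τ.app X) ≫ liftedMap c' g := by
  let _ : Localization.Lifting L W (F ⋙ L') Fb := ⟨c⟩
  let _ : Localization.Lifting L W (G ⋙ L') Gb := ⟨c'⟩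
  let t := Localization.liftNatTrans L W (F ⋙ L') (G ⋙ L') Fb Gb (Functor.whiskerRight τ L')
  have ht (X : K) : t.app (L.obj X) = c.hom.app X ≫ L'.map (τ.app X) ≫ c'.inv.app X :=
    Localization.liftNatTrans_app ..
  have h := t.naturality g
  rw [ht, ht] at h
  have h' := congr(c.inv.app X ≫ $h ≫ c'.hom.app Y)
  simpa [liftedMap] using h'

end

/-- A criterion for a functor between localizations to be bijective on maps. -/
theorem bijective_map_of_localization {L : K ⥤ D} {L' : K' ⥤ D'} {W : MorphismProperty K}
    {W' : MorphismProperty K'} [L.IsLocalization W] [L'.IsLocalization W']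
    {F : K ⥤ K'} {Fb : D ⥤ D'} (cF : L ⋙ Fb ≅ F ⋙ L')
    {T : K ⥤ K} {R : K' ⥤ K} {N T' : K' ⥤ K'}
    (hT : ∀ ⦃X Y : K⦄ (f : X ⟶ Y), W f → W (T.map f))
    (hR : ∀ ⦃X Y : K'⦄ (f : X ⟶ Y), W' f → W (R.map f))
    (hN : ∀ ⦃X Y : K'⦄ (f : X ⟶ Y), W' f → W' (N.map f))
    (hT' : ∀ ⦃X Y : K'⦄ (f : X ⟶ Y), W' f → W' (T'.map f))
    (κ : T ⟶ 𝟭 K) (κ' : T' ⟶ 𝟭 K') (ε : T ⟶ F ⋙ R) (hε : ∀ X, W (ε.app X))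
    (ι : T' ⟶ N) (hι : ∀ X, W' (ι.app (F.obj X))) (ν : R ⋙ F ⟶ N) (θ : T ⋙ F ⟶ F ⋙ T')
    (h₁ : ∀ X, F.map (ε.app X) ≫ ν.app (F.obj X) = θ.app X ≫ ι.app (F.obj X))
    (h₂ : ∀ X, θ.app X ≫ κ'.app (F.obj X) = F.map (κ.app X))
    (X Y : K) (hX : W (κ.app X)) (hY : W (κ.app Y)) :
    Function.Bijective (fun g : L.obj X ⟶ L.obj Y => Fb.map g) := by
  have iT : W.IsInvertedBy (T ⋙ L) := fun _ _ f hf => Localization.inverts L W _ (hT f hf)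
  have iR : W'.IsInvertedBy (R ⋙ L) := fun _ _ f hf => Localization.inverts L W _ (hR f hf)
  have iN : W'.IsInvertedBy (N ⋙ L') := fun _ _ f hf => Localization.inverts L' W' _ (hN f hf)
  have iT' : W'.IsInvertedBy (T' ⋙ L') := fun _ _ f hf => Localization.inverts L' W' _ (hT' f hf)
  let cT : L ⋙ _ ≅ T ⋙ L := Localization.fac _ iT L
  let cR : L' ⋙ _ ≅ R ⋙ L := Localization.fac _ iR L'
  let cN : L' ⋙ _ ≅ N ⋙ L' := Localization.fac _ iN L'
  let cT' : L' ⋙ _ ≅ T' ⋙ L' := Localization.fac _ iT' L'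
  have nκ {X Y : K} (g : L.obj X ⟶ L.obj Y) :
      liftedMap cT g ≫ L.map (κ.app Y) = L.map (κ.app X) ≫ g := by
    simpa only [liftedMap_id] using!
      liftedMap_naturality cT W (L.rightUnitor ≪≫ L.leftUnitor.symm) κ g
  have nκ' {X Y : K'} (g : L'.obj X ⟶ L'.obj Y) :
      liftedMap cT' g ≫ L'.map (κ'.app Y) = L'.map (κ'.app X) ≫ g := by
    simpa only [liftedMap_id] using!
      liftedMap_naturality cT' W' (L'.rightUnitor ≪≫ L'.leftUnitor.symm) κ' g
  have nε {X Y : K} (g : L.obj X ⟶ L.obj Y) :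
      liftedMap cT g ≫ L.map (ε.app Y) = L.map (ε.app X) ≫ liftedMap cR (liftedMap cF g) := by
    rw [← liftedMap_liftingComp]
    exact liftedMap_naturality cT W (liftingComp cF cR) ε g
  have nι {X Y : K'} (g : L'.obj X ⟶ L'.obj Y) :
      liftedMap cT' g ≫ L'.map (ι.app Y) = L'.map (ι.app X) ≫ liftedMap cN g :=
    liftedMap_naturality cT' W' cN ι g
  have nν {X Y : K'} (g : L'.obj X ⟶ L'.obj Y) :
      liftedMap cF (liftedMap cR g) ≫ L'.map (ν.app Y) = L'.map (ν.app X) ≫ liftedMap cN g := by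
    rw [← liftedMap_liftingComp]
    exact liftedMap_naturality (liftingComp cR cF) W' cN ν g
  have iε (X : K) : IsIso (L.map (ε.app X)) := Localization.inverts L W _ (hε X)
  have iι (X : K) : IsIso (L'.map (ι.app (F.obj X))) := Localization.inverts L' W' _ (hι X)
  have iX : IsIso (L.map (κ.app X)) := Localization.inverts L W _ hX
  have iY : IsIso (L.map (κ.app Y)) := Localization.inverts L W _ hY
  have hb : Function.Bijective (fun g : L.obj X ⟶ L.obj Y => liftedMap cF g) := by
    constructor
    · intro g₁ g₂ h
      dsimp only at h
      rw [← cancel_epi (L.map (κ.app X)), ← nκ, ← nκ]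
      congr 1
      rw [← cancel_mono (L.map (ε.app Y)), nε, nε, h]
    · intro g
      refine ⟨inv (L.map (κ.app X)) ≫ L.map (ε.app X) ≫ liftedMap cR g ≫
        inv (L.map (ε.app Y)) ≫ L.map (κ.app Y), ?_⟩
      have e₀ : liftedMap cF (inv (L.map (ε.app Y))) ≫ L'.map (θ.app Y) ≫
          L'.map (ι.app (F.obj Y)) = L'.map (ν.app (F.obj Y)) := by
        rw [← Functor.map_comp, ← h₁, Functor.map_comp, ← liftedMap_map cF,
          ← Category.assoc, (liftedMap_isoInv cF _).2]
        exact Category.id_comp _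
      have e₁ : L'.map (F.map (ε.app X)) ≫ liftedMap cF (liftedMap cR g) ≫
          liftedMap cF (inv (L.map (ε.app Y))) ≫ L'.map (θ.app Y) =
          L'.map (θ.app X) ≫ liftedMap cT' g := by
        rw [← cancel_mono (L'.map (ι.app (F.obj Y)))]
        simp only [Category.assoc]
        rw [e₀, nν, nι, ← Functor.map_comp_assoc, ← Functor.map_comp_assoc, h₁]
      have e₂ (Z : K) : liftedMap cF (L.map (κ.app Z)) =
          L'.map (θ.app Z) ≫ L'.map (κ'.app (F.obj Z)) := by
        rw [← Functor.map_comp, h₂]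
        exact liftedMap_map cF _
      have : IsIso (liftedMap cF (L.map (κ.app X))) :=
        ⟨_, (liftedMap_isoInv cF _).1, (liftedMap_isoInv cF _).2⟩
      rw [← cancel_epi (liftedMap cF (L.map (κ.app X)))]
      dsimp only
      rw [← liftedMap_comp, IsIso.hom_inv_id_assoc]
      simp only [liftedMap_comp]
      erw [e₂, e₂]
      rw [liftedMap_map]
      have e₃ := congr($e₁ ≫ L'.map (κ'.app (F.obj Y)))
      simp only [Category.assoc] at e₃ ⊢
      rw [nκ'] at e₃
      exact e₃
  constructor
  · intro g₁ g₂ h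
    exact hb.1 (congr(cF.inv.app X ≫ $h ≫ cF.hom.app Y))
  · intro g
    obtain ⟨h, hh⟩ := hb.2 (cF.inv.app X ≫ g ≫ cF.hom.app Y)
    exact ⟨h, (cancel_mono (cF.hom.app Y)).1 (by simpa [liftedMap] using hh)⟩

end LocalizationLemma

section HomotopyEquivalences

variable {V : Type*} [Category* V] [Preadditive V]

/-- A map of complexes is invertible up to homotopy. -/
abbrev IsHomotopyIso {X Y : CochainComplex V ℤ} (φ : X ⟶ Y) : Prop :=
  IsIso ((HomotopyCategory.quotient V (ComplexShape.up ℤ)).map φ)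

lemma isHomotopyIso_iff {X Y : CochainComplex V ℤ} (φ : X ⟶ Y) :
    IsHomotopyIso φ ↔ ∃ ψ : Y ⟶ X, Nonempty (Homotopy (φ ≫ ψ) (𝟙 X)) ∧
      Nonempty (Homotopy (ψ ≫ φ) (𝟙 Y)) := by
  constructor
  · intro h
    obtain ⟨ψ, hψ⟩ := (HomotopyCategory.quotient V (ComplexShape.up ℤ)).map_surjective
      (inv ((HomotopyCategory.quotient V (ComplexShape.up ℤ)).map φ))
    refine ⟨ψ, ⟨HomotopyCategory.homotopyOfEq _ _ ?_⟩, ⟨HomotopyCategory.homotopyOfEq _ _ ?_⟩⟩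
    · rw [Functor.map_comp, hψ, IsIso.hom_inv_id, CategoryTheory.Functor.map_id]
    · rw [Functor.map_comp, hψ, IsIso.inv_hom_id, CategoryTheory.Functor.map_id]
  · rintro ⟨ψ, ⟨h₁⟩, ⟨h₂⟩⟩
    refine ⟨(HomotopyCategory.quotient V (ComplexShape.up ℤ)).map ψ, ?_, ?_⟩
    · rw [← Functor.map_comp, ← CategoryTheory.Functor.map_id]
      exact HomotopyCategory.eq_of_homotopy _ _ h₁
    · rw [← Functor.map_comp, ← CategoryTheory.Functor.map_id]
      exact HomotopyCategory.eq_of_homotopy _ _ h₂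

lemma IsHomotopyIso.comp {X Y Z : CochainComplex V ℤ} {φ : X ⟶ Y} {ψ : Y ⟶ Z}
    (h₁ : IsHomotopyIso φ) (h₂ : IsHomotopyIso ψ) : IsHomotopyIso (φ ≫ ψ) := by
  unfold IsHomotopyIso
  rw [Functor.map_comp]
  infer_instance

lemma isHomotopyIso_of_isIso {X Y : CochainComplex V ℤ} (φ : X ⟶ Y) [IsIso φ] :
    IsHomotopyIso φ := by
  unfold IsHomotopyIso
  infer_instance

lemma isHomotopyIso_iff_of_arrow_iso {X Y X' Y' : CochainComplex V ℤ} {φ : X ⟶ Y} {φ' : X' ⟶ Y'}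
    (a : X ≅ X') (b : Y ≅ Y') (w : φ ≫ b.hom = a.hom ≫ φ') :
    IsHomotopyIso φ ↔ IsHomotopyIso φ' := by
  have e : φ = a.hom ≫ φ' ≫ b.inv := by rw [← Category.assoc, ← w]; simp
  have e' : φ' = a.inv ≫ φ ≫ b.hom := by rw [w]; simp
  constructor
  · intro h
    rw [e']
    exact (isHomotopyIso_of_isIso _).comp (h.comp (isHomotopyIso_of_isIso _))
  · intro h
    rw [e]
    exact (isHomotopyIso_of_isIso _).comp (h.comp (isHomotopyIso_of_isIso _))

lemma isHomotopyIso_iff_cone [HasBinaryBiproducts V] [HasZeroObject V]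
    {X Y : CochainComplex V ℤ} (φ : X ⟶ Y) :
    IsHomotopyIso φ ↔ Nonempty (Homotopy (𝟙 (CochainComplex.mappingCone φ)) 0) := by
  have h := HomotopyCategory.mappingCone_triangleh_distinguished φ
  rw [← HomotopyCategory.isZero_quotient_obj_iff]
  exact ((CochainComplex.mappingCone.triangleh φ).isZero₃_iff_isIso₁ h).symm

variable {V' : Type*} [Category* V'] [Preadditive V']

/-- A functor between categories of complexes preserves homotopies. -/
def PreservesHomotopies (G : CochainComplex V ℤ ⥤ CochainComplex V' ℤ) : Prop :=
  ∀ ⦃X Y : CochainComplex V ℤ⦄ (f g : X ⟶ Y), Homotopy f g →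
    Nonempty (Homotopy (G.map f) (G.map g))

lemma PreservesHomotopies.comp {V'' : Type*} [Category* V''] [Preadditive V'']
    {G : CochainComplex V ℤ ⥤ CochainComplex V' ℤ} {G' : CochainComplex V' ℤ ⥤ CochainComplex V'' ℤ}
    (hG : PreservesHomotopies G) (hG' : PreservesHomotopies G') : PreservesHomotopies (G ⋙ G') :=
  fun _ _ _ _ H => hG' _ _ (hG _ _ H).some

end HomotopyEquivalences

section RelQuasiIso

variable {C : Type u} [SmallCategory C] {k : Type u} [CommRing k] {A : Cᵒᵖ ⥤ AlgCat.{u} k}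

lemma isRelQuasiIso_iff {M N : CochainComplex (AMod A) ℤ} (φ : M ⟶ N) :
    IsRelQuasiIso φ ↔ ∀ i : C,
      IsHomotopyIso (((evalK A i).mapHomologicalComplex (ComplexShape.up ℤ)).map φ) :=
  forall_congr' fun _ => (isHomotopyIso_iff_cone _).symm

end RelQuasiIso

section Truncation

variable {V : Type*} [Category* V] [Preadditive V]

/-- The complex `T` is the canonical truncation of `X` in degrees `≤ n`, via `ι : T ⟶ X`. -/
structure IsTrunc (n : ℤ) {T X : CochainComplex V ℤ} (ι : T ⟶ X) : Prop where
  mono (m : ℤ) : Mono (ι.f m)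
  d_eq_zero (m : ℤ) : n ≤ m → ι.f m ≫ X.d m (m + 1) = 0
  eq_zero (m : ℤ) : n < m → ι.f m = 0
  exists_lift (m : ℤ) {Z : V} (f : Z ⟶ X.X m) : (n ≤ m → f ≫ X.d m (m + 1) = 0) →
    (n < m → f = 0) → ∃ g : Z ⟶ T.X m, g ≫ ι.f m = f

namespace IsTrunc

variable {n : ℤ} {T X : CochainComplex V ℤ} {ι : T ⟶ X}

lemma isZero (h : IsTrunc n ι) (m : ℤ) (hm : n < m) : IsZero (T.X m) := by
  have := h.mono m
  rw [IsZero.iff_id_eq_zero, ← cancel_mono (ι.f m), h.eq_zero m hm, comp_zero, comp_zero]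

lemma exists_homLift (h : IsTrunc n ι) {Z : CochainComplex V ℤ}
    (hZ : ∀ m, n < m → IsZero (Z.X m)) (φ : Z ⟶ X) : ∃ ψ : Z ⟶ T, ψ ≫ ι = φ := by
  have H (m : ℤ) : ∃ g : Z.X m ⟶ T.X m, g ≫ ι.f m = φ.f m :=
    h.exists_lift m _ (fun hm => by
      rw [φ.comm, (hZ (m + 1) (by lia)).eq_of_src (φ.f (m + 1)) 0, comp_zero])
      (fun hm => (hZ m hm).eq_of_src _ _)
  choose g hg using H
  refine ⟨{ f := g, comm' := fun i j _ => ?_ }, ?_⟩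
  · have := h.mono j
    rw [← cancel_mono (ι.f j), Category.assoc, Category.assoc, hg, ← ι.comm, ← Category.assoc,
      hg, φ.comm]
  · ext m
    exact hg m

lemma hom_ext (h : IsTrunc n ι) {Z : CochainComplex V ℤ} {φ ψ : Z ⟶ T} (e : φ ≫ ι = ψ ≫ ι) :
    φ = ψ := by
  ext m
  have := h.mono m
  rw [← cancel_mono (ι.f m)]
  exact HomologicalComplex.congr_hom e m

lemma homotopy_of_comp (h : IsTrunc n ι) {Z : CochainComplex V ℤ}
    (hZ : ∀ m, n < m → IsZero (Z.X m)) {φ ψ : Z ⟶ T} (H : Homotopy (φ ≫ ι) (ψ ≫ ι)) :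
    Nonempty (Homotopy φ ψ) := by
  have H' (i j : ℤ) : ∃ g : Z.X i ⟶ T.X j, g ≫ ι.f j = H.hom i j := by
    by_cases hij : j + 1 = i
    · refine h.exists_lift j _ (fun hj => ?_) (fun hj => ?_)
      · exact (hZ i (by lia)).eq_of_src _ _
      · exact (hZ i (by lia)).eq_of_src _ _
    · exact ⟨0, by rw [zero_comp, H.zero i j hij]⟩
  choose g hg using H'
  refine ⟨{ hom := g, zero := fun i j hij => ?_, comm := fun i => ?_ }⟩
  · have := h.mono j
    rw [← cancel_mono (ι.f j), hg, H.zero i j hij, zero_comp]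
  · have := h.mono i
    rw [← cancel_mono (ι.f i)]
    have e := H.comm i
    have r₁ : (ComplexShape.up ℤ).Rel (i - 1) i := by simp
    have r₂ : (ComplexShape.up ℤ).Rel i (i + 1) := by simp
    rw [dNext_eq _ r₂, prevD_eq _ r₁] at e ⊢
    simp only [HomologicalComplex.comp_f] at e
    rw [e]
    simp only [Preadditive.add_comp, Category.assoc, hg, ← ι.comm]
    rw [← Category.assoc (g i (i - 1)), hg]

lemma isHomotopyIso {T' X' : CochainComplex V ℤ} {ι' : T' ⟶ X'} (h : IsTrunc n ι)
    (h' : IsTrunc n ι') {t : T ⟶ T'} {φ : X ⟶ X'} (w : t ≫ ι' = ι ≫ φ) (hφ : IsHomotopyIso φ) :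
    IsHomotopyIso t := by
  obtain ⟨ψ, ⟨h₁⟩, ⟨h₂⟩⟩ := (isHomotopyIso_iff _).1 hφ
  obtain ⟨s, hs⟩ := h.exists_homLift h'.isZero (ι' ≫ ψ)
  refine (isHomotopyIso_iff _).2 ⟨s, h.homotopy_of_comp h.isZero ?_,
    h'.homotopy_of_comp h'.isZero ?_⟩
  · refine (Homotopy.ofEq ?_).trans ((h₁.compLeft ι).trans (Homotopy.ofEq ?_))
    · rw [Category.assoc, hs, ← Category.assoc, w, Category.assoc]
    · simp
  · refine (Homotopy.ofEq ?_).trans ((h₂.compLeft ι').trans (Homotopy.ofEq ?_))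
    · rw [Category.assoc, w, ← Category.assoc, hs, Category.assoc]
    · simp

lemma isIso_of_isZero (h : IsTrunc n ι) (hX : ∀ m, n < m → IsZero (X.X m)) : IsIso ι := by
  obtain ⟨ψ, hψ⟩ := h.exists_homLift hX (𝟙 X)
  exact ⟨ψ, h.hom_ext (by simp [hψ]), hψ⟩

end IsTrunc

variable [HasKernels V]

section

variable (n : ℤ) (X : CochainComplex V ℤ)

lemma kernel_ι_smul_comp {c : ℤ} (hc : c = 1) {P Q : V} (f : P ⟶ Q) :
    kernel.ι (c • f) ≫ f = 0 := by
  subst hc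
  have := kernel.condition ((1 : ℤ) • f)
  rw [Preadditive.comp_zsmul] at this
  exact (one_smul ℤ (kernel.ι ((1 : ℤ) • f) ≫ f)).symm.trans this

/-- The terms of the canonical truncation. -/
abbrev truncX (m : ℤ) : V :=
  kernel ((if n < m then (1 : ℤ) else 0) •
    kernel.ι ((if n ≤ m then (1 : ℤ) else 0) • X.d m (m + 1)))

/-- The inclusion of the terms of the canonical truncation. -/
def truncIncl (m : ℤ) : truncX n X m ⟶ X.X m :=
  kernel.ι _ ≫ kernel.ι _

instance (m : ℤ) : Mono (truncIncl n X m) := mono_comp _ _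

lemma truncIncl_d (m : ℤ) (h : n ≤ m) : truncIncl n X m ≫ X.d m (m + 1) = 0 := by
  rw [truncIncl, Category.assoc, kernel_ι_smul_comp (if_pos h), comp_zero]

lemma truncIncl_eq_zero (m : ℤ) (h : n < m) : truncIncl n X m = 0 :=
  kernel_ι_smul_comp (if_pos h) _

lemma exists_truncLift (m : ℤ) {Z : V} (f : Z ⟶ X.X m) (h₁ : n ≤ m → f ≫ X.d m (m + 1) = 0)
    (h₂ : n < m → f = 0) : ∃ g : Z ⟶ truncX n X m, g ≫ truncIncl n X m = f := by
  have e₁ : f ≫ ((if n ≤ m then (1 : ℤ) else 0) • X.d m (m + 1)) = 0 := by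
    rw [Preadditive.comp_zsmul]
    split_ifs with h
    · rw [h₁ h, smul_zero]
    · rw [zero_smul]
  have e₂ : kernel.lift _ f e₁ ≫ ((if n < m then (1 : ℤ) else 0) •
      kernel.ι ((if n ≤ m then (1 : ℤ) else 0) • X.d m (m + 1))) = 0 := by
    rw [Preadditive.comp_zsmul, kernel.lift_ι]
    split_ifs with h
    · rw [h₂ h, smul_zero]
    · rw [zero_smul]
  exact ⟨kernel.lift _ _ e₂, by rw [truncIncl, kernel.lift_ι_assoc, kernel.lift_ι]⟩

lemma exists_truncD (i j : ℤ) :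
    ∃ g : truncX n X i ⟶ truncX n X j, g ≫ truncIncl n X j = truncIncl n X i ≫ X.d i j := by
  by_cases hij : i + 1 = j
  · subst hij
    refine exists_truncLift _ _ _ _ (fun _ => by simp) (fun h => truncIncl_d n X i (by lia))
  · exact ⟨0, by rw [X.shape i j hij, zero_comp, comp_zero]⟩

/-- The canonical truncation of a complex in degrees `≤ n`. -/
def trunc : CochainComplex V ℤ where
  X := truncX n X
  d i j := (exists_truncD n X i j).choose
  shape i j h := by
    rw [← cancel_mono (truncIncl n X j), (exists_truncD n X i j).choose_spec, X.shape i j h,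
      zero_comp, comp_zero]
  d_comp_d' i j l _ _ := by
    rw [← cancel_mono (truncIncl n X l), Category.assoc, (exists_truncD n X j l).choose_spec,
      ← Category.assoc, (exists_truncD n X i j).choose_spec, Category.assoc, X.d_comp_d,
      zero_comp, comp_zero]

/-- The inclusion of the canonical truncation. -/
def truncι : trunc n X ⟶ X where
  f := truncIncl n X
  comm' i j _ := ((exists_truncD n X i j).choose_spec).symm

lemma isTrunc_truncι : IsTrunc n (truncι n X) where
  mono m := inferInstanceAs (Mono (truncIncl n X m))
  d_eq_zero := truncIncl_d n X
  eq_zero := truncIncl_eq_zero n X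
  exists_lift m _ := exists_truncLift n X m

end

lemma exists_truncMap (n : ℤ) {X Y : CochainComplex V ℤ} (φ : X ⟶ Y) :
    ∃ ψ : trunc n X ⟶ trunc n Y, ψ ≫ truncι n Y = truncι n X ≫ φ :=
  (isTrunc_truncι n Y).exists_homLift (isTrunc_truncι n X).isZero _

variable (V) in
/-- The canonical truncation functor. -/
def truncFunctor (n : ℤ) : CochainComplex V ℤ ⥤ CochainComplex V ℤ where
  obj X := trunc n X
  map φ := (exists_truncMap n φ).choose
  map_id X := (isTrunc_truncι n X).hom_ext
    ((exists_truncMap n (𝟙 X)).choose_spec.trans (by simp))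
  map_comp φ ψ := (isTrunc_truncι n _).hom_ext
    ((exists_truncMap n (φ ≫ ψ)).choose_spec.trans (by
      rw [Category.assoc]
      erw [(exists_truncMap n ψ).choose_spec]
      rw [← Category.assoc, ← Category.assoc]
      exact congr($((exists_truncMap n φ).choose_spec.symm) ≫ ψ)))

lemma truncFunctor_map_ι (n : ℤ) {X Y : CochainComplex V ℤ} (φ : X ⟶ Y) :
    (truncFunctor V n).map φ ≫ truncι n Y = truncι n X ≫ φ :=
  (exists_truncMap n φ).choose_spec

variable (V) in
lemma preservesHomotopies_truncFunctor (n : ℤ) : PreservesHomotopies (truncFunctor V n) := by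
  intro X Y f g H
  refine (isTrunc_truncι n Y).homotopy_of_comp (isTrunc_truncι n X).isZero ?_
  refine (Homotopy.ofEq (truncFunctor_map_ι n f)).trans ((H.compLeft _).trans
    (Homotopy.ofEq (truncFunctor_map_ι n g).symm))

lemma IsTrunc.map {V' : Type*} [Category* V'] [Preadditive V'] [HasKernels V']
    (F : V ⥤ V') [F.Additive]
    [PreservesFiniteLimits F] (n : ℤ) (X : CochainComplex V ℤ) :
    IsTrunc n ((F.mapHomologicalComplex (ComplexShape.up ℤ)).map (truncι n X)) where
  mono m := by
    change Mono (F.map (truncIncl n X m))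
    infer_instance
  d_eq_zero m h := by
    change F.map (truncIncl n X m) ≫ F.map (X.d m (m + 1)) = 0
    rw [← F.map_comp, truncIncl_d n X m h, F.map_zero]
  eq_zero m h := by
    change F.map (truncIncl n X m) = 0
    rw [truncIncl_eq_zero n X m h, F.map_zero]
  exists_lift m Z f h₁ h₂ := by
    change Z ⟶ F.obj (X.X m) at f
    change _ → f ≫ F.map (X.d m (m + 1)) = 0 at h₁
    change _ → f = (0 : Z ⟶ F.obj (X.X m)) at h₂
    change ∃ g : Z ⟶ F.obj (truncX n X m), g ≫ F.map (truncIncl n X m) = f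
    have L (A B : V) (a : A ⟶ B) (c : Z ⟶ F.obj A) (hc : c ≫ F.map a = 0) :
        ∃ e : Z ⟶ F.obj (kernel a), e ≫ F.map (kernel.ι a) = c := by
      refine ⟨kernel.lift _ c hc ≫ (PreservesKernel.iso F a).inv, ?_⟩
      simp
    have e₁ : f ≫ F.map ((if n ≤ m then (1 : ℤ) else 0) • X.d m (m + 1)) = 0 := by
      rw [Functor.map_zsmul, Preadditive.comp_zsmul]
      split_ifs with h
      · rw [h₁ h, smul_zero]
      · rw [zero_smul]
    obtain ⟨g, hg⟩ := L _ _ _ f e₁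
    have e₂ : g ≫ F.map ((if n < m then (1 : ℤ) else 0) •
        kernel.ι ((if n ≤ m then (1 : ℤ) else 0) • X.d m (m + 1))) = 0 := by
      rw [Functor.map_zsmul, Preadditive.comp_zsmul, hg]
      split_ifs with h
      · rw [h₂ h, smul_zero]
      · rw [zero_smul]
    obtain ⟨g', hg'⟩ := L _ _ _ g e₂
    refine ⟨g', ?_⟩
    rw [truncIncl, F.map_comp, ← Category.assoc, hg', hg]

end Truncation

open CochainComplex HomComplex

/-- A functor from `V` to cochain complexes in `W` concentrated in degrees `≥ 0`. -/
structure CochainFunctor (V W : Type*) [Category* V] [Category* W] [Preadditive V]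
    [Preadditive W] where
  /-- the terms -/
  R : ℕ → V ⥤ W
  additive (p : ℕ) : (R p).Additive
  /-- the differential -/
  D (p : ℕ) : R p ⟶ R (p + 1)
  D_comp_D (p : ℕ) : D p ≫ D (p + 1) = 0

attribute [instance] CochainFunctor.additive

/-- Pairs `(p, q)` with `p ≥ 0` and `p + q = m`. -/
abbrev TotIndex (m : ℤ) : Type := {x : ℕ × ℤ // (x.1 : ℤ) + x.2 = m}

namespace CochainFunctor

section

variable {V W : Type*} [Category* V] [Category* W] [Preadditive V]
  [Preadditive W] (R : CochainFunctor V W)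

lemma D_app_comp (p : ℕ) (X : V) : (R.D p).app X ≫ (R.D (p + 1)).app X = 0 := by
  rw [← NatTrans.comp_app, R.D_comp_D]
  rfl

/-- Postcomposition with an additive functor. -/
abbrev postcomp {W' : Type*} [Category* W'] [Preadditive W'] (F : W ⥤ W') [F.Additive] :
    CochainFunctor V W' where
  R p := R.R p ⋙ F
  additive p := inferInstance
  D p := Functor.whiskerRight (R.D p) F
  D_comp_D p := by
    ext X
    simp [← F.map_comp, R.D_app_comp]

/-- Precomposition with an additive functor. -/
abbrev precomp {V' : Type*} [Category* V'] [Preadditive V'] (F : V' ⥤ V) [F.Additive] :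
    CochainFunctor V' W where
  R p := F ⋙ R.R p
  additive p := inferInstance
  D p := Functor.whiskerLeft F (R.D p)
  D_comp_D p := by
    ext X
    simp [R.D_app_comp]

variable [∀ m, HasProductsOfShape (TotIndex m) W]

/-- The terms of the product total complex. -/
abbrev totX (N : CochainComplex V ℤ) (m : ℤ) : W :=
  ∏ᶜ fun x : TotIndex m => (R.R x.1.1).obj (N.X x.1.2)

/-- The projections of the product total complex. -/
abbrev totπ (N : CochainComplex V ℤ) (m : ℤ) (p : ℕ) (q : ℤ) (h : (p : ℤ) + q = m) :
    R.totX N m ⟶ (R.R p).obj (N.X q) :=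
  Pi.π (fun x : TotIndex m => (R.R x.1.1).obj (N.X x.1.2)) ⟨(p, q), h⟩

/-- Maps to the terms of the product total complex. -/
def totLift {N : CochainComplex V ℤ} {m : ℤ} {Z : W}
    (f : ∀ (p : ℕ) (q : ℤ) (_ : (p : ℤ) + q = m), Z ⟶ (R.R p).obj (N.X q)) : Z ⟶ R.totX N m :=
  Pi.lift fun x => f x.1.1 x.1.2 x.2

variable {R}

@[simp]
lemma totLift_π {N : CochainComplex V ℤ} {m : ℤ} {Z : W}
    (f : ∀ (p : ℕ) (q : ℤ) (_ : (p : ℤ) + q = m), Z ⟶ (R.R p).obj (N.X q))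
    (p : ℕ) (q : ℤ) (h : (p : ℤ) + q = m) : R.totLift f ≫ R.totπ N m p q h = f p q h :=
  Pi.lift_π _ _

lemma totLift_π_assoc {N : CochainComplex V ℤ} {m : ℤ} {Z Z' : W}
    (f : ∀ (p : ℕ) (q : ℤ) (_ : (p : ℤ) + q = m), Z ⟶ (R.R p).obj (N.X q))
    (p : ℕ) (q : ℤ) (h : (p : ℤ) + q = m) (t : (R.R p).obj (N.X q) ⟶ Z') :
    R.totLift f ≫ R.totπ N m p q h ≫ t = f p q h ≫ t := by
  rw [← Category.assoc, totLift_π]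

lemma tot_ext {N : CochainComplex V ℤ} {m : ℤ} {Z : W} {f g : Z ⟶ R.totX N m}
    (h : ∀ (p : ℕ) (q : ℤ) (h : (p : ℤ) + q = m), f ≫ R.totπ N m p q h = g ≫ R.totπ N m p q h) :
    f = g :=
  Pi.hom_ext _ _ fun x => h x.1.1 x.1.2 x.2

variable (R)

/-- The part of the differential of the total complex coming from the cochain functor. -/
def totVert (N : CochainComplex V ℤ) (m m' : ℤ) (h : m + 1 = m') : R.totX N m ⟶ R.totX N m' :=
  R.totLift fun p q hpq => match p with
    | 0 => 0
    | p + 1 => R.totπ N m p q (by push_cast at hpq; lia) ≫ (R.D p).app (N.X q)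

lemma totVert_π_zero (N : CochainComplex V ℤ) (m m' : ℤ) (h : m + 1 = m') (q : ℤ)
    (hq : ((0 : ℕ) : ℤ) + q = m') : R.totVert N m m' h ≫ R.totπ N m' 0 q hq = 0 :=
  totLift_π _ _ _ _

lemma totVert_π_zero_assoc (N : CochainComplex V ℤ) (m m' : ℤ) (h : m + 1 = m') (q : ℤ)
    (hq : ((0 : ℕ) : ℤ) + q = m') {Z : W} (t : (R.R 0).obj (N.X q) ⟶ Z) :
    R.totVert N m m' h ≫ R.totπ N m' 0 q hq ≫ t = 0 ≫ t := by
  rw [← Category.assoc, totVert_π_zero]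

lemma totVert_π_succ (N : CochainComplex V ℤ) (m m' : ℤ) (h : m + 1 = m') (p : ℕ) (q : ℤ)
    (hq : ((p + 1 : ℕ) : ℤ) + q = m') : R.totVert N m m' h ≫ R.totπ N m' (p + 1) q hq =
      R.totπ N m p q (by push_cast at hq; lia) ≫ (R.D p).app (N.X q) :=
  totLift_π _ _ _ _

lemma totVert_π_succ_assoc (N : CochainComplex V ℤ) (m m' : ℤ) (h : m + 1 = m') (p : ℕ) (q : ℤ)
    (hq : ((p + 1 : ℕ) : ℤ) + q = m') {Z : W} (t : (R.R (p + 1)).obj (N.X q) ⟶ Z) :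
    R.totVert N m m' h ≫ R.totπ N m' (p + 1) q hq ≫ t =
      R.totπ N m p q (by push_cast at hq; lia) ≫ (R.D p).app (N.X q) ≫ t := by
  rw [← Category.assoc, totVert_π_succ, Category.assoc]

lemma totVert_π_comp_D (N : CochainComplex V ℤ) (m m' : ℤ) (h : m + 1 = m') (p : ℕ) (q : ℤ)
    (hq : (p : ℤ) + q = m') : R.totVert N m m' h ≫ R.totπ N m' p q hq ≫ (R.D p).app (N.X q) = 0 := by
  cases p with
  | zero => rw [totVert_π_zero_assoc, zero_comp]
  | succ p => rw [totVert_π_succ_assoc, R.D_app_comp, comp_zero]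

/-- The map induced by a cochain on the terms of total complexes. -/
def totMap {X Y : CochainComplex V ℤ} {n : ℤ} (z : Cochain X Y n) (m m' : ℤ) (h : m + n = m') :
    R.totX X m ⟶ R.totX Y m' :=
  R.totLift fun p q hpq => R.totπ X m p (q - n) (by lia) ≫ (R.R p).map (z.v (q - n) q (by lia))

lemma totMap_π {X Y : CochainComplex V ℤ} {n : ℤ} (z : Cochain X Y n) (m m' : ℤ) (h : m + n = m')
    (p : ℕ) (q q' : ℤ) (hq : (p : ℤ) + q' = m') (hqq' : q + n = q') :
    R.totMap z m m' h ≫ R.totπ Y m' p q' hq =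
      R.totπ X m p q (by lia) ≫ (R.R p).map (z.v q q' hqq') := by
  obtain rfl : q = q' - n := by lia
  exact totLift_π _ _ _ _

lemma totMap_π_assoc {X Y : CochainComplex V ℤ} {n : ℤ} (z : Cochain X Y n) (m m' : ℤ)
    (h : m + n = m') (p : ℕ) (q q' : ℤ) (hq : (p : ℤ) + q' = m') (hqq' : q + n = q') {Z : W}
    (t : (R.R p).obj (Y.X q') ⟶ Z) : R.totMap z m m' h ≫ R.totπ Y m' p q' hq ≫ t =
      R.totπ X m p q (by lia) ≫ (R.R p).map (z.v q q' hqq') ≫ t := by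
  rw [← Category.assoc, R.totMap_π z m m' h p q q' hq hqq', Category.assoc]

lemma totMap_totVert {X Y : CochainComplex V ℤ} {n : ℤ} (z : Cochain X Y n) (m₁ m₁' m₂ m₂' : ℤ)
    (h₁ : m₁ + n = m₁') (h₂ : m₂ + n = m₂') (h : m₁ + 1 = m₂) (h' : m₁' + 1 = m₂') :
    R.totMap z m₁ m₁' h₁ ≫ R.totVert Y m₁' m₂' h' =
      R.totVert X m₁ m₂ h ≫ R.totMap z m₂ m₂' h₂ := by
  refine tot_ext fun p q hpq => ?_
  rw [Category.assoc, Category.assoc, R.totMap_π z m₂ m₂' h₂ p (q - n) q hpq (by lia)]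
  cases p with
  | zero => rw [totVert_π_zero, totVert_π_zero_assoc, comp_zero, zero_comp]
  | succ p =>
    rw [totVert_π_succ, totVert_π_succ_assoc, totMap_π_assoc _ _ _ _ _ _ (q - n) q _ (by lia)]
    simp

/-- The differential of the product total complex. -/
def totD (N : CochainComplex V ℤ) (m m' : ℤ) : R.totX N m ⟶ R.totX N m' :=
  if h : m + 1 = m' then R.totMap (Cochain.diff N) m m' h + m.negOnePow • R.totVert N m m' h
  else 0

lemma totD_eq (N : CochainComplex V ℤ) (m m' : ℤ) (h : m + 1 = m') :
    R.totD N m m' = R.totMap (Cochain.diff N) m m' h + m.negOnePow • R.totVert N m m' h :=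
  dif_pos h

lemma totD_π (N : CochainComplex V ℤ) (m m' : ℤ) (h : m + 1 = m') (p : ℕ) (q q' : ℤ)
    (hq : (p : ℤ) + q' = m') (hqq' : q + 1 = q') :
    R.totD N m m' ≫ R.totπ N m' p q' hq = R.totπ N m p q (by lia) ≫ (R.R p).map (N.d q q') +
      m.negOnePow • (R.totVert N m m' h ≫ R.totπ N m' p q' hq) := by
  rw [totD_eq _ _ _ _ h, Preadditive.add_comp, R.totMap_π _ m m' h p q q' hq hqq',
    Cochain.diff_v, Linear.units_smul_comp]

lemma totD_comp_totD (N : CochainComplex V ℤ) (m₁ m₂ m₃ : ℤ) (h : m₁ + 1 = m₂) (h' : m₂ + 1 = m₃) :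
    R.totD N m₁ m₂ ≫ R.totD N m₂ m₃ = 0 := by
  refine tot_ext fun p q hpq => ?_
  rw [Category.assoc, R.totD_π N m₂ m₃ h' p (q - 1) q hpq (by lia), Preadditive.comp_add,
    ← Category.assoc, R.totD_π N m₁ m₂ h p (q - 2) (q - 1) (by lia) (by lia), zero_comp]
  have e : (R.R p).map (N.d (q - 2) (q - 1)) ≫ (R.R p).map (N.d (q - 1) q) = 0 := by
    rw [← Functor.map_comp, N.d_comp_d, Functor.map_zero]
  rw [Preadditive.add_comp, Category.assoc, e, comp_zero, zero_add, Linear.comp_units_smul]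
  cases p with
  | zero => simp only [totVert_π_zero, comp_zero, smul_zero, zero_comp, add_zero]
  | succ p =>
    rw [totVert_π_succ, totVert_π_succ, ← Category.assoc (R.totD N m₁ m₂),
      R.totD_π N m₁ m₂ h p (q - 1) q (by push_cast at hpq; lia) (by lia),
      Preadditive.add_comp, Linear.units_smul_comp, Linear.units_smul_comp, Category.assoc,
      Category.assoc, Category.assoc, totVert_π_comp_D, smul_zero, add_zero,
      show m₂.negOnePow = -m₁.negOnePow by rw [← h, Int.negOnePow_succ], Units.neg_smul, NatTrans.naturality, add_neg_cancel]

/-- The product total complex of the double complex obtained by applying a cochain functor to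
a complex. -/
abbrev tot (N : CochainComplex V ℤ) : CochainComplex W ℤ where
  X := R.totX N
  d := R.totD N
  shape _ _ h := dif_neg h
  d_comp_d' _ _ _ h h' := R.totD_comp_totD N _ _ _ h h'

/-- The cochain between total complexes induced by a cochain. -/
def totCochain {X Y : CochainComplex V ℤ} {n : ℤ} (z : Cochain X Y n) :
    Cochain (R.tot X) (R.tot Y) n :=
  Cochain.mk fun m m' h => R.totMap z m m' h

lemma totCochain_v {X Y : CochainComplex V ℤ} {n : ℤ} (z : Cochain X Y n) (m m' : ℤ)
    (h : m + n = m') : (R.totCochain z).v m m' h = R.totMap z m m' h := rfl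

lemma totMap_add {X Y : CochainComplex V ℤ} {n : ℤ} (z z' : Cochain X Y n) (m m' : ℤ)
    (h : m + n = m') : R.totMap (z + z') m m' h = R.totMap z m m' h + R.totMap z' m m' h := by
  refine tot_ext fun p q hpq => ?_
  rw [Preadditive.add_comp, R.totMap_π _ _ _ h p (q - n) q hpq (by lia),
    R.totMap_π _ _ _ h p (q - n) q hpq (by lia), R.totMap_π _ _ _ h p (q - n) q hpq (by lia),
    Cochain.add_v, Functor.map_add, Preadditive.comp_add]

lemma totMap_units_smul {X Y : CochainComplex V ℤ} {n : ℤ} (a : ℤˣ) (z : Cochain X Y n) (m m' : ℤ)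
    (h : m + n = m') : R.totMap (a • z) m m' h = a • R.totMap z m m' h := by
  refine tot_ext fun p q hpq => ?_
  rw [Linear.units_smul_comp, R.totMap_π _ _ _ h p (q - n) q hpq (by lia),
    R.totMap_π _ _ _ h p (q - n) q hpq (by lia), Cochain.units_smul_v, Functor.map_units_smul,
    Linear.comp_units_smul]

lemma totMap_comp {X Y Z : CochainComplex V ℤ} {n n' n'' : ℤ} (z : Cochain X Y n)
    (z' : Cochain Y Z n') (h : n + n' = n'') (m m' m'' : ℤ) (hm : m + n = m') (hm' : m' + n' = m'') :
    R.totMap (z.comp z' h) m m'' (by lia) = R.totMap z m m' hm ≫ R.totMap z' m' m'' hm' := by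
  refine tot_ext fun p q hpq => ?_
  rw [Category.assoc, R.totMap_π z' _ _ hm' p (q - n') q hpq (by lia),
    R.totMap_π_assoc z _ _ hm p (q - n'') (q - n') (by lia) (by lia),
    R.totMap_π (z.comp z' h) m m'' (by lia) p (q - n'') q hpq (by lia),
    Cochain.comp_v z z' h (q - n'') (q - n') q (by lia) (by lia), Functor.map_comp]

lemma totCochain_comp {X Y Z : CochainComplex V ℤ} {n n' n'' : ℤ} (z : Cochain X Y n)
    (z' : Cochain Y Z n') (h : n + n' = n'') :
    R.totCochain (z.comp z' h) = (R.totCochain z).comp (R.totCochain z') h := by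
  refine Cochain.ext _ _ fun m m' hm => ?_
  rw [Cochain.comp_v _ _ h m (m + n) m' rfl (by lia)]
  exact R.totMap_comp z z' h m (m + n) m' rfl (by lia)

lemma totCochain_add {X Y : CochainComplex V ℤ} {n : ℤ} (z z' : Cochain X Y n) :
    R.totCochain (z + z') = R.totCochain z + R.totCochain z' := by
  refine Cochain.ext _ _ fun m m' hm => ?_
  exact R.totMap_add z z' m m' hm

lemma totCochain_zero {X Y : CochainComplex V ℤ} {n : ℤ} :
    R.totCochain (0 : Cochain X Y n) = 0 := by
  simpa using R.totCochain_add (0 : Cochain X Y n) 0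

lemma δ_totCochain {X Y : CochainComplex V ℤ} {n n' : ℤ} (h : n + 1 = n') (z : Cochain X Y n) :
    δ n n' (R.totCochain z) = R.totCochain (δ n n' z) := by
  have e : δ n n' z = z.comp (Cochain.diff Y) h +
      n'.negOnePow • (Cochain.diff X).comp z (by lia) := by
    ext p q hpq
    rw [δ_v n n' h z p q hpq (q - 1) (p + 1) rfl rfl, Cochain.add_v, Cochain.units_smul_v,
      Cochain.comp_v _ _ h p (q - 1) q (by lia) (by lia),
      Cochain.comp_v (Cochain.diff X) z (by lia : 1 + n = n') p (p + 1) q (by lia) (by lia)]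
    rfl
  refine Cochain.ext _ _ fun m m' hm => ?_
  rw [δ_v n n' h _ m m' hm (m' - 1) (m + 1) rfl rfl, totCochain_v, totCochain_v, totCochain_v, e,
    totMap_add, totMap_units_smul,
    R.totMap_comp z (Cochain.diff Y) h m (m' - 1) m' (by lia) (by lia),
    R.totMap_comp (Cochain.diff X) z (by lia : 1 + n = n') m (m + 1) m' (by lia) (by lia)]
  change R.totMap z m (m' - 1) _ ≫ R.totD Y (m' - 1) m' +
    n'.negOnePow • R.totD X m (m + 1) ≫ R.totMap z (m + 1) m' _ = _
  rw [R.totD_eq Y _ _ (by lia), R.totD_eq X _ _ rfl, Preadditive.comp_add, Preadditive.add_comp,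
    smul_add, Linear.comp_units_smul, Linear.units_smul_comp,
    R.totMap_totVert z m (m' - 1) (m + 1) m' (by lia) (by lia) rfl (by lia), smul_smul,
    ← Int.negOnePow_add,
    show (m' - 1).negOnePow = (n + m).negOnePow from congr_arg _ (by lia),
    show n' + m = n + m + 1 by lia, Int.negOnePow_succ, Units.neg_smul]
  abel

/-- The functoriality of the total complex. -/
def totHom {X Y : CochainComplex V ℤ} (φ : X ⟶ Y) : R.tot X ⟶ R.tot Y :=
  Cocycle.homOf (Cocycle.mk (R.totCochain (Cochain.ofHom φ)) 1 (zero_add 1) (by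
    rw [δ_totCochain _ (zero_add 1), δ_ofHom, totCochain_zero]))

lemma ofHom_totHom {X Y : CochainComplex V ℤ} (φ : X ⟶ Y) :
    Cochain.ofHom (R.totHom φ) = R.totCochain (Cochain.ofHom φ) := by
  rw [totHom, Cocycle.cochain_ofHom_homOf_eq_coe]
  rfl

lemma totHom_f_π {X Y : CochainComplex V ℤ} (φ : X ⟶ Y) (m : ℤ) (p : ℕ) (q : ℤ)
    (h : (p : ℤ) + q = m) : (R.totHom φ).f m ≫ R.totπ Y m p q h =
      R.totπ X m p q h ≫ (R.R p).map (φ.f q) := by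
  have := R.totMap_π (Cochain.ofHom φ) m m (add_zero m) p q q h (add_zero q)
  rwa [Cochain.ofHom_v] at this

lemma totHom_f_π_assoc {X Y : CochainComplex V ℤ} (φ : X ⟶ Y) (m : ℤ) (p : ℕ) (q : ℤ)
    (h : (p : ℤ) + q = m) {Z : W} (t : (R.R p).obj (Y.X q) ⟶ Z) :
    (R.totHom φ).f m ≫ R.totπ Y m p q h ≫ t = R.totπ X m p q h ≫ (R.R p).map (φ.f q) ≫ t := by
  rw [← Category.assoc, totHom_f_π, Category.assoc]

/-- The total complex functor. -/
abbrev totFunctor : CochainComplex V ℤ ⥤ CochainComplex W ℤ where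
  obj := R.tot
  map := R.totHom
  map_id X := by
    ext m : 1
    refine tot_ext fun p q hpq => ?_
    rw [totHom_f_π, HomologicalComplex.id_f, HomologicalComplex.id_f, CategoryTheory.Functor.map_id,
      Category.comp_id, Category.id_comp]
  map_comp φ ψ := by
    ext m : 1
    refine tot_ext fun p q hpq => ?_
    rw [totHom_f_π, HomologicalComplex.comp_f, HomologicalComplex.comp_f, Functor.map_comp]
    rw [Category.assoc, totHom_f_π, totHom_f_π_assoc]

lemma preservesHomotopies_totFunctor : PreservesHomotopies R.totFunctor := by
  intro X Y f g H
  refine ⟨(Cochain.equivHomotopy _ _).symm ⟨R.totCochain (Cochain.equivHomotopy _ _ H).1, ?_⟩⟩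
  rw [δ_totCochain _ (by lia), ofHom_totHom, ofHom_totHom, ← totCochain_add]
  exact congr_arg _ (Cochain.equivHomotopy _ _ H).2

end

end CochainFunctor

open CochainComplex HomComplex

namespace CochainFunctor

section

variable {V W : Type*} [Category* V] [Category* W] [Preadditive V]
  [Preadditive W] (R : CochainFunctor V W) [∀ m, HasProductsOfShape (TotIndex m) W]

/-- The mapping cone of a map of total complexes is a retract of the total complex of the
mapping cone. -/
lemma exists_retract_cone [HasBinaryBiproducts V] [HasBinaryBiproducts W]
    {X Y : CochainComplex V ℤ} (φ : X ⟶ Y) :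
    ∃ (i : mappingCone (R.totHom φ) ⟶ R.tot (mappingCone φ))
      (r : R.tot (mappingCone φ) ⟶ mappingCone (R.totHom φ)), i ≫ r = 𝟙 _ := by
  refine ⟨mappingCone.desc _ (R.totCochain (mappingCone.inl φ)) (R.totHom (mappingCone.inr φ)) ?_,
    mappingCone.lift _ (Cocycle.mk (R.totCochain (mappingCone.fst φ).1) 2 (by lia) ?_)
      (R.totCochain (mappingCone.snd φ)) ?_, ?_⟩
  · rw [R.δ_totCochain (by lia), mappingCone.δ_inl, ← ofHom_totHom]
    exact congr_arg _ (R.totFunctor.map_comp φ (mappingCone.inr φ))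
  · rw [R.δ_totCochain (by lia), Cocycle.δ_eq_zero, totCochain_zero]
  · rw [R.δ_totCochain (by lia), mappingCone.δ_snd, ofHom_totHom]
    change _ + (R.totCochain (mappingCone.fst φ).1).comp _ _ = 0
    rw [← totCochain_comp, ← totCochain_add, neg_add_cancel, totCochain_zero]
  · apply Cochain.ofHom_injective
    rw [Cochain.ofHom_comp, mappingCone.ofHom_desc, mappingCone.ofHom_lift]
    have h (Z : CochainComplex V ℤ) : R.totCochain (Cochain.ofHom (𝟙 Z)) = Cochain.ofHom (𝟙 _) := by
      rw [← ofHom_totHom]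
      exact congr_arg _ (R.totFunctor.map_id Z)
    rw [mappingCone.ext_cochain_from_iff _ (-1) 0 (by lia)]
    constructor
    · rw [← Cochain.comp_assoc_of_third_is_zero_cochain, mappingCone.inl_descCochain,
        mappingCone.ext_cochain_to_iff _ (-1) 0 (by lia)]
      constructor
      · rw [Cochain.comp_assoc_of_second_is_zero_cochain, mappingCone.liftCochain_fst,
          Cochain.comp_id, mappingCone.inl_fst]
        change (R.totCochain _).comp (R.totCochain (mappingCone.fst φ).1) _ = _
        rw [← totCochain_comp, mappingCone.inl_fst, h]
      · rw [Cochain.comp_assoc_of_second_is_zero_cochain, mappingCone.liftCochain_snd,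
          Cochain.comp_id, mappingCone.inl_snd, ← totCochain_comp, mappingCone.inl_snd,
          totCochain_zero]
    · rw [← Cochain.comp_assoc_of_third_is_zero_cochain, mappingCone.inr_descCochain,
        mappingCone.ext_cochain_to_iff _ 0 1 (by lia)]
      constructor
      · rw [Cochain.comp_assoc_of_second_is_zero_cochain, mappingCone.liftCochain_fst,
          Cochain.comp_id, mappingCone.inr_fst, ofHom_totHom]
        change (R.totCochain _).comp (R.totCochain (mappingCone.fst φ).1) _ = _
        rw [← totCochain_comp, mappingCone.inr_fst, totCochain_zero]
      · rw [Cochain.comp_assoc_of_second_is_zero_cochain, mappingCone.liftCochain_snd,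
          Cochain.comp_id, mappingCone.inr_snd, ofHom_totHom, ← totCochain_comp,
          mappingCone.inr_snd, h]

/-! ### Total complexes of double complexes with contractible rows -/

section

variable {R}

/-- An endomorphism of a product which is the identity up to terms raising the index `p` is
invertible. -/
lemma isIso_of_raising {N : CochainComplex V ℤ} {m : ℤ} (u : R.totX N m ⟶ R.totX N m)
    (hu : ∀ ⦃Z : W⦄ (f : Z ⟶ R.totX N m) (p : ℕ) (q : ℤ) (h : (p : ℤ) + q = m),
      (∀ (p' : ℕ) (q' : ℤ) (h' : (p' : ℤ) + q' = m), p' < p → f ≫ R.totπ N m p' q' h' = 0) →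
      f ≫ (u - 𝟙 _) ≫ R.totπ N m p q h = 0) : IsIso u := by
  let y : ℕ → (R.totX N m ⟶ R.totX N m) := fun j =>
    Nat.rec (𝟙 _) (fun _ z => 𝟙 _ - z ≫ (u - 𝟙 _)) j
  have hy (j : ℕ) : y (j + 1) = 𝟙 _ - y j ≫ (u - 𝟙 _) := rfl
  have h₁ (j : ℕ) (p : ℕ) (q : ℤ) (h : (p : ℤ) + q = m) (hp : p ≤ j) :
      (y (j + 1) - y j) ≫ R.totπ N m p q h = 0 := by
    induction j generalizing p q with
    | zero =>
      obtain rfl : p = 0 := by lia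
      have := hu (𝟙 _) 0 q h (fun p' _ _ hp' => by lia)
      rw [Category.id_comp] at this
      rw [hy 0, show y 0 = 𝟙 _ from rfl, Category.id_comp, sub_sub_cancel_left,
        Preadditive.neg_comp, this, neg_zero]
    | succ j hj =>
      rw [hy (j + 1)]
      nth_rw 2 [hy j]
      rw [sub_sub_sub_cancel_left, ← Preadditive.sub_comp, Category.assoc]
      refine hu _ p q h fun p' q' h' hp' => ?_
      rw [← neg_sub, Preadditive.neg_comp, hj p' q' h' (by lia), neg_zero]
  have h₂ (j p : ℕ) (q : ℤ) (h : (p : ℤ) + q = m) :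
      (y (p + j) - y p) ≫ R.totπ N m p q h = 0 := by
    induction j with
    | zero => simp
    | succ j hj =>
      rw [← sub_add_sub_cancel (y (p + (j + 1))) (y (p + j)) (y p), Preadditive.add_comp, hj,
        add_zero]
      exact h₁ (p + j) p q h (by lia)
  let v : R.totX N m ⟶ R.totX N m := R.totLift fun p q h => y p ≫ R.totπ N m p q h
  have h₃ (p p' : ℕ) (q' : ℤ) (h : (p' : ℤ) + q' = m) (hp : p' ≤ p) :
      (v - y p) ≫ R.totπ N m p' q' h = 0 := by
    have := h₂ (p - p') p' q' h
    rw [show p' + (p - p') = p by lia, Preadditive.sub_comp, sub_eq_zero] at this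
    rw [Preadditive.sub_comp, totLift_π, this, sub_self]
  have hvu : v ≫ u = 𝟙 _ := by
    refine tot_ext fun p q h => ?_
    have e₁ : (v - y p) ≫ (u - 𝟙 _) ≫ R.totπ N m p q h = 0 :=
      hu _ p q h fun p' q' h' hp' => h₃ p p' q' h' (by lia)
    have e₂ := h₃ (p + 1) p q h (by lia)
    rw [hy] at e₂
    simp only [Preadditive.sub_comp, Preadditive.comp_sub, Category.assoc, Category.id_comp,
      Category.comp_id] at e₁ e₂ ⊢
    rw [← sub_eq_zero, ← e₁]
    generalize v ≫ u ≫ R.totπ N m p q h = a at *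
    generalize v ≫ R.totπ N m p q h = b at *
    generalize y p ≫ R.totπ N m p q h = c at *
    generalize y p ≫ u ≫ R.totπ N m p q h = d at *
    generalize R.totπ N m p q h = e at *
    have : a - e = (a - d - (b - c)) + (b - (e - (d - c))) := by abel
    rw [this, e₂, add_zero]
  have hinj {Z : W} (f : Z ⟶ R.totX N m) (hf : f ≫ u = 0) : f = 0 := by
    have (p : ℕ) : ∀ (q : ℤ) (h : (p : ℤ) + q = m), f ≫ R.totπ N m p q h = 0 := by
      induction p using Nat.strong_induction_on with
      | _ p hp =>
        intro q h
        have := hu f p q h fun p' q' h' hp' => hp p' hp' q' h'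
        simpa only [Preadditive.sub_comp, Preadditive.comp_sub, Category.id_comp, zero_sub,
          reassoc_of% hf, zero_comp, neg_eq_zero] using this
    exact tot_ext fun p q h => by rw [this, zero_comp]
  refine ⟨v, ?_, hvu⟩
  rw [← sub_eq_zero]
  refine hinj _ ?_
  rw [Preadditive.sub_comp, Category.assoc, hvu, Category.comp_id, Category.id_comp, sub_self]

end

lemma isIso_of_sub_eq {Z : CochainComplex V ℤ} (m : ℤ) (u : R.totX Z m ⟶ R.totX Z m)
    (S : R.totX Z m ⟶ R.totX Z (m - 1))
    (s : ∀ (p : ℕ) (q q' : ℤ), (R.R p).obj (Z.X q) ⟶ (R.R p).obj (Z.X q'))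
    (hS : ∀ (p : ℕ) (q q' : ℤ) (h : (p : ℤ) + q' = m - 1) (_ : q' + 1 = q),
      S ≫ R.totπ Z (m - 1) p q' h = R.totπ Z m p q (by lia) ≫ s p q q')
    (hu : ∀ (p : ℕ) (q : ℤ) (hq : (p : ℤ) + q = m), (u - 𝟙 _) ≫ R.totπ Z m p q hq =
      m.negOnePow • (R.totVert Z m (m + 1) rfl ≫ R.totπ Z (m + 1) p (q + 1) (by lia) ≫
        s p (q + 1) q) +
      (m - 1).negOnePow • (S ≫ R.totVert Z (m - 1) m (by lia) ≫ R.totπ Z m p q hq)) :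
    IsIso u := by
  refine R.isIso_of_raising _ fun Z' f p q hpq hf => ?_
  rw [hu, Preadditive.comp_add, Linear.comp_units_smul, Linear.comp_units_smul]
  cases p with
  | zero => rw [totVert_π_zero, totVert_π_zero_assoc]; simp
  | succ p =>
    have hpq' : (p : ℤ) + (q + 1) = m := by
      clear hf hu hS
      push_cast at hpq
      linarith
    have h₀ := hf p (q + 1) hpq' p.lt_succ_self
    have h₁ := hS p (q + 1) q (by linarith) rfl
    rw [totVert_π_succ, totVert_π_succ_assoc]
    have e₁ : f ≫ S ≫ R.totπ Z (m - 1) p q (by linarith) ≫ (R.D p).app (Z.X q) = 0 := by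
      rw [reassoc_of% h₁, reassoc_of% h₀, zero_comp]
    have e₂ : f ≫ R.totπ Z m p (q + 1) hpq' ≫ (R.D p).app (Z.X (q + 1)) ≫ s (p + 1) (q + 1) q = 0 := by
      rw [reassoc_of% h₀, zero_comp]
    rw [e₁]
    refine (congr_arg₂ _ (congr_arg _ ?_) (smul_zero _)).trans (by rw [smul_zero, add_zero])
    exact e₂

/-- The map between terms of total complexes given by a family of maps. -/
def totFamily {X Y : CochainComplex V ℤ}
    (s : ∀ (p : ℕ) (q q' : ℤ), (R.R p).obj (X.X q) ⟶ (R.R p).obj (Y.X q'))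
    (m m' : ℤ) (h : m' + 1 = m) : R.totX X m ⟶ R.totX Y m' :=
  R.totLift fun p q hq => R.totπ X m p (q + 1) (by lia) ≫ s p (q + 1) q

lemma totFamily_π {X Y : CochainComplex V ℤ}
    (s : ∀ (p : ℕ) (q q' : ℤ), (R.R p).obj (X.X q) ⟶ (R.R p).obj (Y.X q'))
    (m m' : ℤ) (h : m' + 1 = m) (p : ℕ) (q q' : ℤ) (hq : (p : ℤ) + q' = m') (hqq' : q' + 1 = q) :
    R.totFamily s m m' h ≫ R.totπ Y m' p q' hq = R.totπ X m p q (by lia) ≫ s p q q' := by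
  subst hqq'
  exact totLift_π _ _ _ _

lemma contractible_tot {Z : CochainComplex V ℤ}
    (h : ∀ p, Nonempty (Homotopy (𝟙 (((R.R p).mapHomologicalComplex (ComplexShape.up ℤ)).obj Z)) 0)) :
    Nonempty (Homotopy (𝟙 (R.tot Z)) 0) := by
  let s (p : ℕ) (q q' : ℤ) : (R.R p).obj (Z.X q) ⟶ (R.R p).obj (Z.X q') := (h p).some.hom q q'
  have hs (p : ℕ) (q₀ q q₁ : ℤ) (h₀ : q₀ + 1 = q) (h₁ : q + 1 = q₁) :
      (R.R p).map (Z.d q q₁) ≫ s p q₁ q + s p q q₀ ≫ (R.R p).map (Z.d q₀ q) = 𝟙 _ := by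
    have e := (h p).some.comm q
    rw [dNext_eq _ (show (ComplexShape.up ℤ).Rel q q₁ from h₁),
      prevD_eq _ (show (ComplexShape.up ℤ).Rel q₀ q from h₀), HomologicalComplex.zero_f,
      add_zero] at e
    exact e.symm
  let S (m m' : ℤ) (hm : m' + 1 = m) : R.totX Z m ⟶ R.totX Z m' := R.totFamily s m m' hm
  have hS (m m' : ℤ) (hm : m' + 1 = m) (p : ℕ) (q q' : ℤ) (hq : (p : ℤ) + q' = m')
      (hqq' : q' + 1 = q) : S m m' hm ≫ R.totπ Z m' p q' hq =
      R.totπ Z m p q (by lia) ≫ s p q q' := R.totFamily_π s m m' hm p q q' hq hqq'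
  let U := Homotopy.nullHomotopicMap' (C := R.tot Z) (D := R.tot Z) (c := ComplexShape.up ℤ)
    (fun i j hij => S i j hij)
  have H : Homotopy U 0 := Homotopy.nullHomotopy' _
  have hU (m : ℤ) (p : ℕ) (q : ℤ) (hq : (p : ℤ) + q = m) :
      (U.f m - 𝟙 _) ≫ R.totπ Z m p q hq =
        m.negOnePow • (R.totVert Z m (m + 1) rfl ≫ R.totπ Z (m + 1) p (q + 1) (by lia) ≫
          s p (q + 1) q) +
        (m - 1).negOnePow • (S m (m - 1) (by lia) ≫ R.totVert Z (m - 1) m (by lia) ≫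
          R.totπ Z m p q hq) := by
    have e : U.f m = R.totD Z m (m + 1) ≫ S (m + 1) m rfl +
        S m (m - 1) (by lia) ≫ R.totD Z (m - 1) m :=
      Homotopy.nullHomotopicMap'_f (show (ComplexShape.up ℤ).Rel (m - 1) m by simp)
        (show (ComplexShape.up ℤ).Rel m (m + 1) by simp) _
    rw [e, Preadditive.sub_comp, Preadditive.add_comp, Category.assoc, Category.assoc,
      hS (m + 1) m rfl p (q + 1) q hq rfl, ← Category.assoc (R.totD Z m (m + 1)),
      R.totD_π Z m (m + 1) rfl p q (q + 1) (by lia) rfl,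
      R.totD_π Z (m - 1) m (by lia) p (q - 1) q hq (by lia), Preadditive.add_comp,
      Preadditive.comp_add, ← Category.assoc (S m (m - 1) _) (R.totπ Z (m - 1) p (q - 1) _),
      hS m (m - 1) (by lia) p q (q - 1) (by lia) (by lia), Linear.units_smul_comp,
      Linear.comp_units_smul, Category.assoc, Category.assoc, Category.assoc]
    have e' := congr(R.totπ Z m p q hq ≫ $(hs p (q - 1) q (q + 1) (by lia) rfl))
    rw [Preadditive.comp_add, Category.comp_id] at e'
    rw [Category.id_comp]
    generalize R.totπ Z m p q hq ≫ (R.R p).map (Z.d q (q + 1)) ≫ s p (q + 1) q = a at *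
    generalize R.totπ Z m p q hq ≫ s p q (q - 1) ≫ (R.R p).map (Z.d (q - 1) q) = b at *
    rw [add_add_add_comm, e']
    abel
  clear_value U S s
  have iU : IsIso U := by
    have (m : ℤ) : IsIso (U.f m) :=
      R.isIso_of_sub_eq m (U.f m) (S m (m - 1) (sub_add_cancel m 1)) s
        (hS m (m - 1) (sub_add_cancel m 1)) (hU m)
    exact HomologicalComplex.Hom.isIso_of_components U
  exact ⟨(Homotopy.ofEq (IsIso.hom_inv_id U).symm).trans ((H.compRight (inv U)).trans
    (Homotopy.ofEq zero_comp))⟩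

end

end CochainFunctor

open CochainComplex HomComplex

section

variable {V W : Type*} [Category* V] [Category* W] [Preadditive V] [Preadditive W]
  (F : V ⥤ W) [F.Additive]

/-- The complex obtained by applying an additive functor. -/
abbrev mapObj (N : CochainComplex V ℤ) : CochainComplex W ℤ where
  X q := F.obj (N.X q)
  d q q' := F.map (N.d q q')
  shape q q' h := by rw [N.shape _ _ h, F.map_zero]
  d_comp_d' _ _ _ _ _ := by rw [← F.map_comp, N.d_comp_d, F.map_zero]

/-- The map of complexes obtained by applying an additive functor. -/
abbrev mapHom {N N' : CochainComplex V ℤ} (f : N ⟶ N') : mapObj F N ⟶ mapObj F N' where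
  f q := F.map (f.f q)
  comm' _ _ _ := by rw [← F.map_comp, ← F.map_comp, f.comm]

end

namespace CochainFunctor

section

variable {V W : Type*} [Category* V] [Category* W] [Preadditive V]
  [Preadditive W] (R R' : CochainFunctor V W) [∀ m, HasProductsOfShape (TotIndex m) W]

section

variable {R R'} (φ : ∀ p, R.R p ⟶ R'.R p) (hφ : ∀ p, R.D p ≫ φ (p + 1) = φ p ≫ R'.D p)

/-- The map of total complexes induced by a map of cochain functors. -/
def totTransApp (N : CochainComplex V ℤ) : R.tot N ⟶ R'.tot N where
  f m := R'.totLift fun p q h => R.totπ N m p q h ≫ (φ p).app (N.X q)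
  comm' m m' h := by
    change m + 1 = m' at h
    refine tot_ext fun p q hpq => ?_
    rw [Category.assoc, Category.assoc, totLift_π]
    rw [R'.totD_π N m m' h p (q - 1) q hpq (by lia), Preadditive.comp_add, totLift_π_assoc,
      ← Category.assoc (R.totD N m m'), R.totD_π N m m' h p (q - 1) q hpq (by lia),
      Preadditive.add_comp, Category.assoc, Category.assoc, NatTrans.naturality,
      Linear.comp_units_smul, Linear.units_smul_comp]
    congr 2
    cases p with
    | zero => rw [totVert_π_zero, totVert_π_zero, comp_zero, zero_comp]
    | succ p =>
      rw [totVert_π_succ, totVert_π_succ, totLift_π_assoc, Category.assoc]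
      exact congr(R.totπ N m p q _ ≫ NatTrans.app $((hφ p).symm) _).trans
        (Category.assoc _ _ _).symm

lemma totTransApp_f_π (N : CochainComplex V ℤ) (m : ℤ) (p : ℕ) (q : ℤ) (h : (p : ℤ) + q = m) :
    (totTransApp φ hφ N).f m ≫ R'.totπ N m p q h = R.totπ N m p q h ≫ (φ p).app (N.X q) :=
  totLift_π (fun p q h => R.totπ N m p q h ≫ (φ p).app (N.X q)) p q h

lemma totTransApp_f_π_assoc (N : CochainComplex V ℤ) (m : ℤ) (p : ℕ) (q : ℤ) (h : (p : ℤ) + q = m)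
    {Z : W} (t : (R'.R p).obj (N.X q) ⟶ Z) : (totTransApp φ hφ N).f m ≫ R'.totπ N m p q h ≫ t =
      R.totπ N m p q h ≫ (φ p).app (N.X q) ≫ t := by
  rw [← Category.assoc, totTransApp_f_π, Category.assoc]

/-- The map of total complexes induced by a map of cochain functors, as a natural
transformation. -/
def totTrans : R.totFunctor ⟶ R'.totFunctor where
  app := totTransApp φ hφ
  naturality X Y f := by
    ext m : 1
    refine tot_ext fun p q hpq => ?_
    rw [HomologicalComplex.comp_f, HomologicalComplex.comp_f, Category.assoc, Category.assoc]
    rw [totTransApp_f_π, totHom_f_π, totHom_f_π_assoc, totTransApp_f_π_assoc, NatTrans.naturality]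

lemma isIso_totTransApp (N : CochainComplex V ℤ) (h : ∀ p q, IsIso ((φ p).app (N.X q))) :
    IsIso (totTransApp φ hφ N) := by
  have (m : ℤ) : IsIso ((totTransApp φ hφ N).f m) := by
    refine ⟨R.totLift fun p q h => R'.totπ N m p q h ≫ inv ((φ p).app (N.X q)),
      tot_ext fun p q h => ?_, tot_ext fun p q h => ?_⟩
    · rw [Category.assoc, totLift_π, totTransApp_f_π_assoc, IsIso.hom_inv_id, Category.comp_id,
        Category.id_comp]
    · rw [Category.assoc, totTransApp_f_π, totLift_π_assoc, Category.assoc, IsIso.inv_hom_id, Category.comp_id,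
        Category.id_comp]
  exact HomologicalComplex.Hom.isIso_of_components _

end

section

variable {K : CochainComplex W ℤ} {N : CochainComplex V ℤ}
  (e : K ⟶ mapObj (R.R 0) N)
  (he : ∀ q, e.f q ≫ (R.D 0).app (N.X q) = 0)

/-- The components of the map to a total complex given by a map to the row of index zero. -/
def augComp (m : ℤ) : ∀ (p : ℕ) (q : ℤ) (_ : (p : ℤ) + q = m), K.X m ⟶ (R.R p).obj (N.X q)
  | 0, q, h => (K.XIsoOfEq (show m = q by simpa using h.symm)).hom ≫ e.f q
  | _ + 1, _, _ => 0

lemma augComp_zero (m : ℤ) (h : ((0 : ℕ) : ℤ) + m = m) :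
    R.augComp e m 0 m h = e.f m := by
  simp [augComp]

lemma augComp_succ (m : ℤ) (p : ℕ) (q : ℤ) (h : ((p + 1 : ℕ) : ℤ) + q = m) :
    R.augComp e m (p + 1) q h = 0 := rfl

/-- The map to a total complex given by a map to the row of index zero. -/
def augHom : K ⟶ R.tot N where
  f m := R.totLift (R.augComp e m)
  comm' m m' h := by
    change m + 1 = m' at h
    refine tot_ext fun p q hpq => ?_
    rw [Category.assoc, Category.assoc, R.totD_π N m m' h p (q - 1) q hpq (by lia), totLift_π,
      Preadditive.comp_add, totLift_π_assoc, Linear.comp_units_smul]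
    match p with
    | 0 =>
      obtain rfl : q = m' := by simpa using hpq
      obtain rfl : m = q - 1 := by lia
      rw [totVert_π_zero, comp_zero, smul_zero, add_zero, augComp_zero, augComp_zero]
      exact e.comm (q - 1) q
    | 1 =>
      obtain rfl : q = m := by simp at hpq; lia
      rw [totVert_π_succ, totLift_π_assoc, augComp_zero, he, smul_zero, augComp_succ,
        augComp_succ, comp_zero, zero_comp, add_zero]
    | p + 2 =>
      rw [totVert_π_succ, totLift_π_assoc, augComp_succ, augComp_succ, augComp_succ, zero_comp,
        comp_zero, zero_comp, smul_zero, add_zero]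

lemma augHom_f_π_zero (m : ℤ) (h : ((0 : ℕ) : ℤ) + m = m) :
    (R.augHom e he).f m ≫ R.totπ N m 0 m h = e.f m :=
  (totLift_π _ _ _ _).trans (augComp_zero ..)

lemma augHom_f_π_zero_assoc (m : ℤ) (h : ((0 : ℕ) : ℤ) + m = m) {Z : W}
    (t : (R.R 0).obj (N.X m) ⟶ Z) : (R.augHom e he).f m ≫ R.totπ N m 0 m h ≫ t = e.f m ≫ t := by
  rw [← Category.assoc, augHom_f_π_zero]

lemma augHom_f_π_succ (m : ℤ) (p : ℕ) (q : ℤ) (h : ((p + 1 : ℕ) : ℤ) + q = m) :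
    (R.augHom e he).f m ≫ R.totπ N m (p + 1) q h = 0 :=
  totLift_π _ _ _ _

lemma augHom_f_π_succ_assoc (m : ℤ) (p : ℕ) (q : ℤ) (h : ((p + 1 : ℕ) : ℤ) + q = m) {Z : W}
    (t : (R.R (p + 1)).obj (N.X q) ⟶ Z) :
    (R.augHom e he).f m ≫ R.totπ N m (p + 1) q h ≫ t = 0 ≫ t := by
  rw [← Category.assoc, augHom_f_π_succ]

lemma comp_augHom {K' : CochainComplex W ℤ} (f : K' ⟶ K)
    (e' : K' ⟶ mapObj (R.R 0) N)
    (he' : ∀ q, e'.f q ≫ (R.D 0).app (N.X q) = 0) (w : e' = f ≫ e) :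
    f ≫ R.augHom e he = R.augHom e' he' := by
  subst w
  ext m : 1
  refine tot_ext fun p q hpq => ?_
  rw [HomologicalComplex.comp_f, Category.assoc]
  cases p with
  | zero =>
    obtain rfl : q = m := by simpa using hpq
    rw [augHom_f_π_zero, augHom_f_π_zero, HomologicalComplex.comp_f]
  | succ p => rw [augHom_f_π_succ, augHom_f_π_succ, comp_zero]

lemma augHom_totHom {N' : CochainComplex V ℤ} (f : N ⟶ N')
    (e' : K ⟶ mapObj (R.R 0) N')
    (he' : ∀ q, e'.f q ≫ (R.D 0).app (N'.X q) = 0)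
    (w : e' = e ≫ mapHom (R.R 0) f) :
    R.augHom e he ≫ R.totHom f = R.augHom e' he' := by
  subst w
  ext m : 1
  refine tot_ext fun p q hpq => ?_
  rw [HomologicalComplex.comp_f, Category.assoc, totHom_f_π]
  cases p with
  | zero =>
    obtain rfl : q = m := by simpa using hpq
    rw [augHom_f_π_zero, augHom_f_π_zero_assoc]
    rfl
  | succ p => rw [augHom_f_π_succ, augHom_f_π_succ_assoc, zero_comp]

variable {R R'} in
lemma augHom_totTransApp (φ : ∀ p, R.R p ⟶ R'.R p) (hφ : ∀ p, R.D p ≫ φ (p + 1) = φ p ≫ R'.D p)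
    (e' : K ⟶ mapObj (R'.R 0) N)
    (he' : ∀ q, e'.f q ≫ (R'.D 0).app (N.X q) = 0)
    (w : ∀ q, e'.f q = e.f q ≫ (φ 0).app (N.X q)) :
    R.augHom e he ≫ totTransApp φ hφ N = R'.augHom e' he' := by
  ext m : 1
  refine tot_ext fun p q hpq => ?_
  rw [HomologicalComplex.comp_f, Category.assoc, totTransApp_f_π]
  cases p with
  | zero =>
    obtain rfl : q = m := by simpa using hpq
    rw [augHom_f_π_zero, augHom_f_π_zero_assoc, w]
  | succ p => rw [augHom_f_π_succ, augHom_f_π_succ_assoc, zero_comp]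

/-- If the augmented cochain functor is naturally contractible, then the augmentation is a
homotopy equivalence. -/
lemma isHomotopyIso_augHom (r : mapObj (R.R 0) N ⟶ K)
    (s : ∀ p, R.R (p + 1) ⟶ R.R p) (her : e ≫ r = 𝟙 _)
    (h₀ : ∀ q, r.f q ≫ e.f q + (R.D 0 ≫ s 0).app (N.X q) = 𝟙 _)
    (h : ∀ p, s p ≫ R.D p + R.D (p + 1) ≫ s (p + 1) = 𝟙 _) :
    IsHomotopyIso (R.augHom e he) := by
  let ρ : R.tot N ⟶ K :=
    { f := fun m => R.totπ N m 0 m (by simp) ≫ r.f m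
      comm' := fun m m' hm => by
        change m + 1 = m' at hm
        rw [Category.assoc, ← Category.assoc (R.totD N m m'), R.totD_π N m m' hm 0 m m' _ hm,
          totVert_π_zero, smul_zero, add_zero, Category.assoc, r.comm] }
  have hρ (m : ℤ) : ρ.f m = R.totπ N m 0 m (by simp) ≫ r.f m := rfl
  let S (m m' : ℤ) (hm : m' + 1 = m) : R.totX N m ⟶ R.totX N m' :=
    R.totLift fun p q hpq => m'.negOnePow • (R.totπ N m (p + 1) q (by push_cast; linarith) ≫
      (s p).app (N.X q))
  have hS (m m' : ℤ) (hm : m' + 1 = m) (p : ℕ) (q : ℤ) (hq : (p : ℤ) + q = m') :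
      S m m' hm ≫ R.totπ N m' p q hq = m'.negOnePow • (R.totπ N m (p + 1) q
        (by push_cast; linarith) ≫ (s p).app (N.X q)) := totLift_π _ _ _ _
  clear_value S
  refine (isHomotopyIso_iff _).2 ⟨ρ, ⟨Homotopy.ofEq ?_⟩, ⟨((Homotopy.equivSubZero.symm
    ((Homotopy.ofEq ?_).trans (Homotopy.nullHomotopy' (C := R.tot N) (D := R.tot N)
      (c := ComplexShape.up ℤ) (fun i j hij => S i j hij)))).symm)⟩⟩
  · ext m
    rw [HomologicalComplex.comp_f, hρ, augHom_f_π_zero_assoc]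
    exact HomologicalComplex.congr_hom her m
  · ext m : 1
    refine (tot_ext fun p q hpq => ?_).trans (Homotopy.nullHomotopicMap'_f
      (C := R.tot N) (D := R.tot N) (show (ComplexShape.up ℤ).Rel (m - 1) m by simp)
      (show (ComplexShape.up ℤ).Rel m (m + 1) by simp) fun i j hij => S i j hij).symm
    have e₁ : (R.totD N m (m + 1) ≫ S (m + 1) m rfl) ≫ R.totπ N m p q hpq =
        m.negOnePow • (R.totπ N m (p + 1) (q - 1) (by push_cast; linarith) ≫
          (R.R (p + 1)).map (N.d (q - 1) q) ≫ (s p).app (N.X q)) +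
        R.totπ N m p q hpq ≫ (R.D p ≫ s p).app (N.X q) := by
      rw [Category.assoc, hS, Linear.comp_units_smul, ← Category.assoc (R.totD N m (m + 1)),
        R.totD_π N m (m + 1) rfl (p + 1) (q - 1) q _ (by lia), totVert_π_succ,
        Preadditive.add_comp, smul_add, Linear.units_smul_comp, smul_smul,
        Int.units_mul_self, one_smul, Category.assoc, Category.assoc, NatTrans.comp_app]
    have e₂ : (S m (m - 1) (by lia) ≫ R.totD N (m - 1) m) ≫ R.totπ N m p q hpq =
        (m - 1).negOnePow • (R.totπ N m (p + 1) (q - 1) (by push_cast; linarith) ≫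
          (s p).app (N.X (q - 1)) ≫ (R.R p).map (N.d (q - 1) q)) +
        (m - 1).negOnePow • (S m (m - 1) (by lia) ≫ R.totVert N (m - 1) m (by lia) ≫
          R.totπ N m p q hpq) := by
      rw [Category.assoc, R.totD_π N (m - 1) m (by lia) p (q - 1) q _ (by lia),
        Preadditive.comp_add, Linear.comp_units_smul, ← Category.assoc (S _ _ _) (R.totπ _ _ _ _ _),
        hS, Linear.units_smul_comp, Category.assoc]
    change (𝟙 _ - ρ.f m ≫ (R.augHom e he).f m) ≫ _ = 
      (R.totD N m (m + 1) ≫ S (m + 1) m rfl + S m (m - 1) _ ≫ R.totD N (m - 1) m) ≫ _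
    rw [Preadditive.add_comp, e₁, e₂, NatTrans.naturality, Int.negOnePow_sub, Int.negOnePow_one,
      mul_neg_one, Units.neg_smul, Units.neg_smul, hρ, Preadditive.sub_comp, Category.id_comp,
      Category.assoc, Category.assoc]
    cases p with
    | zero =>
      obtain rfl : q = m := by simpa using hpq
      rw [totVert_π_zero, comp_zero, smul_zero, augHom_f_π_zero]
      have := congr(R.totπ N q 0 q hpq ≫ $(h₀ q))
      rw [Category.comp_id, Preadditive.comp_add] at this
      refine (congr_arg (· - _) this.symm).trans ?_
      abel
    | succ p =>
      have e₃ : m.negOnePow • (S m (m - 1) (by lia) ≫ R.totVert N (m - 1) m (by lia) ≫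
          R.totπ N m (p + 1) q hpq) = - (R.totπ N m (p + 1) q hpq ≫
            (s p).app (N.X q) ≫ (R.D p).app (N.X q)) := by
        rw [totVert_π_succ, ← Category.assoc (S _ _ _) (R.totπ _ _ _ _ _), hS,
          Linear.units_smul_comp, smul_smul, Int.negOnePow_sub, Int.negOnePow_one,
          mul_neg_one, mul_neg, Int.units_mul_self, Units.neg_smul, one_smul, Category.assoc]
      rw [e₃, augHom_f_π_succ, comp_zero, comp_zero, sub_zero, neg_neg]
      have := congr(R.totπ N m (p + 1) q hpq ≫ NatTrans.app $(h p) (N.X q))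
      rw [NatTrans.id_app, Category.comp_id, NatTrans.app_add, Preadditive.comp_add,
        NatTrans.comp_app] at this
      refine this.symm.trans ?_
      abel

end

section

variable {W' : Type*} [Category* W'] [Preadditive W'] (F : W ⥤ W') [F.Additive]
    [∀ m, HasProductsOfShape (TotIndex m) W']

/-- The comparison map for the total complex after applying an additive functor. -/
def mapTot (N : CochainComplex V ℤ) :
    mapObj F (R.tot N) ⟶ (R.postcomp F).tot N where
  f m := (R.postcomp F).totLift fun p q h => F.map (R.totπ N m p q h)
  comm' m m' h := by
    change m + 1 = m' at h
    refine tot_ext fun p q hpq => ?_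
    rw [Category.assoc, Category.assoc, totLift_π]
    rw [(R.postcomp F).totD_π N m m' h p (q - 1) q hpq (by lia), Preadditive.comp_add,
      totLift_π_assoc, Linear.comp_units_smul]
    refine Eq.trans ?_ (F.map_comp _ _)
    rw [R.totD_π N m m' h p (q - 1) q hpq (by lia), F.map_add, F.map_comp, F.map_units_smul]
    refine congr_arg₂ _ rfl (congr_arg _ ?_)
    cases p with
    | zero => rw [totVert_π_zero, totVert_π_zero, comp_zero, F.map_zero]
    | succ p =>
      rw [totVert_π_succ, totVert_π_succ, totLift_π_assoc, F.map_comp]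
      rfl

lemma mapTot_f_π (N : CochainComplex V ℤ) (m : ℤ) (p : ℕ) (q : ℤ) (h : (p : ℤ) + q = m) :
    (R.mapTot F N).f m ≫ (R.postcomp F).totπ N m p q h = F.map (R.totπ N m p q h) :=
  totLift_π (R := R.postcomp F) (fun p q h => F.map (R.totπ N m p q h)) p q h

lemma mapTot_f_π_assoc (N : CochainComplex V ℤ) (m : ℤ) (p : ℕ) (q : ℤ) (h : (p : ℤ) + q = m)
    {Z : W'} (t : ((R.postcomp F).R p).obj (N.X q) ⟶ Z) :
    (R.mapTot F N).f m ≫ (R.postcomp F).totπ N m p q h ≫ t = F.map (R.totπ N m p q h) ≫ t := by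
  rw [← Category.assoc, mapTot_f_π]

/-- The comparison map for the total complex after applying an additive functor, as a natural
transformation. -/
def mapTotTrans : R.totFunctor ⋙ F.mapHomologicalComplex (ComplexShape.up ℤ) ⟶
    (R.postcomp F).totFunctor where
  app := R.mapTot F
  naturality X Y f := by
    ext m : 1
    refine tot_ext fun p q hpq => ?_
    change (F.map _ ≫ (R.mapTot F Y).f m) ≫ _ = ((R.mapTot F X).f m ≫ _) ≫ _
    rw [Category.assoc, Category.assoc, totHom_f_π, mapTot_f_π, mapTot_f_π_assoc]
    refine (F.map_comp _ _).symm.trans ((congr_arg _ ?_).trans (F.map_comp _ _))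
    exact R.totHom_f_π f m p q hpq

instance [∀ m, PreservesLimitsOfShape (Discrete (TotIndex m)) F] (N : CochainComplex V ℤ) :
    IsIso (R.mapTot F N) := by
  have (m : ℤ) : IsIso ((R.mapTot F N).f m) :=
    inferInstanceAs (IsIso (piComparison F fun x : TotIndex m => (R.R x.1.1).obj (N.X x.1.2)))
  exact HomologicalComplex.Hom.isIso_of_components _

lemma map_augHom_mapTot {K : CochainComplex W ℤ} {N : CochainComplex V ℤ}
    (e : K ⟶ mapObj (R.R 0) N)
    (he : ∀ q, e.f q ≫ (R.D 0).app (N.X q) = 0)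
    (e' : mapObj F K ⟶
      mapObj ((R.postcomp F).R 0) N)
    (he' : ∀ q, e'.f q ≫ ((R.postcomp F).D 0).app (N.X q) = 0) (w : ∀ q, e'.f q = F.map (e.f q)) :
    mapHom F (R.augHom e he) ≫ R.mapTot F N =
      (R.postcomp F).augHom e' he' := by
  ext m : 1
  refine tot_ext fun p q hpq => ?_
  rw [HomologicalComplex.comp_f, Category.assoc, mapTot_f_π]
  refine (F.map_comp _ _).symm.trans ?_
  cases p with
  | zero =>
    obtain rfl : q = m := by simpa using hpq
    rw [augHom_f_π_zero, augHom_f_π_zero, w]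
  | succ p => rw [augHom_f_π_succ, augHom_f_π_succ, F.map_zero]

end

end

end CochainFunctor

section SemiCosimplicial

variable {V W : Type*} [Category* V] [Category* W] [Preadditive V] [Preadditive W]

/-- A semi-cosimplicial functor. -/
structure SemiCosimplicialFunctor (V W : Type*) [Category* V] [Category* W] [Preadditive V]
    [Preadditive W] where
  /-- the terms -/
  R : ℕ → V ⥤ W
  additive (p : ℕ) : (R p).Additive
  /-- the coface maps -/
  δ {p q : ℕ} (f : Fin (p + 1) ↪o Fin (q + 1)) : R p ⟶ R q
  δ_comp_δ {p q r : ℕ} (f : Fin (p + 1) ↪o Fin (q + 1)) (g : Fin (q + 1) ↪o Fin (r + 1)) :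
    δ f ≫ δ g = δ (f.trans g)

attribute [instance] SemiCosimplicialFunctor.additive

namespace SemiCosimplicialFunctor

variable (R : SemiCosimplicialFunctor V W)

/-- The coface maps of codimension one. -/
abbrev face {p : ℕ} (i : Fin (p + 2)) : R.R p ⟶ R.R (p + 1) := R.δ (Fin.succAboveOrderEmb i)

lemma face_comp_face {p : ℕ} {i j : Fin (p + 2)} (h : i ≤ j) :
    R.face i ≫ R.face j.succ = R.face j ≫ R.face i.castSucc := by
  rw [R.δ_comp_δ, R.δ_comp_δ]
  congr 1
  ext k : 1
  exact congr(SimplexCategory.Hom.toOrderHom $(SimplexCategory.δ_comp_δ h) k)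

/-- The alternating sum of the coface maps. -/
def alternatingD (p : ℕ) : R.R p ⟶ R.R (p + 1) :=
  ∑ i : Fin (p + 2), (-1 : ℤ) ^ (i : ℕ) • R.face i

lemma alternatingD_comp (p : ℕ) : R.alternatingD p ≫ R.alternatingD (p + 1) = 0 := by
  unfold alternatingD
  simp only [Preadditive.comp_sum, Preadditive.sum_comp, ← Finset.sum_product']
  let P := Fin (p + 3) × Fin (p + 2)
  let S : Finset P := {ij : P | (ij.1 : ℕ) ≤ (ij.2 : ℕ)}
  rw [Finset.univ_product_univ, ← Finset.sum_add_sum_compl S, ← eq_neg_iff_add_eq_zero,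
    ← Finset.sum_neg_distrib]
  let φ : ∀ ij : P, ij ∈ S → P := fun ij hij =>
    (ij.2.succ, Fin.castLT ij.1 (lt_of_le_of_lt (Finset.mem_filter.mp hij).right (Fin.is_lt ij.2)))
  apply Finset.sum_bij φ
  · intro ij hij
    simp_rw [S, φ, Finset.compl_filter, Finset.mem_filter_univ, Fin.val_succ,
      Fin.val_castLT] at hij ⊢
    lia
  · rintro ⟨i, j⟩ hij ⟨i', j'⟩ hij' h
    rw [Prod.mk_inj]
    exact ⟨by simpa [φ, Fin.castSucc_castLT] using! congr_arg Fin.castSucc (congr_arg Prod.snd h),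
      by simpa [φ] using! congr_arg Prod.fst h⟩
  · rintro ⟨i', j'⟩ hij'
    simp_rw [S, Finset.compl_filter, Finset.mem_filter_univ, not_le] at hij'
    refine ⟨(Fin.castSucc j', i'.pred <| ?_), ?_, ?_⟩
    · rintro rfl
      simp only [Fin.val_zero, not_lt_zero] at hij'
    · simpa [S] using! Nat.le_sub_one_of_lt hij'
    · simp only [φ, Fin.castLT_castSucc, Fin.succ_pred]
  · rintro ⟨i, j⟩ hij
    have hij' : (i : ℕ) ≤ j := by simpa [S] using! hij
    have e := R.face_comp_face (i := i.castLT (by lia)) (j := j) (by simpa using! hij')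
    rw [Fin.castSucc_castLT] at e
    simp only [Preadditive.zsmul_comp, Preadditive.comp_zsmul, smul_smul, ← neg_smul]
    dsimp only [φ]
    rw [e]
    congr 1
    simp only [Fin.val_succ, pow_add, pow_one, mul_neg, mul_one, Fin.val_castLT]
    ring

/-- The cochain functor of alternating sums of coface maps. -/
abbrev cochain : CochainFunctor V W where
  R := R.R
  additive := R.additive
  D := R.alternatingD
  D_comp_D := R.alternatingD_comp

end SemiCosimplicialFunctor

end SemiCosimplicial

section Span

variable {B₀ B : Type u} [SmallCategory B₀] [SmallCategory B] (R₀ : B₀ᵒᵖ ⥤ RingCat.{u})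
  (R₁ : Bᵒᵖ ⥤ RingCat.{u})

/-- The data defining a functor from modules over `R₀` to modules over `R₁` that is
given by products indexed by `I`. -/
structure ProductData where
  /-- the indices of the product -/
  I : B ⥤ Type u
  /-- the objects at which the factors are evaluated -/
  o : I.Elements ⥤ B₀
  /-- the module structure on the factors -/
  α (e : I.Elements) : R₁.obj (op e.1) →+* R₀.obj (op (o.obj e))
  α_map {e e' : I.Elements} (f : e ⟶ e') (a : R₁.obj (op e'.1)) :
    R₀.map (o.map f).op (α e' a) = α e (R₁.map f.1.op a)

namespace ProductData

variable {R₀ R₁} (S : ProductData R₀ R₁)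

/-- Elements of products. -/
def X (N : PresheafOfModules.{u} R₀) (i : B) : Type u :=
  ∀ s : S.I.obj i, N.obj (op (S.o.obj ⟨i, s⟩))

instance (N : PresheafOfModules.{u} R₀) (i : B) : AddCommGroup (S.X N i) :=
  inferInstanceAs (AddCommGroup (∀ s : S.I.obj i, N.obj (op (S.o.obj ⟨i, s⟩))))

instance (N : PresheafOfModules.{u} R₀) (i : Bᵒᵖ) : Module (R₁.obj (i)) (S.X N i.unop) where
  smul a x := fun s => S.α ⟨i.unop, s⟩ a • x s
  one_smul x := funext fun s => by
    change S.α ⟨i.unop, s⟩ 1 • x s = x s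
    rw [map_one, one_smul]
  mul_smul a b x := funext fun s => by
    change S.α ⟨i.unop, s⟩ (a * b) • x s = S.α ⟨i.unop, s⟩ a • S.α ⟨i.unop, s⟩ b • x s
    rw [map_mul, mul_smul]
  smul_zero a := funext fun s => smul_zero (S.α ⟨i.unop, s⟩ a)
  smul_add a x y := funext fun s => smul_add (S.α ⟨i.unop, s⟩ a) (x s) (y s)
  add_smul a b x := funext fun s => by
    change S.α ⟨i.unop, s⟩ (a + b) • x s = S.α ⟨i.unop, s⟩ a • x s + S.α ⟨i.unop, s⟩ b • x s
    rw [map_add, add_smul]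
  zero_smul x := funext fun s => by
    change S.α ⟨i.unop, s⟩ 0 • x s = 0
    rw [map_zero, zero_smul]

variable {S}

lemma map_apply_congr {N : PresheafOfModules.{u} R₀} {i : B} (x : S.X N i) {e : S.I.Elements}
    {t t' : S.I.obj i} (f : e ⟶ S.I.elementsMk i t) (f' : e ⟶ S.I.elementsMk i t')
    (h : f.1 = f'.1) : N.map (S.o.map f).op (x t) = N.map (S.o.map f').op (x t') := by
  have ht : t = t' := f.2.symm.trans ((congr_arg (fun v => S.I.map v e.2) h).trans f'.2)
  subst ht
  obtain rfl : f = f' := Subtype.ext h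
  rfl

lemma map_id_apply {N : PresheafOfModules.{u} R₀} {i : B} (x : S.X N i)
    {t t' : S.I.obj i} (f : S.I.elementsMk i t' ⟶ S.I.elementsMk i t) (h : f.1 = 𝟙 i) :
    N.map (S.o.map f).op (x t) = x t' := by
  rw [map_apply_congr x f (𝟙 _) h, S.o.map_id, op_id]
  rw [N.map_id]
  rfl

variable (S)

/-- The product, as a presheaf of abelian groups. -/
def presheaf (N : PresheafOfModules.{u} R₀) : Bᵒᵖ ⥤ Ab.{u} where
  obj i := AddCommGrpCat.of (S.X N i.unop)
  map {i h} v := AddCommGrpCat.ofHom (AddMonoidHom.mk'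
    (fun (x : S.X N i.unop) (s : S.I.obj h.unop) =>
      N.map (S.o.map (CategoryOfElements.homMk (S.I.elementsMk _ s)
        (S.I.elementsMk _ (S.I.map v.unop s)) v.unop rfl)).op (x (S.I.map v.unop s)))
    (fun x y => funext fun s => map_add (N.map _).hom _ _))
  map_id i := by
    ext x
    exact funext fun s => map_id_apply x _ rfl
  map_comp {i j l} v w := by
    ext x
    refine funext fun s => ?_
    refine (map_apply_congr x (CategoryOfElements.homMk (S.I.elementsMk _ s)
        (S.I.elementsMk _ (S.I.map (v ≫ w).unop s)) (v ≫ w).unop rfl)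
        (CategoryOfElements.homMk (S.I.elementsMk _ s)
        (S.I.elementsMk _ (S.I.map w.unop s)) w.unop rfl ≫
        CategoryOfElements.homMk (S.I.elementsMk _ (S.I.map w.unop s))
        (S.I.elementsMk _ (S.I.map v.unop (S.I.map w.unop s))) v.unop rfl) rfl).trans ?_
    rw [S.o.map_comp, op_comp, N.map_comp_apply]
    rfl

instance (N : PresheafOfModules.{u} R₀) (i : Bᵒᵖ) :
    Module (R₁.obj i) ((S.presheaf N).obj i) :=
  inferInstanceAs (Module (R₁.obj i) (S.X N i.unop))

/-- The product. -/
def obj (N : PresheafOfModules.{u} R₀) : PresheafOfModules.{u} R₁ :=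
  PresheafOfModules.ofPresheaf (S.presheaf N) (fun i h v a x => funext fun s => by
    let f := CategoryOfElements.homMk (S.I.elementsMk _ s)
        (S.I.elementsMk _ (S.I.map v.unop s)) v.unop rfl
    refine (N.map_smul (S.o.map f).op (S.α ⟨i.unop, S.I.map v.unop s⟩ a)
      ((show S.X N i.unop from x) (S.I.map v.unop s))).trans ?_
    exact congr_arg (· • _) (S.α_map f a))

/-- Elements of `S.obj N` as families. -/
abbrev app {N : PresheafOfModules.{u} R₀} {i : B} (x : (S.obj N).obj (op i)) (s : S.I.obj i) :
    N.obj (op (S.o.obj ⟨i, s⟩)) :=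
  (show S.X N i from x) s

variable {S}

lemma ext {N : PresheafOfModules.{u} R₀} {i : B} {x y : (S.obj N).obj (op i)}
    (h : ∀ s, S.app x s = S.app y s) : x = y := funext h

lemma hom_ext {P : PresheafOfModules.{u} R₁} {N : PresheafOfModules.{u} R₀} {f g : P ⟶ S.obj N}
    (h : ∀ (i : B) (y : P.obj (op i)) (s : S.I.obj i),
      S.app (f.app (op i) y) s = S.app (g.app (op i) y) s) : f = g := by
  ext i y
  exact funext fun s => h i.unop y s

section

variable {P : PresheafOfModules.{u} R₁} {N : PresheafOfModules.{u} R₀}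
  (g : ∀ e : S.I.Elements, P.obj (op e.1) →+ N.obj (op (S.o.obj e)))
  (hg : ∀ (e : S.I.Elements) (a : R₁.obj (op e.1)) (y : P.obj (op e.1)),
    g e (a • y) = S.α e a • g e y)
  (hg' : ∀ (e e' : S.I.Elements) (f : e ⟶ e') (y : P.obj (op e'.1)),
    g e (P.map f.1.op y) = N.map (S.o.map f).op (g e' y))

/-- Maps to a product. -/
def lift : P ⟶ S.obj N :=
  PresheafOfModules.homMk (M₁ := P) (M₂ := S.obj N)
    { app i := AddCommGrpCat.ofHom (AddMonoidHom.mk'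
        (fun (y : P.obj i) => (show S.X N i.unop from fun s => g ⟨i.unop, s⟩ y))
        (fun y y' => funext fun s => map_add (g ⟨i.unop, s⟩) y y'))
      naturality i h v := by
        ext y
        exact funext fun s => hg' _ _ (CategoryOfElements.homMk (S.I.elementsMk _ s)
          (S.I.elementsMk _ (S.I.map v.unop s)) v.unop rfl) y }
    (fun i a y => funext fun s => hg ⟨i.unop, s⟩ a y)

end

lemma app_map {N : PresheafOfModules.{u} R₀} {e e' : S.I.Elements} (f : e ⟶ e')
    (x : (S.obj N).obj (op e'.1)) :
    S.app ((S.obj N).map f.1.op x) e.2 = N.map (S.o.map f).op (S.app x e'.2) :=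
  map_apply_congr x (CategoryOfElements.homMk e (S.I.elementsMk _ (S.I.map f.1 e.2)) f.1 rfl) f rfl

variable (S)

/-- The projections of a product. -/
def proj (N : PresheafOfModules.{u} R₀) (e : S.I.Elements) :
    (S.obj N).obj (op e.1) →+ N.obj (op (S.o.obj e)) :=
  AddMonoidHom.mk' (fun x => S.app x e.2) (fun _ _ => rfl)

/-- The functoriality of products. -/
def functor : PresheafOfModules.{u} R₀ ⥤ PresheafOfModules.{u} R₁ where
  obj := S.obj
  map {N _} φ := lift (fun e => ((φ.app _).hom.toAddMonoidHom).comp (S.proj N e))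
    (fun e a x => (φ.app (op (S.o.obj e))).hom.map_smul (S.α e a) (S.app x e.2))
    (fun _ _ f x => (congr_arg (φ.app _) (app_map f x)).trans
      (PresheafOfModules.naturality_apply φ _ _))
  map_id _ := rfl
  map_comp _ _ := rfl

instance : S.functor.Additive where
  map_add := rfl

end ProductData

end Span

section

variable {V : Type*} [Category* V] [Preadditive V]

lemma contractible_iff (X : CochainComplex V ℤ) : Nonempty (Homotopy (𝟙 X) 0) ↔
    ∃ h : ∀ q q' : ℤ, X.X q ⟶ X.X q', ∀ q,
      X.d q (q + 1) ≫ h (q + 1) q + h q (q - 1) ≫ X.d (q - 1) q = 𝟙 _ := by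
  have r₁ (q : ℤ) : (ComplexShape.up ℤ).Rel (q - 1) q := by simp
  have r₂ (q : ℤ) : (ComplexShape.up ℤ).Rel q (q + 1) := by simp
  constructor
  · rintro ⟨H⟩
    refine ⟨H.hom, fun q => ?_⟩
    have e := H.comm q
    rw [dNext_eq _ (r₂ q), prevD_eq _ (r₁ q), HomologicalComplex.zero_f, add_zero] at e
    exact e.symm
  · rintro ⟨h, hh⟩
    refine ⟨{ hom := fun q q' => if q' + 1 = q then h q q' else 0
              zero := fun q q' hq => if_neg hq
              comm := fun q => ?_ }⟩
    rw [dNext_eq _ (r₂ q), prevD_eq _ (r₁ q), HomologicalComplex.zero_f, add_zero, if_pos rfl,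
      if_pos (by lia), hh]
    rfl

end

section ContractibleProducts

variable {k : Type u} [CommRing k] {B₀ B : Type u} [SmallCategory B₀] [SmallCategory B]
  {A₀ : B₀ᵒᵖ ⥤ AlgCat.{u} k} {A₁ : Bᵒᵖ ⥤ AlgCat.{u} k}
  (S : ProductData (A₀ ⋙ forget₂ (AlgCat.{u} k) RingCat.{u})
    (A₁ ⋙ forget₂ (AlgCat.{u} k) RingCat.{u}))

/-- A product functor is `k`-linear. -/
def ProductData.IsLinear : Prop :=
  ∀ (e : S.I.Elements) (c : k), S.α e (algebraMap k (A₁.obj (op e.1)) c) =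
    algebraMap k (A₀.obj (op (S.o.obj e))) c

variable {S}

/-- The map on products of `k`-modules given by a family of maps. -/
def ProductData.piMap (hS : S.IsLinear) {M N : AMod A₀} (i : B)
    (h : ∀ s : S.I.obj i, (evalK A₀ (S.o.obj ⟨i, s⟩)).obj M ⟶ (evalK A₀ (S.o.obj ⟨i, s⟩)).obj N) :
    (evalK A₁ i).obj (S.obj M) ⟶ (evalK A₁ i).obj (S.obj N) :=
  ModuleCat.ofHom (X := (evalK A₁ i).obj (S.obj M)) (Y := (evalK A₁ i).obj (S.obj N))
    { toFun x := show S.X N i from fun s => h s (S.app (i := i) x s)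
      map_add' x y := funext fun s => map_add (h s).hom _ _
      map_smul' c x := funext fun s => by
        refine (congr_arg (h s) ?_).trans (((h s).hom.map_smul c (S.app (i := i) x s)).trans ?_)
        · exact congr_arg (fun a : A₀.obj (op (S.o.obj ⟨i, s⟩)) =>
            (show M.obj _ from a • (S.app (i := i) x s))) (hS ⟨i, s⟩ c)
        · exact congr_arg (fun a : A₀.obj (op (S.o.obj ⟨i, s⟩)) =>
            (show N.obj _ from a • (show N.obj _ from h s (S.app (i := i) x s)))) (hS ⟨i, s⟩ c).symm }

lemma ProductData.contractible_functor (hS : S.IsLinear) (Z : CochainComplex (AMod A₀) ℤ) (i : B)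
    (h : ∀ s : S.I.obj i, Nonempty (Homotopy (𝟙 (((evalK A₀ (S.o.obj ⟨i, s⟩)).mapHomologicalComplex
      (ComplexShape.up ℤ)).obj Z)) 0)) :
    Nonempty (Homotopy (𝟙 (((S.functor ⋙ evalK A₁ i).mapHomologicalComplex
      (ComplexShape.up ℤ)).obj Z)) 0) := by
  choose H hH using fun s => (contractible_iff _).1 (h s)
  refine (contractible_iff _).2 ⟨fun q q' => piMap hS i fun s => H s q q', fun q => ?_⟩
  ext x
  exact funext fun s => congr($(hH s q) (S.app (i := i) x s))

end ContractibleProducts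

section Join

variable {C : Type u} [SmallCategory C]

/-- The functor on the ordinal sum given by two functors and a map between them. -/
def sumFunctor {p q : ℕ} (σ : Fin (p + 1) ⥤ C) (τ : Fin (q + 1) ⥤ C)
    (w : σ.obj (Fin.last p) ⟶ τ.obj 0) : (Fin (p + 1) ⊕ₗ Fin (q + 1)) ⥤ C where
  obj x := match ofLex x with
    | .inl a => σ.obj a
    | .inr b => τ.obj b
  map {x y} f := match x, y, leOfHom f with
    | .inl a, .inl b, h => σ.map (homOfLE (Sum.Lex.inl_le_inl_iff.1 h))
    | .inl a, .inr b, _ => σ.map (homOfLE (Fin.le_last a)) ≫ w ≫ τ.map (homOfLE (Fin.zero_le b))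
    | .inr a, .inl b, h => (Sum.Lex.not_inr_le_inl h).elim
    | .inr a, .inr b, h => τ.map (homOfLE (Sum.Lex.inr_le_inr_iff.1 h))
  map_id := by
    rintro (a | a)
    · exact σ.map_id a
    · exact τ.map_id a
  map_comp := by
    rintro (a | a) (b | b) (c | c) f g
    · exact σ.map_comp (homOfLE (Sum.Lex.inl_le_inl_iff.1 (leOfHom f)))
        (homOfLE (Sum.Lex.inl_le_inl_iff.1 (leOfHom g)))
    · refine Eq.trans ?_ (Category.assoc _ _ _)
      refine congr_arg (· ≫ _) ?_
      exact σ.map_comp (homOfLE (Sum.Lex.inl_le_inl_iff.1 (leOfHom f))) (homOfLE (Fin.le_last b))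
    · exact (Sum.Lex.not_inr_le_inl (leOfHom g)).elim
    · refine Eq.trans ?_ ((Category.assoc _ _ _).trans (congr_arg _ (Category.assoc _ _ _))).symm
      refine congr_arg (_ ≫ _ ≫ ·) ?_
      exact τ.map_comp (homOfLE (Fin.zero_le b))
        (homOfLE (Sum.Lex.inr_le_inr_iff.1 (leOfHom g)))
    · exact (Sum.Lex.not_inr_le_inl (leOfHom f)).elim
    · exact (Sum.Lex.not_inr_le_inl (leOfHom f)).elim
    · exact (Sum.Lex.not_inr_le_inl (leOfHom g)).elim
    · exact τ.map_comp (homOfLE (Sum.Lex.inr_le_inr_iff.1 (leOfHom f)))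
        (homOfLE (Sum.Lex.inr_le_inr_iff.1 (leOfHom g)))

/-- The map of ordinal sums given by two order embeddings. -/
def sumMap {p q p' q' : ℕ} (f : Fin (p' + 1) ↪o Fin (p + 1)) (g : Fin (q' + 1) ↪o Fin (q + 1)) :
    (Fin (p' + 1) ⊕ₗ Fin (q' + 1)) ↪o (Fin (p + 1) ⊕ₗ Fin (q + 1)) :=
  OrderEmbedding.ofStrictMono (fun x => toLex (Sum.map f g (ofLex x))) (by
    rintro (a | a) (b | b) h
    · exact Sum.Lex.inl_lt_inl_iff.2 (f.strictMono (Sum.Lex.inl_lt_inl_iff.1 h))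
    · exact Sum.Lex.inl_lt_inr _ _
    · exact (Sum.Lex.not_inr_lt_inl h).elim
    · exact Sum.Lex.inr_lt_inr_iff.2 (g.strictMono (Sum.Lex.inr_lt_inr_iff.1 h)))

lemma sumMap_functor {p q p' q' : ℕ} (f : Fin (p' + 1) ↪o Fin (p + 1))
    (g : Fin (q' + 1) ↪o Fin (q + 1)) (σ : Fin (p + 1) ⥤ C) (τ : Fin (q + 1) ⥤ C)
    (w : σ.obj (Fin.last p) ⟶ τ.obj 0) :
    (sumMap f g).monotone.functor ⋙ sumFunctor σ τ w =
      sumFunctor (f.monotone.functor ⋙ σ) (g.monotone.functor ⋙ τ)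
        (σ.map (homOfLE (Fin.le_last (f (Fin.last p')))) ≫ w ≫
          τ.map (homOfLE (Fin.zero_le (g 0)))) := by
  refine CategoryTheory.Functor.hext ?_ ?_
  · rintro (a | a) <;> rfl
  · rintro (a | a) (b | b) h
    · rfl
    · refine heq_of_eq ?_
      change σ.map (homOfLE (Fin.le_last (f a))) ≫ w ≫ τ.map (homOfLE (Fin.zero_le (g b))) =
        σ.map (homOfLE (f.monotone (Fin.le_last a))) ≫
          (σ.map (homOfLE (Fin.le_last (f (Fin.last p')))) ≫ w ≫
            τ.map (homOfLE (Fin.zero_le (g 0)))) ≫ τ.map (homOfLE (g.monotone (Fin.zero_le b)))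
      simp only [Category.assoc, ← Functor.map_comp, ← Functor.map_comp_assoc, homOfLE_comp]
    · exact (Sum.Lex.not_inr_le_inl (leOfHom h)).elim
    · rfl

/-- The ordinal sum of two finite ordinals is a finite ordinal. -/
def finSumIso (p q : ℕ) : (Fin (p + 1) ⊕ₗ Fin (q + 1)) ≃o Fin (p + q + 1 + 1) :=
  StrictMono.orderIsoOfRightInverse
    (fun x => match ofLex x with
      | .inl a => ⟨a, by lia⟩
      | .inr b => ⟨p + 1 + b, by lia⟩)
    (by
      rintro (a | a) (b | b) h
      · exact (Sum.Lex.inl_lt_inl_iff (α := Fin (p + 1)) (β := Fin (q + 1))).1 h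
      · exact Fin.mk_lt_mk.2 (by lia)
      · exact (Sum.Lex.not_inr_lt_inl h).elim
      · have : (a : ℕ) < b := (Sum.Lex.inr_lt_inr_iff (α := Fin (p + 1)) (β := Fin (q + 1))).1 h
        exact Fin.mk_lt_mk.2 (by lia))
    (fun x => if h : (x : ℕ) < p + 1 then Sum.inlₗ ⟨x, h⟩ else Sum.inrₗ ⟨x - (p + 1), by lia⟩)
    (fun x => by
      by_cases h : (x : ℕ) < p + 1
      · simp [h]
      · simp only [h, dite_false]
        exact Fin.ext (by change p + 1 + (x - (p + 1)) = (x : ℕ); lia))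

namespace Simplex

/-- The map in the subdivision given by a strictly monotone map. -/
def face {τ σ : Simplex C} (f : Fin (σ.dim + 1) ↪o Fin (τ.dim + 1))
    (h : f.monotone.functor ⋙ τ.functor = σ.functor) : τ ⟶ σ :=
  ⟨τ.functor.map (homOfLE (Fin.zero_le (f 0))) ≫ eqToHom (Functor.congr_obj h 0),
    f, f.strictMono, h, rfl⟩

lemma face_comp {τ σ ω : Simplex C} (f : Fin (σ.dim + 1) ↪o Fin (τ.dim + 1))
    (g : Fin (ω.dim + 1) ↪o Fin (σ.dim + 1))
    (h : f.monotone.functor ⋙ τ.functor = σ.functor)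
    (h' : g.monotone.functor ⋙ σ.functor = ω.functor)
    (h'' : (OrderEmbedding.monotone (g.trans f)).functor ⋙ τ.functor = ω.functor) :
    face f h ≫ face g h' = face (g.trans f) h'' :=
  Subtype.ext (comp_aux f.strictMono g.strictMono h h').2

lemma face_congr {τ σ : Simplex C} {f g : Fin (σ.dim + 1) ↪o Fin (τ.dim + 1)} (hfg : f = g)
    (h : f.monotone.functor ⋙ τ.functor = σ.functor)
    (h' : g.monotone.functor ⋙ τ.functor = σ.functor) : face f h = face g h' := by
  subst hfg
  rfl

lemma face_comp_eq_face_comp {τ σ σ' ω : Simplex C} {f : Fin (σ.dim + 1) ↪o Fin (τ.dim + 1)}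
    {g : Fin (ω.dim + 1) ↪o Fin (σ.dim + 1)} {f' : Fin (σ'.dim + 1) ↪o Fin (τ.dim + 1)}
    {g' : Fin (ω.dim + 1) ↪o Fin (σ'.dim + 1)} (e : ∀ x, f (g x) = f' (g' x))
    (h : f.monotone.functor ⋙ τ.functor = σ.functor)
    (k : g.monotone.functor ⋙ σ.functor = ω.functor)
    (h' : f'.monotone.functor ⋙ τ.functor = σ'.functor)
    (k' : g'.monotone.functor ⋙ σ'.functor = ω.functor) :
    face f h ≫ face g k = face f' h' ≫ face g' k' := by
  have e' : g.trans f = g'.trans f' := RelEmbedding.ext e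
  have a : (OrderEmbedding.monotone (g.trans f)).functor ⋙ τ.functor = ω.functor :=
    (comp_aux f.strictMono g.strictMono h k).1
  have a' : (OrderEmbedding.monotone (g'.trans f')).functor ⋙ τ.functor = ω.functor :=
    (comp_aux f'.strictMono g'.strictMono h' k').1
  rw [face_comp f g h k a, face_comp f' g' h' k' a', face_congr e']

lemma exists_eq_face {τ : Simplex C} {q : ℕ} {σ : Fin (q + 1) ⥤ C} (t : τ ⟶ ⟨q, σ⟩) :
    ∃ (f : Fin (q + 1) ↪o Fin (τ.dim + 1)) (h : f.monotone.functor ⋙ τ.functor = σ),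
      t = face (σ := ⟨q, σ⟩) f h := by
  obtain ⟨v, f, hf, h, e⟩ := t
  exact ⟨OrderEmbedding.ofStrictMono f hf, h, Subtype.ext e⟩

/-- The ordinal sum of simplices. -/
abbrev join (σ τ : Simplex C) (w : σ.functor.obj (Fin.last σ.dim) ⟶ τ.functor.obj 0) :
    Simplex C where
  dim := σ.dim + τ.dim + 1
  functor := (finSumIso σ.dim τ.dim).symm.monotone.functor ⋙ sumFunctor σ.functor τ.functor w

section

variable (σ τ : Simplex C) (w : σ.functor.obj (Fin.last σ.dim) ⟶ τ.functor.obj 0)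

/-- The inclusion of the first summand of an ordinal sum. -/
def inlEmb (p q : ℕ) : Fin (p + 1) ↪o Fin (p + q + 1 + 1) :=
  (OrderEmbedding.ofStrictMono Sum.inlₗ Sum.Lex.inl_strictMono).trans
    (finSumIso p q).toOrderEmbedding

/-- The inclusion of the second summand of an ordinal sum. -/
def inrEmb (p q : ℕ) : Fin (q + 1) ↪o Fin (p + q + 1 + 1) :=
  (OrderEmbedding.ofStrictMono Sum.inrₗ Sum.Lex.inr_strictMono).trans
    (finSumIso p q).toOrderEmbedding

lemma functor_comp_functor_congr {X Y Z : Type*} [Preorder X] [Preorder Y] [Preorder Z]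
    {f : X → Y} {g : Y → Z} {h : X → Z} (hf : Monotone f) (hg : Monotone g) (hh : Monotone h)
    (e : ∀ x, g (f x) = h x) (F : Z ⥤ C) :
    hf.functor ⋙ hg.functor ⋙ F = hh.functor ⋙ F := by
  obtain rfl : g ∘ f = h := funext e
  rfl

lemma inl_aux : (inlEmb σ.dim τ.dim).monotone.functor ⋙ (join σ τ w).functor = σ.functor :=
  (functor_comp_functor_congr _ _ Sum.Lex.inl_mono
    (fun x => (finSumIso σ.dim τ.dim).symm_apply_apply (Sum.inlₗ x)) _).trans rfl

lemma inr_aux : (inrEmb σ.dim τ.dim).monotone.functor ⋙ (join σ τ w).functor = τ.functor :=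
  (functor_comp_functor_congr _ _ Sum.Lex.inr_mono
    (fun x => (finSumIso σ.dim τ.dim).symm_apply_apply (Sum.inrₗ x)) _).trans rfl

/-- The map from the ordinal sum to the first summand. -/
def inl : join σ τ w ⟶ σ := face (inlEmb σ.dim τ.dim) (inl_aux σ τ w)

/-- The map from the ordinal sum to the second summand. -/
def inr : join σ τ w ⟶ τ := face (inrEmb σ.dim τ.dim) (inr_aux σ τ w)

lemma functor_map_homOfLE_comp_eqToHom {L : Type*} [Preorder L] (F : L ⥤ C) {x x' y y' : L}
    (hx : x = x') (hy : y = y') (h : x ≤ y) (h' : x' ≤ y') {X Y : C} (eX : F.obj x' = X)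
    (eY : F.obj y' = Y) :
    F.map (homOfLE h) ≫ eqToHom ((congr_arg F.obj hy).trans eY) =
      eqToHom ((congr_arg F.obj hx).trans eX) ≫ eqToHom eX.symm ≫ F.map (homOfLE h') ≫ eqToHom eY := by
  subst hx hy eX eY
  simp

lemma inl_comp : (inl σ τ w).1 ≫ σ.functor.map (homOfLE (Fin.zero_le (Fin.last σ.dim))) ≫ w =
    (inr σ τ w).1 := by
  have h : inlEmb σ.dim τ.dim 0 ≤ inrEmb σ.dim τ.dim 0 :=
    (finSumIso σ.dim τ.dim).monotone (Sum.Lex.inl_le_inr _ _)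
  have e := functor_map_homOfLE_comp_eqToHom (sumFunctor σ.functor τ.functor w)
    ((finSumIso σ.dim τ.dim).symm_apply_apply (Sum.inlₗ 0))
    ((finSumIso σ.dim τ.dim).symm_apply_apply (Sum.inrₗ 0))
    ((finSumIso σ.dim τ.dim).symm.monotone h)
    (Sum.Lex.inl_le_inr _ _) rfl rfl
  have e' : (sumFunctor σ.functor τ.functor w).map (homOfLE (Sum.Lex.inl_le_inr 0 0)) =
      σ.functor.map (homOfLE (Fin.zero_le (Fin.last σ.dim))) ≫ w := by
    change σ.functor.map _ ≫ w ≫ τ.functor.map (𝟙 _) = _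
    rw [CategoryTheory.Functor.map_id, Category.comp_id]
  rw [eqToHom_refl, eqToHom_refl, Category.comp_id, Category.id_comp, e'] at e
  have : (inr σ τ w).1 = (join σ τ w).functor.map (homOfLE (Fin.zero_le (inlEmb _ _ 0))) ≫
      (join σ τ w).functor.map (homOfLE h) ≫ eqToHom (congr_arg (sumFunctor _ _ w).obj
        ((finSumIso σ.dim τ.dim).symm_apply_apply (Sum.inrₗ 0))) := by
    rw [← Functor.map_comp_assoc]
    rfl
  rw [this]
  refine (Category.assoc _ _ _).trans (congr_arg _ ?_)
  exact e.symm

instance isIso_inl : IsIso (inl σ τ w).1 := by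
  have (x : Fin (σ.dim + τ.dim + 1 + 1)) (hx : x = 0) :
      IsIso ((join σ τ w).functor.map (homOfLE (Fin.zero_le x))) := by
    subst hx
    exact inferInstanceAs (IsIso ((join σ τ w).functor.map (𝟙 _)))
  have := this (inlEmb σ.dim τ.dim 0) rfl
  have i₂ {X Y Z : C} (a : X ⟶ Y) [IsIso a] (h : Y = Z) : IsIso (a ≫ eqToHom h) := inferInstance
  exact i₂ ((join σ τ w).functor.map (homOfLE (Fin.zero_le (inlEmb σ.dim τ.dim 0)))) _

variable {σ τ w} in
lemma hom_join_ext {ω : Simplex C} {f g : ω ⟶ join σ τ w} (h : f ≫ inl σ τ w = g ≫ inl σ τ w) :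
    f = g := by
  have := congr_arg Subtype.val h
  change f.1 ≫ (inl σ τ w).1 = g.1 ≫ (inl σ τ w).1 at this
  rw [cancel_mono] at this
  exact Subtype.ext this

end

/-- The face of a simplex given by a strictly monotone map. -/
abbrev restrict (σ : Simplex C) {p : ℕ} (f : Fin (p + 1) ↪o Fin (σ.dim + 1)) : Simplex C :=
  ⟨p, f.monotone.functor ⋙ σ.functor⟩

/-- The map from a simplex to one of its faces. -/
abbrev toRestrict (σ : Simplex C) {p : ℕ} (f : Fin (p + 1) ↪o Fin (σ.dim + 1)) :
    σ ⟶ σ.restrict f :=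
  face (σ := σ.restrict f) f rfl

lemma exists_joinMap {σ τ τ' : Simplex C} {w : σ.functor.obj (Fin.last σ.dim) ⟶ τ.functor.obj 0}
    {p' : ℕ} (f : Fin (p' + 1) ↪o Fin (σ.dim + 1)) (t : τ ⟶ τ')
    {w' : σ.functor.obj (f (Fin.last p')) ⟶ τ'.functor.obj 0}
    (h : w' = σ.functor.map (homOfLE (Fin.le_last (f (Fin.last p')))) ≫ w ≫ t.1) :
    ∃ φ : join σ τ w ⟶ join (σ.restrict f) τ' w',
      φ ≫ inl (σ.restrict f) τ' w' = inl σ τ w ≫ σ.toRestrict f ∧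
      φ ≫ inr (σ.restrict f) τ' w' = inr σ τ w ≫ t := by
  obtain ⟨q', τ'⟩ := τ'
  obtain ⟨g, rfl, rfl⟩ := exists_eq_face t
  have h : w' = σ.functor.map (homOfLE (Fin.le_last (f (Fin.last p')))) ≫ w ≫
    τ.functor.map (homOfLE (Fin.zero_le (g 0))) := h.trans
      (congr_arg (_ ≫ _ ≫ ·) (Category.comp_id _))
  subst h
  let J : Fin (p' + q' + 1 + 1) ↪o Fin (σ.dim + τ.dim + 1 + 1) :=
    ((finSumIso p' q').symm.toOrderEmbedding.trans (sumMap f g)).trans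
      (finSumIso σ.dim τ.dim).toOrderEmbedding
  have hJ : J.monotone.functor ⋙ (join σ τ w).functor =
      (join (σ.restrict f) (τ.restrict g) _).functor :=
    (functor_comp_functor_congr _ _
      (OrderEmbedding.monotone ((finSumIso p' q').symm.toOrderEmbedding.trans (sumMap f g)))
        (fun x => (finSumIso σ.dim τ.dim).symm_apply_apply _) _).trans
      (congr_arg ((finSumIso p' q').symm.monotone.functor ⋙ ·) (sumMap_functor f g _ _ w))
  refine ⟨face (σ := join (σ.restrict f) (τ.restrict g) _) J hJ, ?_, ?_⟩
  · exact face_comp_eq_face_comp (τ := join σ τ w) (σ' := σ)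
      (σ := join (σ.restrict f) (τ.restrict g) _) (ω := σ.restrict f)
      (f := J) (g := inlEmb p' q') (f' := inlEmb σ.dim τ.dim) (g' := f)
      (fun x => congr_arg (fun y => finSumIso σ.dim τ.dim (sumMap f g y))
        ((finSumIso p' q').symm_apply_apply (Sum.inlₗ x))) hJ
        (inl_aux (σ.restrict f) (τ.restrict g) _) (inl_aux σ τ w) rfl
  · exact face_comp_eq_face_comp (τ := join σ τ w) (σ' := τ)
      (σ := join (σ.restrict f) (τ.restrict g) _) (ω := τ.restrict g)
      (f := J) (g := inrEmb p' q') (f' := inrEmb σ.dim τ.dim) (g' := g)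
      (fun x => congr_arg (fun y => finSumIso σ.dim τ.dim (sumMap f g y))
        ((finSumIso p' q').symm_apply_apply (Sum.inrₗ x))) hJ
        (inr_aux (σ.restrict f) (τ.restrict g) _) (inr_aux σ τ w) rfl

end Simplex

end Join

namespace ProductData

section

variable {k : Type u} [CommRing k] {B₀ B : Type u} [SmallCategory B₀] [SmallCategory B]

/-- Product data given by maps of algebras. -/
def mkOfAlgebra (A₀ : B₀ᵒᵖ ⥤ AlgCat.{u} k) (A₁ : Bᵒᵖ ⥤ AlgCat.{u} k) (I : B ⥤ Type u)
    (o : I.Elements ⥤ B₀) (ψ : ∀ e : I.Elements, A₁.obj (op e.1) ⟶ A₀.obj (op (o.obj e)))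
    (hψ : ∀ (e e' : I.Elements) (f : e ⟶ e'),
      ψ e' ≫ A₀.map (o.map f).op = A₁.map f.1.op ≫ ψ e) :
    ProductData (A₀ ⋙ forget₂ (AlgCat.{u} k) RingCat.{u})
      (A₁ ⋙ forget₂ (AlgCat.{u} k) RingCat.{u}) where
  I := I
  o := o
  α e := (ψ e).hom.toRingHom
  α_map {e e'} f a := congr($(hψ e e' f) a)

lemma isLinear_mkOfAlgebra (A₀ : B₀ᵒᵖ ⥤ AlgCat.{u} k) (A₁ : Bᵒᵖ ⥤ AlgCat.{u} k) (I : B ⥤ Type u)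
    (o : I.Elements ⥤ B₀) (ψ : ∀ e : I.Elements, A₁.obj (op e.1) ⟶ A₀.obj (op (o.obj e)))
    (hψ : ∀ (e e' : I.Elements) (f : e ⟶ e'),
      ψ e' ≫ A₀.map (o.map f).op = A₁.map f.1.op ≫ ψ e) :
    (mkOfAlgebra A₀ A₁ I o ψ hψ).IsLinear :=
  fun e c => (ψ e).hom.commutes c

end

section

variable {B₀ B : Type u} [SmallCategory B₀] [SmallCategory B] {R₀ : B₀ᵒᵖ ⥤ RingCat.{u}}
  {R₁ : Bᵒᵖ ⥤ RingCat.{u}}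

/-- The maps in the category of elements induced by a natural transformation. -/
abbrev elementsMap {I I' : B ⥤ Type u} (ρ : I' ⟶ I) {e e' : I'.Elements} (f : e ⟶ e') :
    I.elementsMk e.1 (ρ.app _ e.2) ⟶ I.elementsMk e'.1 (ρ.app _ e'.2) :=
  CategoryOfElements.homMk _ _ f.1 (by
    have := ρ.naturality_apply f.1 e.2
    exact this.symm.trans (congr_arg (ρ.app _) f.2))

/-- Data inducing a natural transformation between product functors. -/
structure Hom (S S' : ProductData R₀ R₁) where
  /-- the map on indices -/
  ρ : S'.I ⟶ S.I
  /-- the map on objects -/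
  χ (e : S'.I.Elements) : S'.o.obj e ⟶ S.o.obj (S.I.elementsMk e.1 (ρ.app e.1 e.2))
  naturality {e e' : S'.I.Elements} (f : e ⟶ e') :
    S'.o.map f ≫ χ e' = χ e ≫ S.o.map (elementsMap ρ f)
  α_comp (e : S'.I.Elements) (a : R₁.obj (op e.1)) :
    R₀.map (χ e).op (S.α (S.I.elementsMk e.1 (ρ.app e.1 e.2)) a) = S'.α e a

/-- The natural transformation between product functors. -/
def Hom.trans {S S' : ProductData R₀ R₁} (h : Hom S S') : S.functor ⟶ S'.functor where
  app N := lift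
    (fun e => (AddMonoidHom.mk' (fun x => N.map (h.χ e).op x) (map_add (N.map (h.χ e).op).hom)).comp
      (S.proj N (S.I.elementsMk e.1 (h.ρ.app e.1 e.2))))
    (fun e a y => by
      refine (N.map_smul (h.χ e).op (S.α (S.I.elementsMk e.1 (h.ρ.app e.1 e.2)) a)
        (S.app y (h.ρ.app e.1 e.2))).trans ?_
      rw [h.α_comp]
      rfl)
    (fun e e' f y => by
      refine (congr_arg (N.map (h.χ e).op) (app_map (elementsMap h.ρ f) y)).trans ?_
      refine (N.map_comp_apply _ _ _).symm.trans (Eq.trans ?_ (N.map_comp_apply (h.χ e').op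
        (S'.o.map f).op (S.app y (h.ρ.app e'.1 e'.2))))
      rw [← op_comp, ← op_comp, h.naturality])
  naturality N N' φ := hom_ext fun i y s => (PresheafOfModules.naturality_apply φ
    (h.χ (S'.I.elementsMk i s)).op (S.app y (h.ρ.app i s))).symm

end

end ProductData

section Index

variable (C : Type u) [SmallCategory C]

/-- Simplices with a map from the last vertex to a given object. -/
def lastIndex (p : ℕ) : C ⥤ Type u where
  obj i := Σ σ : Fin (p + 1) ⥤ C, σ.obj (Fin.last p) ⟶ i
  map f := TypeCat.ofHom fun s => ⟨s.1, s.2 ≫ f⟩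
  map_id i := by
    refine ConcreteCategory.hom_ext _ _ fun s => ?_
    exact Sigma.ext rfl (heq_of_eq (Category.comp_id s.2))
  map_comp f g := by
    refine ConcreteCategory.hom_ext _ _ fun s => ?_
    exact Sigma.ext rfl (heq_of_eq (Category.assoc s.2 f g).symm)

variable {C}

/-- Constructor for elements of `lastIndex`. -/
abbrev lastIndexMk {p : ℕ} {i : C} (σ : Fin (p + 1) ⥤ C) (w : σ.obj (Fin.last p) ⟶ i) :
    (lastIndex C p).obj i := ⟨σ, w⟩

lemma lastIndex_induction {p : ℕ} {motive : ∀ {e e' : (lastIndex C p).Elements}, (e ⟶ e') → Prop}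
    (h : ∀ (i i' : C) (g : i ⟶ i') (σ : Fin (p + 1) ⥤ C) (w : σ.obj (Fin.last p) ⟶ i),
      motive (CategoryOfElements.homMk ((lastIndex C p).elementsMk i (lastIndexMk σ w))
        ((lastIndex C p).elementsMk i' (lastIndexMk σ (w ≫ g))) g rfl))
    {e e' : (lastIndex C p).Elements} (f : e ⟶ e') : motive f := by
  obtain ⟨i, σ, w⟩ := e
  obtain ⟨i', s⟩ := e'
  obtain ⟨g, hg⟩ := f
  change i ⟶ i' at g
  change (lastIndex C p).map g (lastIndexMk σ w) = s at hg
  subst hg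
  exact h i i' g σ w

/-- The underlying simplex of an index. -/
def lastSimplex (p : ℕ) : (lastIndex C p).Elements ⥤ Simplex C where
  obj e := ⟨p, e.2.1⟩
  map f := eqToHom (congr_arg (Simplex.mk p) (congr_arg Sigma.fst f.2))
  map_id _ := rfl
  map_comp _ _ := (eqToHom_trans _ _).symm

/-- The map from the initial vertex of an index. -/
def lastHom {p : ℕ} (e : (lastIndex C p).Elements) :
    (initialVertex C).obj ((lastSimplex p).obj e) ⟶ e.1 :=
  e.2.1.map (homOfLE (Fin.zero_le (Fin.last p))) ≫ e.2.2

lemma lastHom_naturality {p : ℕ} {e e' : (lastIndex C p).Elements} (f : e ⟶ e') :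
    (initialVertex C).map ((lastSimplex p).map f) ≫ lastHom e' = lastHom e ≫ f.1 := by
  induction f using lastIndex_induction with
  | h i i' g σ w =>
    exact (Category.id_comp (lastHom ((lastIndex C p).elementsMk i'
      (lastIndexMk σ (w ≫ g))))).trans (Category.assoc _ w g).symm

/-- Restriction of indices along a strictly monotone map. -/
def lastRestrict {p q : ℕ} (f : Fin (p + 1) ↪o Fin (q + 1)) : lastIndex C q ⟶ lastIndex C p where
  app i := TypeCat.ofHom fun s => lastIndexMk (f.monotone.functor ⋙ s.1)
    (s.1.map (homOfLE (Fin.le_last (f (Fin.last p)))) ≫ s.2)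
  naturality i i' g := by
    refine ConcreteCategory.hom_ext _ _ fun s => ?_
    exact Sigma.ext rfl (heq_of_eq (Category.assoc _ s.2 g).symm)

/-- The map from a simplex to its restriction. -/
def lastFace {p q : ℕ} (f : Fin (p + 1) ↪o Fin (q + 1)) (e : (lastIndex C q).Elements) :
    (lastSimplex q).obj e ⟶ (lastSimplex p).obj ((lastIndex C p).elementsMk e.1
      ((lastRestrict f).app e.1 e.2)) :=
  Simplex.toRestrict ⟨q, e.2.1⟩ f

lemma lastFace_naturality {p q : ℕ} (f : Fin (p + 1) ↪o Fin (q + 1))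
    {e e' : (lastIndex C q).Elements} (g : e ⟶ e') :
    (lastSimplex q).map g ≫ lastFace f e' =
      lastFace f e ≫ (lastSimplex p).map (ProductData.elementsMap (lastRestrict f) g) := by
  induction g using lastIndex_induction with
  | h i i' g σ w =>
    exact (Category.id_comp (Simplex.toRestrict ⟨q, σ⟩ f)).trans
      (Category.comp_id (Simplex.toRestrict ⟨q, σ⟩ f)).symm

lemma lastFace_lastHom {p q : ℕ} (f : Fin (p + 1) ↪o Fin (q + 1)) (e : (lastIndex C q).Elements) :
    (initialVertex C).map (lastFace f e) ≫ lastHom ((lastIndex C p).elementsMk e.1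
      ((lastRestrict f).app e.1 e.2)) = lastHom e := by
  obtain ⟨i, σ, w⟩ := e
  change (σ.map (homOfLE (Fin.zero_le (f 0))) ≫ 𝟙 _) ≫
    σ.map (homOfLE (f.monotone (Fin.zero_le (Fin.last p)))) ≫
      σ.map (homOfLE (Fin.le_last (f (Fin.last p)))) ≫ w = σ.map _ ≫ w
  rw [Category.comp_id, ← Functor.map_comp_assoc, ← Functor.map_comp_assoc]
  rfl

/-- The map of indices given by the functor of initial vertices. -/
abbrev joinIndexMap {p : ℕ} {e e' : (initialVertex C ⋙ lastIndex C p).Elements} (f : e ⟶ e') :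
    (lastIndex C p).elementsMk ((initialVertex C).obj e.1) e.2 ⟶
      (lastIndex C p).elementsMk ((initialVertex C).obj e'.1) e'.2 :=
  CategoryOfElements.homMk _ _ ((initialVertex C).map f.1) f.2

/-- The ordinal sum given by an index. -/
abbrev joinObj {p : ℕ} (e : (initialVertex C ⋙ lastIndex C p).Elements) : Simplex C :=
  Simplex.join ⟨p, e.2.1⟩ e.1 e.2.2

/-- The projection to the first summand. -/
abbrev joinInl {p : ℕ} (e : (initialVertex C ⋙ lastIndex C p).Elements) :
    joinObj e ⟶ (lastSimplex p).obj
      ((lastIndex C p).elementsMk ((initialVertex C).obj e.1) e.2) :=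
  Simplex.inl ⟨p, e.2.1⟩ e.1 e.2.2

/-- The projection to the second summand. -/
abbrev joinInr {p : ℕ} (e : (initialVertex C ⋙ lastIndex C p).Elements) : joinObj e ⟶ e.1 :=
  Simplex.inr ⟨p, e.2.1⟩ e.1 e.2.2

lemma exists_joinIndexMap {p : ℕ} {e e' : (initialVertex C ⋙ lastIndex C p).Elements}
    (f : e ⟶ e') : ∃ φ : joinObj e ⟶ joinObj e',
      φ ≫ joinInl e' = joinInl e ≫ (lastSimplex p).map (joinIndexMap f) ∧
      φ ≫ joinInr e' = joinInr e ≫ f.1 := by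
  obtain ⟨τ, σ, w⟩ := e
  obtain ⟨τ', s⟩ := e'
  obtain ⟨t, h⟩ := f
  change τ ⟶ τ' at t
  change (lastIndex C p).map ((initialVertex C).map t) (lastIndexMk σ w) = s at h
  subst h
  obtain ⟨φ, h₁, h₂⟩ := Simplex.exists_joinMap (σ := ⟨p, σ⟩) (w := w) (τ' := τ')
    (RelEmbedding.refl _) t (w' := w ≫ t.1) (by
      refine (Category.id_comp _).symm.trans (congr_arg (· ≫ w ≫ t.1) ?_)
      exact (σ.map_id _).symm)
  refine ⟨φ, h₁.trans (congr_arg (Simplex.inl ⟨p, σ⟩ τ w ≫ ·) (Subtype.ext ?_)), h₂⟩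
  refine (Category.comp_id _).trans ?_
  exact σ.map_id 0

/-- The ordinal sums given by indices. -/
def joinSimplex (p : ℕ) : (initialVertex C ⋙ lastIndex C p).Elements ⥤ Simplex C where
  obj := joinObj
  map f := (exists_joinIndexMap f).choose
  map_id e := Simplex.hom_join_ext ((exists_joinIndexMap (𝟙 e)).choose_spec.1.trans
    ((Category.comp_id (joinInl e)).trans (Category.id_comp (joinInl e)).symm))
  map_comp {e e' e''} f g := Simplex.hom_join_ext (by
    refine (exists_joinIndexMap (f ≫ g)).choose_spec.1.trans (Eq.trans ?_
      (Category.assoc _ _ _).symm)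
    refine Eq.trans ?_ (congr_arg (_ ≫ ·) (exists_joinIndexMap g).choose_spec.1.symm)
    refine Eq.trans ?_ (Category.assoc _ _ _)
    refine Eq.trans ?_ (congr_arg (· ≫ _) (exists_joinIndexMap f).choose_spec.1.symm)
    refine Eq.trans ?_ (Category.assoc _ _ _).symm
    exact congr_arg (_ ≫ ·) ((lastSimplex p).map_comp (joinIndexMap f) (joinIndexMap g)))

lemma joinSimplex_map_inl {p : ℕ} {e e' : (initialVertex C ⋙ lastIndex C p).Elements}
    (f : e ⟶ e') : (joinSimplex p).map f ≫ joinInl e' =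
      joinInl e ≫ (lastSimplex p).map (joinIndexMap f) :=
  (exists_joinIndexMap f).choose_spec.1

lemma joinSimplex_map_inr {p : ℕ} {e e' : (initialVertex C ⋙ lastIndex C p).Elements}
    (f : e ⟶ e') : (joinSimplex p).map f ≫ joinInr e' = joinInr e ≫ f.1 :=
  (exists_joinIndexMap f).choose_spec.2

lemma exists_joinFace {p q : ℕ} (f : Fin (p + 1) ↪o Fin (q + 1))
    (e : (initialVertex C ⋙ lastIndex C q).Elements) :
    ∃ φ : joinObj e ⟶ joinObj ((initialVertex C ⋙ lastIndex C p).elementsMk e.1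
        ((lastRestrict f).app _ e.2)),
      φ ≫ joinInl _ = joinInl e ≫ lastFace f
        ((lastIndex C q).elementsMk ((initialVertex C).obj e.1) e.2) ∧
      φ ≫ joinInr _ = joinInr e := by
  obtain ⟨τ, σ, w⟩ := e
  obtain ⟨φ, h₁, h₂⟩ := Simplex.exists_joinMap (σ := ⟨q, σ⟩) (w := w) (τ' := τ) f (𝟙 τ)
    (w' := σ.map (homOfLE (Fin.le_last (f (Fin.last p)))) ≫ w)
    (congr_arg (σ.map _ ≫ ·) (Category.comp_id w).symm)
  exact ⟨φ, h₁, h₂.trans (Category.comp_id _)⟩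

/-- The map from an ordinal sum to its restriction. -/
def joinFace {p q : ℕ} (f : Fin (p + 1) ↪o Fin (q + 1))
    (e : (initialVertex C ⋙ lastIndex C q).Elements) :
    (joinSimplex q).obj e ⟶ (joinSimplex p).obj
      ((initialVertex C ⋙ lastIndex C p).elementsMk e.1 ((lastRestrict f).app _ e.2)) :=
  (exists_joinFace f e).choose

lemma joinFace_inl {p q : ℕ} (f : Fin (p + 1) ↪o Fin (q + 1))
    (e : (initialVertex C ⋙ lastIndex C q).Elements) :
    joinFace f e ≫ joinInl _ = joinInl e ≫ lastFace f
        ((lastIndex C q).elementsMk ((initialVertex C).obj e.1) e.2) :=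
  (exists_joinFace f e).choose_spec.1

lemma joinFace_inr {p q : ℕ} (f : Fin (p + 1) ↪o Fin (q + 1))
    (e : (initialVertex C ⋙ lastIndex C q).Elements) :
    joinFace f e ≫ joinInr _ = joinInr e :=
  (exists_joinFace f e).choose_spec.2

lemma joinFace_naturality {p q : ℕ} (f : Fin (p + 1) ↪o Fin (q + 1))
    {e e' : (initialVertex C ⋙ lastIndex C q).Elements} (g : e ⟶ e') :
    (joinSimplex q).map g ≫ joinFace f e' = joinFace f e ≫ (joinSimplex p).map
      (ProductData.elementsMap (Functor.whiskerLeft (initialVertex C) (lastRestrict f)) g) := by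
  refine Simplex.hom_join_ext ?_
  refine (Category.assoc _ _ _).trans (Eq.trans ?_ (Category.assoc _ _ _).symm)
  refine (congr_arg (_ ≫ ·) (joinFace_inl f e')).trans ?_
  refine (Category.assoc _ _ _).symm.trans ((congr_arg (· ≫ _) (joinSimplex_map_inl g)).trans ?_)
  refine (Category.assoc _ _ _).trans ?_
  refine (congr_arg (_ ≫ ·) (lastFace_naturality f (joinIndexMap g))).trans ?_
  refine (Category.assoc _ _ _).symm.trans ((congr_arg (· ≫ _) (joinFace_inl f e).symm).trans ?_)
  refine (Category.assoc _ _ _).trans (congr_arg (_ ≫ ·) ?_)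
  exact (joinSimplex_map_inl (ProductData.elementsMap
    (Functor.whiskerLeft (initialVertex C) (lastRestrict f)) g)).symm

end Index

section Kan

lemma map_congr {C : Type u} [SmallCategory C] {R : Cᵒᵖ ⥤ RingCat.{u}} (M : PresheafOfModules.{u} R)
    {X Y : C} (y : M.obj (op Y)) {f g : X ⟶ Y} (h : f = g) : M.map f.op y = M.map g.op y := by
  rw [h]

variable {C : Type u} [SmallCategory C] {k : Type u} [CommRing k] (A : Cᵒᵖ ⥤ AlgCat.{u} k)

/-- The data defining the terms of the homotopy right Kan extension along `d`. -/
abbrev kanData (p : ℕ) : ProductData (subdivision A ⋙ forget₂ (AlgCat.{u} k) RingCat.{u})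
    (A ⋙ forget₂ (AlgCat.{u} k) RingCat.{u}) :=
  ProductData.mkOfAlgebra (subdivision A) A (lastIndex C p) (lastSimplex p)
    (fun e => A.map (lastHom e).op) (fun e e' f =>
      (A.map_comp (lastHom e').op ((initialVertex C).map ((lastSimplex p).map f)).op).symm.trans
        ((congr_arg (fun g => A.map g.op) (lastHom_naturality f)).trans
          (A.map_comp f.1.op (lastHom e).op)))

/-- The coface maps of the homotopy right Kan extension along `d`. -/
def kanFace {p q : ℕ} (f : Fin (p + 1) ↪o Fin (q + 1)) : (kanData A p).Hom (kanData A q) where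
  ρ := lastRestrict f
  χ := lastFace f
  naturality := lastFace_naturality f
  α_comp e a := congr($((A.map_comp (lastHom ((lastIndex C p).elementsMk e.1
      ((lastRestrict f).app e.1 e.2))).op ((initialVertex C).map (lastFace f e)).op).symm.trans
    (congr_arg (fun g => A.map g.op) (lastFace_lastHom f e))) a)

lemma app_congr_lastIndex {p : ℕ} {N : AMod (subdivision A)} {i : C}
    (x : ((kanData A p).obj N).obj (op i)) {σ : Fin (p + 1) ⥤ C} {w w' : σ.obj (Fin.last p) ⟶ i}
    (hw : w = w') {ω : Simplex C} {φ φ' : ω ⟶ ⟨p, σ⟩} (hφ : φ = φ') :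
    N.map φ.op ((kanData A p).app x (lastIndexMk σ w)) =
      N.map φ'.op ((kanData A p).app x (lastIndexMk σ w')) := by
  subst hw hφ
  rfl

/-- The homotopy right Kan extension along `d`, as a semi-cosimplicial functor. -/
abbrev kan : SemiCosimplicialFunctor (AMod (subdivision A)) (AMod A) where
  R p := (kanData A p).functor
  additive p := inferInstance
  δ f := (kanFace A f).trans
  δ_comp_δ {p q r} f g := by
    ext N : 2
    refine ProductData.hom_ext fun i x s => ?_
    obtain ⟨σ, w⟩ := s
    let S : Simplex C := ⟨r, σ⟩
    refine (N.map_comp_apply (Simplex.toRestrict (S.restrict g) f).op (S.toRestrict g).op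
      _).symm.trans ?_
    refine app_congr_lastIndex A x (σ := (OrderEmbedding.monotone (f.trans g)).functor ⋙ σ)
      (φ := S.toRestrict g ≫ (S.restrict g).toRestrict f) (φ' := S.toRestrict (f.trans g)) ?_ ?_
    · refine (Category.assoc _ _ _).symm.trans (congr_arg (· ≫ w) (σ.map_comp _ _).symm)
    · exact Simplex.face_comp (τ := S) (σ := S.restrict g) (ω := S.restrict (f.trans g)) g f rfl rfl rfl

/-- The data defining the terms of the functor of ordinal sums. -/
abbrev joinData (p : ℕ) : ProductData (subdivision A ⋙ forget₂ (AlgCat.{u} k) RingCat.{u})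
    (subdivision A ⋙ forget₂ (AlgCat.{u} k) RingCat.{u}) :=
  ProductData.mkOfAlgebra (subdivision A) (subdivision A) (initialVertex C ⋙ lastIndex C p)
    (joinSimplex p) (fun e => (subdivision A).map (joinInr e).op) (fun e e' f =>
      ((subdivision A).map_comp (joinInr e').op ((joinSimplex p).map f).op).symm.trans
        ((congr_arg (fun g => (subdivision A).map g.op) (joinSimplex_map_inr f)).trans
          ((subdivision A).map_comp f.1.op (joinInr e).op)))

/-- The coface maps of the functor of ordinal sums. -/
def joinFaceHom {p q : ℕ} (f : Fin (p + 1) ↪o Fin (q + 1)) :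
    (joinData A p).Hom (joinData A q) where
  ρ := Functor.whiskerLeft (initialVertex C) (lastRestrict f)
  χ := joinFace f
  naturality := joinFace_naturality f
  α_comp e a := congr($(((subdivision A).map_comp (joinInr _).op (joinFace f e).op).symm.trans
    (congr_arg (fun g => (subdivision A).map g.op) (joinFace_inr f e))) a)

lemma app_congr_join {p : ℕ} {N : AMod (subdivision A)} {τ : Simplex C}
    (x : ((joinData A p).obj N).obj (op τ)) {σ : Fin (p + 1) ⥤ C}
    {w w' : σ.obj (Fin.last p) ⟶ (initialVertex C).obj τ}
    (hw : w = w') {ω : Simplex C} {φ : ω ⟶ Simplex.join ⟨p, σ⟩ τ w}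
    {φ' : ω ⟶ Simplex.join ⟨p, σ⟩ τ w'}
    (hφ : φ ≫ Simplex.inl ⟨p, σ⟩ τ w = φ' ≫ Simplex.inl ⟨p, σ⟩ τ w') :
    N.map φ.op ((joinData A p).app x (lastIndexMk σ w)) =
      N.map φ'.op ((joinData A p).app x (lastIndexMk σ w')) := by
  subst hw
  rw [Simplex.hom_join_ext hφ]

/-- The ordinal sum functor, as a semi-cosimplicial functor. -/
abbrev joinFunctor : SemiCosimplicialFunctor (AMod (subdivision A)) (AMod (subdivision A)) where
  R p := (joinData A p).functor
  additive p := inferInstance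
  δ f := (joinFaceHom A f).trans
  δ_comp_δ {p q r} f g := by
    ext N : 2
    refine ProductData.hom_ext fun τ x s => ?_
    obtain ⟨σ, w⟩ := s
    let S : Simplex C := ⟨r, σ⟩
    let e := (initialVertex C ⋙ lastIndex C r).elementsMk τ (lastIndexMk σ w)
    let e' := (initialVertex C ⋙ lastIndex C q).elementsMk τ ((lastRestrict g).app _ e.2)
    refine (N.map_comp_apply (joinFace f e').op (joinFace g e).op _).symm.trans ?_
    refine app_congr_join A x (σ := (OrderEmbedding.monotone (f.trans g)).functor ⋙ σ)
      (φ := joinFace g e ≫ joinFace f e') (φ' := joinFace (f.trans g) e) ?_ ?_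
    · refine (Category.assoc _ _ _).symm.trans (congr_arg (· ≫ w) (σ.map_comp _ _).symm)
    · refine (Category.assoc _ _ _).trans ((congr_arg (_ ≫ ·) (joinFace_inl f e')).trans ?_)
      refine (Category.assoc _ _ _).symm.trans ((congr_arg (· ≫ _) (joinFace_inl g e)).trans ?_)
      refine (Category.assoc _ _ _).trans (Eq.trans ?_ (joinFace_inl (f.trans g) e).symm)
      exact congr_arg (joinInl e ≫ ·)
        (Simplex.face_comp (τ := S) (σ := S.restrict g) (ω := S.restrict (f.trans g)) g f rfl rfl rfl)

/-- The comparison map from the pullback of the homotopy right Kan extension. -/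
def comparison (p : ℕ) : (kanData A p).functor ⋙ dStar A ⟶ (joinData A p).functor where
  app N := ProductData.lift (S := joinData A p)
    (fun e => (AddMonoidHom.mk' (fun x => N.map (joinInl e).op x)
      (map_add (N.map (joinInl e).op).hom)).comp ((kanData A p).proj N
        ((lastIndex C p).elementsMk ((initialVertex C).obj e.1) e.2)))
    (fun e a y => by
      refine (N.map_smul (joinInl e).op ((kanData A p).α ((lastIndex C p).elementsMk
        ((initialVertex C).obj e.1) e.2) a) ((kanData A p).app y e.2)).trans ?_
      refine congr_arg (fun b : (subdivision A).obj (op (joinObj e)) =>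
        show N.obj (op (joinObj e)) from b • N.map (joinInl e).op ((kanData A p).app y e.2)) ?_
      have := congr_arg (fun g => A.map g.op) (Simplex.inl_comp ⟨p, e.2.1⟩ e.1 e.2.2)
      exact congr($((A.map_comp (lastHom ((lastIndex C p).elementsMk
        ((initialVertex C).obj e.1) e.2)).op (joinInl e).1.op).symm.trans this) a))
    (fun e e' f y => by
      have h := ProductData.app_map (S := kanData A p) (N := N) (joinIndexMap f) y
      refine (congr_arg (N.map (joinInl e).op) h).trans ?_
      refine (N.map_comp_apply ((lastSimplex p).map (joinIndexMap f)).op (joinInl e).op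
        ((kanData A p).app y e'.2)).symm.trans (Eq.trans ?_ (N.map_comp_apply (joinInl e').op
        ((joinSimplex p).map f).op ((kanData A p).app y e'.2)))
      exact map_congr N ((kanData A p).app y e'.2)
        (joinSimplex_map_inl f).symm)
  naturality N N' φ := ProductData.hom_ext fun τ y s => (PresheafOfModules.naturality_apply φ
    (joinInl ((initialVertex C ⋙ lastIndex C p).elementsMk τ s)).op ((kanData A p).app y s)).symm

lemma comparison_δ {p q : ℕ} (f : Fin (p + 1) ↪o Fin (q + 1)) :
    Functor.whiskerRight ((kan A).δ f) (dStar A) ≫ comparison A q =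
      comparison A p ≫ (joinFunctor A).δ f := by
  ext N : 2
  refine ProductData.hom_ext fun τ x s => ?_
  let e := (initialVertex C ⋙ lastIndex C q).elementsMk τ s
  refine (N.map_comp_apply (lastFace f ((lastIndex C q).elementsMk ((initialVertex C).obj e.1)
    e.2)).op (joinInl e).op _).symm.trans (Eq.trans ?_ (N.map_comp_apply (joinInl _).op
      (joinFace f e).op _))
  exact map_congr N ((kanData A p).app x ((lastRestrict f).app _ s))
    (joinFace_inl f e).symm

/-- The augmentation of the homotopy right Kan extension. -/
def kanAug : 𝟭 (AMod A) ⟶ dStar A ⋙ (kanData A 0).functor where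
  app M := ProductData.lift (S := kanData A 0) (N := (dStar A).obj M)
    (fun e => AddMonoidHom.mk' (fun x => M.map (lastHom e).op x) (map_add (M.map _).hom))
    (fun e a y => M.map_smul (lastHom e).op a y)
    (fun e e' f y => by
      refine (M.map_comp_apply f.1.op (lastHom e).op y).symm.trans (Eq.trans ?_
        (M.map_comp_apply (lastHom e').op ((initialVertex C).map ((lastSimplex 0).map f)).op y))
      exact map_congr M y (lastHom_naturality f).symm)
  naturality M M' φ := ProductData.hom_ext fun i y s => (PresheafOfModules.naturality_apply φ
    (lastHom ((lastIndex C 0).elementsMk i s)).op y).symm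

lemma kanAug_δ {q : ℕ} (f g : Fin (0 + 1) ↪o Fin (q + 1)) :
    kanAug A ≫ Functor.whiskerLeft (dStar A) ((kan A).δ f) =
      kanAug A ≫ Functor.whiskerLeft (dStar A) ((kan A).δ g) := by
  ext M : 2
  refine ProductData.hom_ext fun i y s => ?_
  let e := (lastIndex C q).elementsMk i s
  have h (f : Fin (0 + 1) ↪o Fin (q + 1)) : (kanData A q).app
      (((kanAug A ≫ Functor.whiskerLeft (dStar A) ((kan A).δ f)).app M).app (op i) y) s =
        M.map (lastHom e).op y := by
    refine (M.map_comp_apply (lastHom ((lastIndex C 0).elementsMk e.1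
      ((lastRestrict f).app e.1 e.2))).op ((initialVertex C).map (lastFace f e)).op y).symm.trans ?_
    exact map_congr M y (lastFace_lastHom f e)
  exact (h f).trans (h g).symm

/-- The augmentation of the functor of ordinal sums. -/
def joinAug : 𝟭 (AMod (subdivision A)) ⟶ (joinData A 0).functor where
  app N := ProductData.lift (S := joinData A 0)
    (fun e => AddMonoidHom.mk' (fun x => N.map (joinInr e).op x) (map_add (N.map _).hom))
    (fun e a y => N.map_smul (joinInr e).op a y)
    (fun e e' f y => by
      refine (N.map_comp_apply f.1.op (joinInr e).op y).symm.trans (Eq.trans ?_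
        (N.map_comp_apply (joinInr e').op ((joinSimplex 0).map f).op y))
      exact map_congr N y (joinSimplex_map_inr f).symm)
  naturality N N' φ := ProductData.hom_ext fun τ y s => (PresheafOfModules.naturality_apply φ
    (joinInr ((initialVertex C ⋙ lastIndex C 0).elementsMk τ s)).op y).symm

lemma joinAug_δ {q : ℕ} (f g : Fin (0 + 1) ↪o Fin (q + 1)) :
    joinAug A ≫ (joinFunctor A).δ f = joinAug A ≫ (joinFunctor A).δ g := by
  ext N : 2
  refine ProductData.hom_ext fun τ y s => ?_
  let e := (initialVertex C ⋙ lastIndex C q).elementsMk τ s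
  have h (f : Fin (0 + 1) ↪o Fin (q + 1)) : (joinData A q).app
      (((joinAug A ≫ (joinFunctor A).δ f).app N).app (op τ) y) s = N.map (joinInr e).op y := by
    refine (N.map_comp_apply (joinInr _).op (joinFace f e).op y).symm.trans ?_
    exact map_congr N y (joinFace_inr f e)
  exact (h f).trans (h g).symm

lemma kanAug_comparison (M : AMod A) : (dStar A).map ((kanAug A).app M) ≫
    (comparison A 0).app ((dStar A).obj M) = (joinAug A).app ((dStar A).obj M) := by
  refine ProductData.hom_ext fun τ y s => ?_
  let e := (initialVertex C ⋙ lastIndex C 0).elementsMk τ s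
  refine (M.map_comp_apply (lastHom ((lastIndex C 0).elementsMk ((initialVertex C).obj e.1)
    e.2)).op (joinInl e).1.op y).symm.trans ?_
  exact map_congr M y (Simplex.inl_comp ⟨0, e.2.1⟩ e.1 e.2.2)

instance isIso_comparison (p : ℕ) (M : AMod A) : IsIso ((comparison A p).app ((dStar A).obj M)) := by
  have : IsIso ((PresheafOfModules.toPresheaf _).map ((comparison A p).app ((dStar A).obj M))) := by
    rw [NatTrans.isIso_iff_isIso_app]
    intro τ
    rw [ConcreteCategory.isIso_iff_bijective]
    have hb (e : (initialVertex C ⋙ lastIndex C p).Elements) :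
        Function.Bijective (fun x => M.map (joinInl e).1.op x) := by
      have : IsIso (M.presheaf.map (joinInl e).1.op) := by
        have : IsIso (joinInl e).1 := 
          Simplex.isIso_inl ⟨p, e.2.1⟩ e.1 e.2.2
        infer_instance
      exact (ConcreteCategory.isIso_iff_bijective (M.presheaf.map (joinInl e).1.op)).1 this
    let b (s : (initialVertex C ⋙ lastIndex C p).obj τ.unop) :=
      Equiv.ofBijective _ (hb ((initialVertex C ⋙ lastIndex C p).elementsMk τ.unop s))
    exact (Equiv.piCongrRight b).bijective
  exact isIso_of_reflects_iso _ (PresheafOfModules.toPresheaf _)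

end Kan

section Contraction

variable {C : Type u} [SmallCategory C] {k : Type u} [CommRing k] {A : Cᵒᵖ ⥤ AlgCat.{u} k}

lemma kan_cochain_apply {p : ℕ} (N : AMod (subdivision A)) {i : C}
    (x : ((kanData A p).obj N).obj (op i)) (s : (lastIndex C (p + 1)).obj i) :
    (kanData A (p + 1)).app ((((kan A).cochain.D p).app N).app (op i) x) s =
      ∑ j : Fin (p + 2), (-1 : ℤ) ^ (j : ℕ) •
        N.map (lastFace (Fin.succAboveOrderEmb j) ((lastIndex C (p + 1)).elementsMk i s)).op
          ((kanData A p).app x ((lastRestrict (Fin.succAboveOrderEmb j)).app _ s)) := by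
  let ev : ((kanData A p).obj N ⟶ (kanData A (p + 1)).obj N) →+
      N.obj (op ((kanData A (p + 1)).o.obj ⟨i, s⟩)) :=
    AddMonoidHom.mk' (fun g => (kanData A (p + 1)).app (g.app (op i) x) s) (fun _ _ => rfl)
  have h : ((kan A).cochain.D p).app N =
      ∑ j : Fin (p + 2), (-1 : ℤ) ^ (j : ℕ) • ((kan A).face j).app N := by
    refine (NatTrans.app_sum _ _ _).trans (Finset.sum_congr rfl fun j _ => ?_)
    exact NatTrans.app_zsmul _ _ _
  refine (congr_arg ev h).trans ((map_sum ev _ _).trans (Finset.sum_congr rfl fun j _ => ?_))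
  exact map_zsmul ev _ _

variable {M : AMod A} {i : C}

/-- The differential on families. -/
abbrev familyD {p : ℕ} (x : ((kanData A p).obj ((dStar A).obj M)).obj (op i)) :
    ((kanData A (p + 1)).obj ((dStar A).obj M)).obj (op i) :=
  (((kan A).cochain.D p).app ((dStar A).obj M)).app (op i) x

/-- The constant families. -/
abbrev familyAug (y : M.obj (op i)) : ((kanData A 0).obj ((dStar A).obj M)).obj (op i) :=
  ((kanAug A).app M).app (op i) y

/-- The components of a family. -/
abbrev component {n : ℕ} (x : ((kanData A n).obj ((dStar A).obj M)).obj (op i))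
    (τ : Fin (n + 1) ⥤ C) (w : τ.obj (Fin.last n) ⟶ i) : M.obj (op (τ.obj 0)) :=
  (kanData A n).app x (lastIndexMk τ w)

lemma component_congr {n : ℕ} (x : ((kanData A n).obj ((dStar A).obj M)).obj (op i))
    {τ : Fin (n + 1) ⥤ C} {w w' : τ.obj (Fin.last n) ⟶ i} (h : w = w') :
    component x τ w = component x τ w' := by
  rw [h]

lemma map_homOfLE_comp_map {L : Type*} [Preorder L] (Γ : L ⥤ C) {x y z : L} (h : x ≤ y)
    (h' : y ≤ z) : Γ.map (homOfLE h) ≫ Γ.map (homOfLE h') = Γ.map (homOfLE (h.trans h')) :=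
  (Γ.map_comp _ _).symm

section

variable {L : Type*} [Preorder L] (Γ : L ⥤ C) {b t : L} (hb : ∀ x, b ≤ x) (ht : ∀ x, x ≤ t)
  (c : Γ.obj t ⟶ i)

/-- The value of a family at the simplex given by a monotone map, restricted to the initial
object. -/
def evalAt {n : ℕ} (f : Fin (n + 1) → L) (hf : Monotone f)
    (x : ((kanData A n).obj ((dStar A).obj M)).obj (op i)) : M.obj (op (Γ.obj b)) :=
  M.map (Γ.map (homOfLE (hb (f 0)))).op
    (component x (hf.functor ⋙ Γ) (Γ.map (homOfLE (ht (f (Fin.last n)))) ≫ c))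

lemma evalAt_add {n : ℕ} (f : Fin (n + 1) → L) (hf : Monotone f)
    (x y : ((kanData A n).obj ((dStar A).obj M)).obj (op i)) :
    evalAt Γ hb ht c f hf (x + y) = evalAt Γ hb ht c f hf x + evalAt Γ hb ht c f hf y :=
  map_add (M.map _).hom _ _

lemma evalAt_smul {n : ℕ} (f : Fin (n + 1) → L) (hf : Monotone f) (a : k)
    (x : ((kanData A n).obj ((dStar A).obj M)).obj (op i)) :
    evalAt Γ hb ht c f hf (show ((kanData A n).obj ((dStar A).obj M)).obj (op i) from
      (show (A ⋙ forget₂ (AlgCat.{u} k) RingCat.{u}).obj (op i) from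
        algebraMap k (A.obj (op i)) a) • x) =
      (show (A ⋙ forget₂ (AlgCat.{u} k) RingCat.{u}).obj (op (Γ.obj b)) from
        algebraMap k (A.obj (op (Γ.obj b))) a) • evalAt Γ hb ht c f hf x := by
  let w : (hf.functor ⋙ Γ).obj (Fin.last n) ⟶ i := Γ.map (homOfLE (ht (f (Fin.last n)))) ≫ c
  let y := component x (hf.functor ⋙ Γ) w
  refine (M.map_smul (Γ.map (homOfLE (hb (f 0)))).op (A.map
    (lastHom ((lastIndex C n).elementsMk i (lastIndexMk (hf.functor ⋙ Γ) w))).op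
      (algebraMap k (A.obj (op i)) a)) y).trans ?_
  refine congr_arg (fun r : A.obj (op (Γ.obj b)) => show M.obj (op (Γ.obj b)) from
    r • M.map (Γ.map (homOfLE (hb (f 0)))).op y) ?_
  exact (congr_arg (A.map (Γ.map (homOfLE (hb (f 0)))).op) ((A.map _).hom.commutes a)).trans
    ((A.map (Γ.map (homOfLE (hb (f 0)))).op).hom.commutes a)

lemma evalAt_naturality {M' : AMod A} (η : M ⟶ M') {n : ℕ} (f : Fin (n + 1) → L) (hf : Monotone f)
    (x : ((kanData A n).obj ((dStar A).obj M)).obj (op i)) :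
    evalAt Γ hb ht c f hf (((kanData A n).functor.map ((dStar A).map η)).app (op i) x) =
      η.app _ (evalAt Γ hb ht c f hf x) :=
  (PresheafOfModules.naturality_apply η (Γ.map (homOfLE (hb (f 0)))).op
    (component x (hf.functor ⋙ Γ) (Γ.map (homOfLE (ht (f (Fin.last n)))) ≫ c))).symm

lemma evalAt_congr {n : ℕ} {f g : Fin (n + 1) → L} (h : f = g) (hf : Monotone f) (hg : Monotone g)
    (x : ((kanData A n).obj ((dStar A).obj M)).obj (op i)) :
    evalAt Γ hb ht c f hf x = evalAt Γ hb ht c g hg x := by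
  subst h
  rfl

lemma evalAt_cochain {n : ℕ} (f : Fin (n + 2) → L) (hf : Monotone f)
    (x : ((kanData A n).obj ((dStar A).obj M)).obj (op i)) :
    evalAt Γ hb ht c f hf (familyD x) =
      ∑ j : Fin (n + 2), (-1 : ℤ) ^ (j : ℕ) • evalAt Γ hb ht c (f ∘ j.succAbove)
        (hf.comp (Fin.strictMono_succAbove j).monotone) x := by
  refine (congr_arg (M.map (Γ.map (homOfLE (hb (f 0)))).op)
    (kan_cochain_apply _ x (lastIndexMk (hf.functor ⋙ Γ) _))).trans ?_
  refine (map_sum (M.map (Γ.map (homOfLE (hb (f 0)))).op).hom _ _).trans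
    (Finset.sum_congr rfl fun j _ => ?_)
  refine (map_zsmul (M.map (Γ.map (homOfLE (hb (f 0)))).op).hom.toAddMonoidHom _ _).trans
    (congr_arg _ ?_)
  have h₀ : f 0 ≤ f (j.succAbove 0) := hf (Fin.zero_le _)
  let y := component x ((hf.comp (Fin.strictMono_succAbove j).monotone).functor ⋙ Γ)
    (Γ.map (homOfLE (hf (Fin.le_last (j.succAbove (Fin.last n))))) ≫
      Γ.map (homOfLE (ht (f (Fin.last (n + 1))))) ≫ c)
  refine (M.map_comp_apply (Γ.map (homOfLE h₀) ≫ 𝟙 _).op (Γ.map (homOfLE (hb (f 0)))).op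
    y).symm.trans ?_
  refine (map_congr M y (f := Γ.map (homOfLE (hb (f 0))) ≫ Γ.map (homOfLE h₀) ≫ 𝟙 _)
    (g := Γ.map (homOfLE (hb (f (j.succAbove 0))))) ?_).trans ?_
  · exact (congr_arg (_ ≫ ·) (Category.comp_id _)).trans (map_homOfLE_comp_map Γ _ _)
  · refine congr_arg (M.map (Γ.map (homOfLE (hb (f (j.succAbove 0))))).op)
      (component_congr x ?_)
    exact (Category.assoc _ _ _).symm.trans (congr_arg (· ≫ c) (map_homOfLE_comp_map Γ _ _))

lemma evalAt_comp {L' : Type*} [Preorder L'] {b' t' : L'} (hb' : ∀ x, b' ≤ x) (ht' : ∀ x, x ≤ t')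
    {g : L' → L} (hg : Monotone g) {Γ' : L' ⥤ C} (h : hg.functor ⋙ Γ = Γ') (c' : Γ'.obj t' ⟶ i)
    (hc : c' = eqToHom (CategoryTheory.Functor.congr_obj h t').symm ≫
      Γ.map (homOfLE (ht (g t'))) ≫ c)
    {n : ℕ} (f : Fin (n + 1) → L') (hf : Monotone f)
    (x : ((kanData A n).obj ((dStar A).obj M)).obj (op i)) :
    M.map (Γ.map (homOfLE (hb (g b'))) ≫ eqToHom (CategoryTheory.Functor.congr_obj h b')).op
      (evalAt Γ' hb' ht' c' f hf x) = evalAt Γ hb ht c (g ∘ f) (hg.comp hf) x := by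
  subst h hc
  have h₀ : g b' ≤ g (f 0) := hg (hb' _)
  let y := component x (hf.functor ⋙ hg.functor ⋙ Γ)
    (Γ.map (homOfLE (hg (ht' (f (Fin.last n))))) ≫ 𝟙 _ ≫ Γ.map (homOfLE (ht (g t'))) ≫ c)
  refine (M.map_comp_apply (Γ.map (homOfLE h₀)).op (Γ.map (homOfLE (hb (g b'))) ≫ 𝟙 _).op
    y).symm.trans ?_
  refine (map_congr M y (f := (Γ.map (homOfLE (hb (g b'))) ≫ 𝟙 _) ≫ Γ.map (homOfLE h₀))
    (g := Γ.map (homOfLE (hb (g (f 0))))) ?_).trans ?_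
  · exact (congr_arg (· ≫ _) (Category.comp_id _)).trans (map_homOfLE_comp_map Γ _ _)
  · refine congr_arg (M.map (Γ.map (homOfLE (hb (g (f 0))))).op)
      (component_congr (τ := (hg.comp hf).functor ⋙ Γ) x ?_)
    refine (congr_arg (_ ≫ ·) (Category.id_comp _)).trans ?_
    exact (Category.assoc _ _ _).symm.trans (congr_arg (· ≫ c) (map_homOfLE_comp_map Γ _ _))

end

/-- The functor on an ordinal with a new last vertex. -/
abbrev snocFunctor {p : ℕ} (s : (lastIndex C p).obj i) : (Fin (p + 1) ⊕ₗ Fin (0 + 1)) ⥤ C :=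
  sumFunctor s.1 ((Functor.const (Fin (0 + 1))).obj i) s.2

lemma inl_zero_le {p : ℕ} (x : Fin (p + 1) ⊕ₗ Fin (0 + 1)) : Sum.inlₗ 0 ≤ x := by
  obtain a | a := x
  · exact Sum.Lex.inl_le_inl_iff.2 (Fin.zero_le a)
  · exact Sum.Lex.inl_le_inr _ _

lemma le_inr_zero {p : ℕ} (x : Fin (p + 1) ⊕ₗ Fin (0 + 1)) : x ≤ Sum.inrₗ 0 := by
  obtain a | a := x
  · exact Sum.Lex.inl_le_inr _ _
  · exact Sum.Lex.inr_le_inr_iff.2 (Fin.le_last a)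

/-- The value of a family at a simplex of an ordinal with a new last vertex. -/
abbrev evalSnoc {p : ℕ} (s : (lastIndex C p).obj i) {n : ℕ}
    (f : Fin (n + 1) → Fin (p + 1) ⊕ₗ Fin (0 + 1)) (hf : Monotone f)
    (x : ((kanData A n).obj ((dStar A).obj M)).obj (op i)) : M.obj (op (s.1.obj 0)) :=
  evalAt (snocFunctor s) inl_zero_le le_inr_zero (𝟙 i) f hf x

lemma evalSnoc_inl {p : ℕ} (s : (lastIndex C p).obj i)
    (x : ((kanData A p).obj ((dStar A).obj M)).obj (op i)) :
    evalSnoc s Sum.inlₗ Sum.Lex.inl_mono x = component x s.1 s.2 := by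
  obtain ⟨σ, w⟩ := s
  have h : (σ.map (homOfLE (Fin.le_last (Fin.last p))) ≫ w ≫ 𝟙 i) ≫ 𝟙 i = w := by
    rw [Category.comp_id, Category.comp_id]
    exact (congr_arg (· ≫ w) (σ.map_id _)).trans (Category.id_comp w)
  refine Eq.trans ?_ (component_congr (τ := σ) x h)
  let y : M.obj (op (σ.obj 0)) := component x σ
    ((σ.map (homOfLE (Fin.le_last (Fin.last p))) ≫ w ≫ 𝟙 i) ≫ 𝟙 i)
  refine (map_congr M y (σ.map_id 0)).trans ?_
  exact congr($(M.map_id _) y)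

lemma sumMap_comp_finSumIso_symm {p : ℕ} (j : Fin (p + 2)) :
    sumMap (Fin.succAboveOrderEmb j) (RelEmbedding.refl _) ∘ (finSumIso p 0).symm =
      (finSumIso (p + 1) 0).symm ∘ j.castSucc.succAbove := by
  funext x
  obtain ⟨y, rfl⟩ := (finSumIso p 0).surjective x
  refine (congr_arg _ ((finSumIso p 0).symm_apply_apply y)).trans ?_
  refine (OrderIso.eq_symm_apply _).2 (Fin.ext ?_)
  obtain a | b := y
  · change (j.succAbove a : ℕ) = _
    have h : ((finSumIso p 0 (Sum.inlₗ a) : Fin (p + 2)) : ℕ) = a := rfl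
    change _ = ((j.castSucc.succAbove (finSumIso p 0 (Sum.inlₗ a))) : ℕ)
    simp only [Fin.succAbove, Fin.lt_def, Fin.val_castSucc, h]
    split_ifs <;> rfl
  · change p + 1 + 1 + (b : ℕ) = _
    have h : ((finSumIso p 0 (Sum.inrₗ b) : Fin (p + 2)) : ℕ) = p + 1 + b := rfl
    change _ = ((j.castSucc.succAbove (finSumIso p 0 (Sum.inrₗ b))) : ℕ)
    have hj := j.2
    rw [Fin.succAbove_of_le_castSucc]
    · rw [Fin.val_succ, h]
      lia
    · rw [Fin.le_def, Fin.val_castSucc, Fin.val_castSucc, h]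
      lia

lemma finSumIso_symm_comp_last_succAbove (p : ℕ) :
    (finSumIso p 0).symm ∘ (Fin.last (p + 1)).succAbove = Sum.inlₗ := by
  funext a
  refine (OrderIso.symm_apply_eq _).2 (Fin.ext ?_)
  rw [Fin.succAbove_last]
  rfl

lemma evalSnoc_restrict {p : ℕ} (s : (lastIndex C (p + 1)).obj i) (j : Fin (p + 2))
    (x : ((kanData A (p + 1)).obj ((dStar A).obj M)).obj (op i)) :
    M.map (lastFace (Fin.succAboveOrderEmb j) ((lastIndex C (p + 1)).elementsMk i s)).1.op
      (evalSnoc ((lastRestrict (Fin.succAboveOrderEmb j)).app i s) (finSumIso p 0).symm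
        (finSumIso p 0).symm.monotone x) =
      evalSnoc s ((finSumIso (p + 1) 0).symm ∘ j.castSucc.succAbove)
        ((finSumIso (p + 1) 0).symm.monotone.comp (Fin.strictMono_succAbove _).monotone) x := by
  let g := sumMap (Fin.succAboveOrderEmb j) (RelEmbedding.refl (α := Fin (0 + 1)) (· ≤ ·))
  have hw : s.1.map (homOfLE (Fin.le_last (j.succAbove (Fin.last p)))) ≫ s.2 ≫ 𝟙 i =
      s.1.map (homOfLE (Fin.le_last (j.succAbove (Fin.last p)))) ≫ s.2 :=
    congr_arg (_ ≫ ·) (Category.comp_id _)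
  have h : g.monotone.functor ⋙ snocFunctor s =
      snocFunctor ((lastRestrict (Fin.succAboveOrderEmb j)).app i s) :=
    (sumMap_functor _ _ _ _ _).trans (congr_arg (sumFunctor _ _) hw)
  refine Eq.trans ?_ ((evalAt_comp (snocFunctor s) inl_zero_le le_inr_zero (𝟙 i) inl_zero_le
    le_inr_zero g.monotone h (𝟙 i) ?_ (finSumIso p 0).symm (finSumIso p 0).symm.monotone x).trans
      (evalAt_congr (snocFunctor s) inl_zero_le le_inr_zero (𝟙 i)
        (sumMap_comp_finSumIso_symm j) _ _ x))
  · rfl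
  · exact ((Category.id_comp _).trans (Category.id_comp _)).symm

lemma neg_one_pow_smul_sum {G : Type*} [AddCommGroup G] {n : ℕ} (a : Fin (n + 2) → G) :
    (-1 : ℤ) ^ (n + 1) • ∑ j : Fin (n + 2), (-1 : ℤ) ^ (j : ℕ) • a j =
      a (Fin.last (n + 1)) + ∑ j : Fin (n + 1), (-1 : ℤ) ^ (n + 1 + j : ℕ) • a j.castSucc := by
  rw [Fin.sum_univ_castSucc, smul_add, add_comm, Finset.smul_sum, smul_smul, Fin.val_last,
    ← pow_add, Even.neg_one_pow ⟨n + 1, rfl⟩, one_smul]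
  simp only [smul_smul, ← pow_add, Fin.val_castSucc]

lemma sum_neg_one_pow_smul_add {G : Type*} [AddCommGroup G] {n m : ℕ} (a : Fin m → G) (b : G) :
    (∑ j : Fin m, (-1 : ℤ) ^ (j : ℕ) • (-1 : ℤ) ^ n • a j) +
      (b + ∑ j : Fin m, (-1 : ℤ) ^ (n + 1 + j : ℕ) • a j) = b := by
  rw [add_left_comm, ← Finset.sum_add_distrib]
  refine (congr_arg _ (Finset.sum_eq_zero fun j _ => ?_)).trans (add_zero _)
  rw [smul_smul, ← add_smul, pow_add _ (n + 1), pow_succ]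
  refine (congr_arg (· • _) ?_).trans (zero_smul ℤ _)
  ring

lemma add_sum_fin_one {G : Type*} [AddCommGroup G] (a b : G) (f : Fin (0 + 1) → G) (h : a = f 0) :
    a + (b + ∑ j : Fin (0 + 1), (-1 : ℤ) ^ (0 + 1 + j : ℕ) • f j) = b := by
  subst h
  simp

/-- The maps of the contraction. -/
def snocMap {p : ℕ} (x : ((kanData A (p + 1)).obj ((dStar A).obj M)).obj (op i)) :
    ((kanData A p).obj ((dStar A).obj M)).obj (op i) :=
  show (kanData A p).X ((dStar A).obj M) i from fun s =>
    (-1 : ℤ) ^ (p + 1) • evalSnoc s (finSumIso p 0).symm (finSumIso p 0).symm.monotone x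

lemma evalSnoc_cochain {p : ℕ} (s : (lastIndex C p).obj i)
    (x : ((kanData A p).obj ((dStar A).obj M)).obj (op i)) :
    component (snocMap (familyD x)) s.1 s.2 =
      component x s.1 s.2 + ∑ j : Fin (p + 1), (-1 : ℤ) ^ (p + 1 + j : ℕ) •
        evalSnoc s ((finSumIso p 0).symm ∘ j.castSucc.succAbove)
          ((finSumIso p 0).symm.monotone.comp (Fin.strictMono_succAbove _).monotone) x := by
  refine (congr_arg ((-1 : ℤ) ^ (p + 1) • ·) (evalAt_cochain (snocFunctor s) inl_zero_le le_inr_zero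
    (𝟙 i) (finSumIso p 0).symm (finSumIso p 0).symm.monotone x)).trans ?_
  refine (neg_one_pow_smul_sum _).trans (congr_arg (· + _) ?_)
  exact (evalAt_congr _ _ _ _ (finSumIso_symm_comp_last_succAbove p) _ Sum.Lex.inl_mono x).trans
    (evalSnoc_inl s x)

/-- The map to the unaugmented functor has a retraction. -/
def kanRetraction (x : ((kanData A 0).obj ((dStar A).obj M)).obj (op i)) : M.obj (op i) :=
  component x ((Functor.const _).obj i) (𝟙 i)

lemma kanRetraction_kanAug (y : M.obj (op i)) :
    kanRetraction (familyAug y) = y := by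
  refine (map_congr M y (f := 𝟙 i ≫ 𝟙 i) (Category.id_comp (𝟙 i))).trans ?_
  exact congr($(M.map_id _) y)

lemma kanAug_kanRetraction (x : ((kanData A 0).obj ((dStar A).obj M)).obj (op i)) :
    familyAug (kanRetraction x) +
      snocMap (familyD x) = x := by
  refine ProductData.ext fun s => ?_
  have h : (finSumIso 0 0).symm ∘ (Fin.castSucc 0).succAbove = fun _ => Sum.inrₗ 0 := by
    funext x
    refine (OrderIso.symm_apply_eq _).2 (Fin.ext ?_)
    obtain rfl := Subsingleton.elim x 0
    rfl
  have e : evalSnoc s ((finSumIso 0 0).symm ∘ (Fin.castSucc 0).succAbove)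
      ((finSumIso 0 0).symm.monotone.comp (Fin.strictMono_succAbove _).monotone) x =
        component (familyAug (kanRetraction x)) s.1 s.2 := by
    refine (evalAt_congr _ _ _ _ h _ monotone_const x).trans ?_
    refine (congr_arg (M.map (s.1.map (homOfLE (Fin.zero_le (Fin.last 0))) ≫ s.2 ≫ 𝟙 i).op)
      (component_congr (τ := (Functor.const _).obj i) x (Category.comp_id (𝟙 i)))).trans ?_
    exact map_congr M (kanRetraction x) (congr_arg (_ ≫ ·) (Category.comp_id _))
  refine (congr_arg (component (familyAug (kanRetraction x)) s.1 s.2 + ·)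
    (evalSnoc_cochain s x)).trans ?_
  exact add_sum_fin_one _ _ _ e.symm

lemma snocMap_contraction {p : ℕ}
    (x : ((kanData A (p + 1)).obj ((dStar A).obj M)).obj (op i)) :
    familyD (snocMap x) +
      snocMap (familyD x) = x := by
  refine ProductData.ext fun s => ?_
  have h : component (familyD (snocMap x))
      s.1 s.2 = ∑ j : Fin (p + 2), (-1 : ℤ) ^ (j : ℕ) • (-1 : ℤ) ^ (p + 1) •
        evalSnoc s ((finSumIso (p + 1) 0).symm ∘ j.castSucc.succAbove)
          ((finSumIso (p + 1) 0).symm.monotone.comp (Fin.strictMono_succAbove _).monotone) x := by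
    refine (kan_cochain_apply ((dStar A).obj M) (snocMap x) s).trans
      (Finset.sum_congr rfl fun j _ => congr_arg (_ • ·) ?_)
    refine (map_zsmul (M.map (lastFace (Fin.succAboveOrderEmb j)
      ((lastIndex C (p + 1)).elementsMk i s)).1.op).hom.toAddMonoidHom _ _).trans ?_
    exact congr_arg (_ • ·) (evalSnoc_restrict s j x)
  refine (congr_arg₂ (· + ·) h (evalSnoc_cochain s x)).trans ?_
  exact sum_neg_one_pow_smul_add _ _

end Contraction

section Preservation

variable {C : Type u} [SmallCategory C] {k : Type u} [CommRing k] (A : Cᵒᵖ ⥤ AlgCat.{u} k)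

instance preservesLimitsOfShape_evalK (i : C) (J : Type*) [Category* J] [Small.{u} J] :
    PreservesLimitsOfShape J (evalK A i) := by
  have : PreservesLimitsOfShape J (ModuleCat.restrictScalars.{u} (algebraMap k (A.obj (op i)))) :=
    ⟨inferInstance⟩
  exact comp_preservesLimitsOfShape _ _

instance preservesLimitsOfShape_dStar (J : Type*) [Category* J] [Small.{u} J] :
    PreservesLimitsOfShape J (dStar A) where
  preservesLimit := ⟨fun hc => ⟨PresheafOfModules.evaluationJointlyReflectsLimits _ _ fun τ =>
    isLimitOfPreserves (PresheafOfModules.evaluation (A ⋙ forget₂ (AlgCat.{u} k) RingCat.{u})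
      (op (τ.unop.functor.obj 0))) hc⟩⟩

lemma preservesFiniteLimits_dStar : PreservesFiniteLimits (dStar A) :=
  ⟨fun _ => inferInstance⟩

lemma preservesFiniteColimits_dStar : PreservesFiniteColimits (dStar A) :=
  ⟨fun _ _ _ => ⟨⟨fun hc =>
    ⟨PresheafOfModules.evaluationJointlyReflectsColimits _ _ fun τ =>
      isColimitOfPreserves (PresheafOfModules.evaluation (A ⋙ forget₂ (AlgCat.{u} k) RingCat.{u})
        (op (τ.unop.functor.obj 0))) hc⟩⟩⟩⟩

end Preservation

section Augmentation

variable {C : Type u} [SmallCategory C] {k : Type u} [CommRing k] (A : Cᵒᵖ ⥤ AlgCat.{u} k)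

/-- The homotopy right Kan extension of the pullback along `d`, evaluated at an object. -/
abbrev kanPullback (i : C) : CochainFunctor (AMod A) (ModuleCat.{u} k) :=
  ((kan A).cochain.postcomp (evalK A i)).precomp (dStar A)

lemma SemiCosimplicialFunctor.comp_alternatingD_app {V W : Type*} [Category* V] [Category* W]
    [Preadditive V] [Preadditive W] (R : SemiCosimplicialFunctor V W) {N : V} {K : W}
    (e : K ⟶ (R.R 0).obj N)
    (h : e ≫ (R.face (0 : Fin 2)).app N = e ≫ (R.face (1 : Fin 2)).app N) :
    e ≫ (R.alternatingD 0).app N = 0 := by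
  have e' : (R.alternatingD 0).app N = (R.face (0 : Fin 2)).app N - (R.face (1 : Fin 2)).app N := by
    rw [SemiCosimplicialFunctor.alternatingD, Fin.sum_univ_two]
    simp [sub_eq_add_neg]
  rw [e', Preadditive.comp_sub, h, sub_self]

lemma kanAug_comp (M : AMod A) :
    (kanAug A).app M ≫ ((kan A).cochain.D 0).app ((dStar A).obj M) = 0 :=
  (kan A).comp_alternatingD_app (N := (dStar A).obj M) ((kanAug A).app M)
    (NatTrans.congr_app (kanAug_δ A _ _) M)

lemma joinAug_comp (N : AMod (subdivision A)) :
    (joinAug A).app N ≫ ((joinFunctor A).cochain.D 0).app N = 0 :=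
  (joinFunctor A).comp_alternatingD_app ((joinAug A).app N)
    (NatTrans.congr_app (joinAug_δ A _ _) N)

variable {A} in
/-- The retraction of the augmentation at an object. -/
def kanRetractionK (M : AMod A) (i : C) :
    (evalK A i).obj ((kanData A 0).obj ((dStar A).obj M)) ⟶ (evalK A i).obj M :=
  ModuleCat.ofHom (X := (evalK A i).obj ((kanData A 0).obj ((dStar A).obj M)))
    (Y := (evalK A i).obj M)
    { toFun x := kanRetraction (i := i) x
      map_add' _ _ := rfl
      map_smul' c x := congr_arg (fun a : A.obj (op i) =>
        show M.obj (op i) from a • kanRetraction (i := i) x) ((A.map _).hom.commutes c) }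

lemma snocMap_smul {M : AMod A} {i : C} {p : ℕ} (c : k)
    (x : (evalK A i).obj ((kanData A (p + 1)).obj ((dStar A).obj M))) :
    snocMap (i := i) (c • x) = (show (evalK A i).obj ((kanData A p).obj ((dStar A).obj M)) from
      c • (show (evalK A i).obj ((kanData A p).obj ((dStar A).obj M)) from
        snocMap (i := i) x)) := by
  refine ProductData.ext fun s => ?_
  refine (congr_arg ((-1 : ℤ) ^ (p + 1) • ·) (evalAt_smul (snocFunctor s) inl_zero_le le_inr_zero
    (𝟙 i) (finSumIso p 0).symm (finSumIso p 0).symm.monotone c x)).trans ?_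
  let y : M.obj (op (s.1.obj 0)) := evalAt (snocFunctor s) inl_zero_le le_inr_zero
    (𝟙 i) (finSumIso p 0).symm (finSumIso p 0).symm.monotone x
  let a : (A ⋙ forget₂ (AlgCat.{u} k) RingCat.{u}).obj (op (s.1.obj 0)) :=
    algebraMap k (A.obj (op (s.1.obj 0))) c
  refine (smul_comm ((-1 : ℤ) ^ (p + 1)) a y).trans ?_
  exact congr_arg (fun a : A.obj (op (s.1.obj 0)) => show M.obj (op (s.1.obj 0)) from
    a • ((-1 : ℤ) ^ (p + 1) • y)) ((A.map _).hom.commutes c).symm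

/-- The maps of the contraction as a natural transformation. -/
def snocTrans (i : C) (p : ℕ) : (kanPullback A i).R (p + 1) ⟶
    (kanPullback A i).R p where
  app M := ModuleCat.ofHom (X := (evalK A i).obj ((kanData A (p + 1)).obj ((dStar A).obj M)))
    (Y := (evalK A i).obj ((kanData A p).obj ((dStar A).obj M)))
    { toFun x := snocMap (i := i) x
      map_add' x y := funext fun s => (congr_arg ((-1 : ℤ) ^ (p + 1) • ·)
        (evalAt_add (snocFunctor s) inl_zero_le le_inr_zero (𝟙 i) _ _ x y)).trans (smul_add _ _ _)
      map_smul' c x := snocMap_smul A c x }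
  naturality M M' η := by
    ext x
    refine ProductData.ext (i := i) fun s => ?_
    refine (congr_arg ((-1 : ℤ) ^ (p + 1) • ·) (evalAt_naturality (snocFunctor s) inl_zero_le
      le_inr_zero (𝟙 i) η (finSumIso p 0).symm (finSumIso p 0).symm.monotone x)).trans ?_
    exact (map_zsmul (η.app (op (s.1.obj 0))).hom.toAddMonoidHom _ _).symm

/-- The termwise augmentation of a complex. -/
def kanAugRow (M : CochainComplex (AMod A) ℤ) :
    M ⟶ mapObj ((kan A).cochain.R 0) (mapObj (dStar A) M) where
  f q := (kanAug A).app (M.X q)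
  comm' q q' _ := ((kanAug A).naturality (M.d q q')).symm

/-- The augmentation of a complex. -/
def kanAugHom (M : CochainComplex (AMod A) ℤ) : M ⟶ (kan A).cochain.tot (mapObj (dStar A) M) :=
  (kan A).cochain.augHom (kanAugRow A M) (fun _ => kanAug_comp A _)

section

variable (M : CochainComplex (AMod A) ℤ) (i : C)

/-- The termwise augmentation of a complex at an object. -/
def kanAugRowK : mapObj (evalK A i) M ⟶
    mapObj (((kan A).cochain.postcomp (evalK A i)).R 0) (mapObj (dStar A) M) where
  f q := (evalK A i).map ((kanAug A).app (M.X q))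
  comm' q q' _ := ((evalK A i).map_comp _ _).symm.trans ((congr_arg (evalK A i).map
    ((kanAug A).naturality (M.d q q')).symm).trans ((evalK A i).map_comp _ _))

/-- The retraction of the termwise augmentation of a complex at an object. -/
def kanRetractionRowK :
    mapObj (((kan A).cochain.postcomp (evalK A i)).R 0) (mapObj (dStar A) M) ⟶
    mapObj (evalK A i) M where
  f q := kanRetractionK (M.X q) i
  comm' q q' _ := by
    ext x
    rfl

lemma kanAugRowK_comp (q : ℤ) : (kanAugRowK A M i).f q ≫
    (((kan A).cochain.postcomp (evalK A i)).D 0).app ((mapObj (dStar A) M).X q) = 0 :=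
  ((evalK A i).map_comp _ _).symm.trans
    ((congr_arg _ (kanAug_comp A _)).trans ((evalK A i).map_zero _ _))

lemma kanAugRowK_kanRetractionRowK : kanAugRowK A M i ≫ kanRetractionRowK A M i = 𝟙 _ := by
  ext q : 1
  ext x
  exact kanRetraction_kanAug (i := i) x

lemma kanRetractionRowK_kanAugRowK (q : ℤ) :
    (show ((kanPullback A i).R 0).obj (M.X q) ⟶ ((kanPullback A i).R 0).obj (M.X q) from
      (kanRetractionRowK A M i).f q ≫ (kanAugRowK A M i).f q) +
      ((kanPullback A i).D 0 ≫ snocTrans A i 0).app (M.X q) = 𝟙 _ := by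
  ext x
  exact kanAug_kanRetraction (i := i) x

lemma snocTrans_contraction (p : ℕ) :
    snocTrans A i p ≫ (kanPullback A i).D p +
      (kanPullback A i).D (p + 1) ≫ snocTrans A i (p + 1) = 𝟙 _ := by
  ext M x
  exact snocMap_contraction (i := i) x

lemma CochainFunctor.isHomotopyIso_augHom_of_precomp {V' V W : Type*} [Category* V'] [Category* V]
    [Category* W] [Preadditive V'] [Preadditive V] [Preadditive W] (R : CochainFunctor V W)
    [∀ m, HasProductsOfShape (TotIndex m) W] (F : V' ⥤ V) [F.Additive]
    {K : CochainComplex W ℤ} {N : CochainComplex V' ℤ} (e : K ⟶ mapObj (R.R 0) (mapObj F N))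
    (he : ∀ q, e.f q ≫ (R.D 0).app ((mapObj F N).X q) = 0)
    (h : IsHomotopyIso ((R.precomp F).augHom (N := N) e he)) :
    IsHomotopyIso (R.augHom e he) := h

lemma isHomotopyIso_augHom_kanAugRowK :
    IsHomotopyIso (((kan A).cochain.postcomp (evalK A i)).augHom (kanAugRowK A M i)
      (kanAugRowK_comp A M i)) :=
  CochainFunctor.isHomotopyIso_augHom_of_precomp _ (dStar A) _ _
    (CochainFunctor.isHomotopyIso_augHom _ _ _ (kanRetractionRowK A M i) (snocTrans A i)
      (kanAugRowK_kanRetractionRowK A M i) (kanRetractionRowK_kanAugRowK A M i)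
      (snocTrans_contraction A i))

lemma map_kanAugHom_mapTot :
    mapHom (evalK A i) (kanAugHom A M) ≫
        (kan A).cochain.mapTot (evalK A i) (mapObj (dStar A) M) =
      ((kan A).cochain.postcomp (evalK A i)).augHom (kanAugRowK A M i) (kanAugRowK_comp A M i) :=
  (kan A).cochain.map_augHom_mapTot (evalK A i) (kanAugRow A M) (fun _ => kanAug_comp A _)
    (kanAugRowK A M i) (kanAugRowK_comp A M i) (fun _ => rfl)

end

lemma isRelQuasiIso_kanAugHom (M : CochainComplex (AMod A) ℤ) :
    IsRelQuasiIso (kanAugHom A M) :=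
  (isRelQuasiIso_iff _).2 fun i => (isHomotopyIso_iff_of_arrow_iso (Iso.refl _)
    (asIso ((kan A).cochain.mapTot (evalK A i) (mapObj (dStar A) M)))
      ((map_kanAugHom_mapTot A M i).trans (Category.id_comp _).symm)).2
        (isHomotopyIso_augHom_kanAugRowK A M i)

end Augmentation

section Contractible

variable {V : Type*} [Category* V] [Preadditive V]

lemma contractible_of_retract {X Y : CochainComplex V ℤ} (i : X ⟶ Y) (r : Y ⟶ X) (h : i ≫ r = 𝟙 X)
    (hY : Nonempty (Homotopy (𝟙 Y) 0)) : Nonempty (Homotopy (𝟙 X) 0) := by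
  obtain ⟨H⟩ := hY
  exact ⟨(Homotopy.ofEq (by rw [Category.id_comp, h])).trans
    (((H.compRight r).compLeft i).trans (Homotopy.ofEq (by simp)))⟩

lemma contractible_of_iso {X Y : CochainComplex V ℤ} (e : X ≅ Y)
    (hY : Nonempty (Homotopy (𝟙 Y) 0)) : Nonempty (Homotopy (𝟙 X) 0) :=
  contractible_of_retract e.hom e.inv e.hom_inv_id hY

end Contractible

section RelQuasiIso

variable {k : Type u} [CommRing k] {B₀ B : Type u} [SmallCategory B₀] [SmallCategory B]
  {A₀ : B₀ᵒᵖ ⥤ AlgCat.{u} k} {A₁ : Bᵒᵖ ⥤ AlgCat.{u} k}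

/-- A functor preserves complexes which are objectwise contractible over `k`. -/
def PreservesRelContractible (F : AMod A₀ ⥤ AMod A₁) [F.Additive] : Prop :=
  ∀ (Z : CochainComplex (AMod A₀) ℤ),
    (∀ j, Nonempty (Homotopy (𝟙 (mapObj (evalK A₀ j) Z)) 0)) →
      ∀ i, Nonempty (Homotopy (𝟙 (mapObj (F ⋙ evalK A₁ i) Z)) 0)

lemma ProductData.preservesRelContractible {S : ProductData
    (A₀ ⋙ forget₂ (AlgCat.{u} k) RingCat.{u}) (A₁ ⋙ forget₂ (AlgCat.{u} k) RingCat.{u})}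
    (hS : S.IsLinear) : PreservesRelContractible S.functor :=
  fun Z h i => S.contractible_functor hS Z i fun _ => h _

lemma isRelQuasiIso_totHom (R : CochainFunctor (AMod A₀) (AMod A₁))
    (hR : ∀ p, PreservesRelContractible (R.R p)) {X Y : CochainComplex (AMod A₀) ℤ} {φ : X ⟶ Y}
    (hφ : IsRelQuasiIso φ) : IsRelQuasiIso (R.totHom φ) := by
  intro i
  have h₁ : Nonempty (Homotopy (𝟙 ((R.postcomp (evalK A₁ i)).tot
      (CochainComplex.mappingCone φ))) 0) :=
    (R.postcomp (evalK A₁ i)).contractible_tot fun p => hR p _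
      (fun j => contractible_of_iso (CochainComplex.mappingCone.mapHomologicalComplexIso φ
        (evalK A₀ j)) (hφ j)) i
  have h₂ := contractible_of_iso
    (asIso (R.mapTot (evalK A₁ i) (CochainComplex.mappingCone φ))) h₁
  obtain ⟨a, r, har⟩ := R.exists_retract_cone φ
  have h₃ := contractible_of_retract (mapHom (evalK A₁ i) a) (mapHom (evalK A₁ i) r)
    (((((evalK A₁ i).mapHomologicalComplex _).map_comp a r).symm.trans
      (congr_arg (mapHom (evalK A₁ i)) har)).trans
        (((evalK A₁ i).mapHomologicalComplex _).map_id _)) h₂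
  exact contractible_of_iso (CochainComplex.mappingCone.mapHomologicalComplexIso (R.totHom φ)
    (evalK A₁ i)).symm h₃

lemma isRelQuasiIso_of_isIso {X Y : CochainComplex (AMod A₀) ℤ} {φ : X ⟶ Y} (_ : IsIso φ) :
    IsRelQuasiIso φ :=
  (isRelQuasiIso_iff φ).2 fun i => isHomotopyIso_of_isIso
    (((evalK A₀ i).mapHomologicalComplex (ComplexShape.up ℤ)).map φ)

lemma IsRelQuasiIso.comp {X Y Z : CochainComplex (AMod A₀) ℤ} {φ : X ⟶ Y} {ψ : Y ⟶ Z}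
    (hφ : IsRelQuasiIso φ) (hψ : IsRelQuasiIso ψ) : IsRelQuasiIso (φ ≫ ψ) :=
  (isRelQuasiIso_iff _).2 fun i => by
    rw [Functor.map_comp]
    exact ((isRelQuasiIso_iff φ).1 hφ i).comp ((isRelQuasiIso_iff ψ).1 hψ i)

instance preservesFiniteLimits_evalK (i : B₀) : PreservesFiniteLimits (evalK A₀ i) :=
  ⟨fun _ => inferInstance⟩

lemma isRelQuasiIso_truncFunctor_map (n : ℤ) {X Y : CochainComplex (AMod A₀) ℤ} {φ : X ⟶ Y}
    (hφ : IsRelQuasiIso φ) : IsRelQuasiIso ((truncFunctor (AMod A₀) n).map φ) :=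
  (isRelQuasiIso_iff _).2 fun i =>
    (IsTrunc.map (evalK A₀ i) n X).isHomotopyIso (IsTrunc.map (evalK A₀ i) n Y)
      (((Functor.map_comp _ _ _).symm.trans (congr_arg _ (truncFunctor_map_ι n φ))).trans
        (Functor.map_comp _ _ _)) ((isRelQuasiIso_iff φ).1 hφ i)

end RelQuasiIso

section Homotopy

variable {C B : Type u} [SmallCategory C] [SmallCategory B] {k : Type u} [CommRing k]
  {A : Cᵒᵖ ⥤ AlgCat.{u} k} {A' : Bᵒᵖ ⥤ AlgCat.{u} k} {S : Set ℤ}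

/-- The functor on homotopy categories induced by a functor which preserves homotopies. -/
def inducedK (G : CochainComplex (AMod A) ℤ ⥤ CochainComplex (AMod A') ℤ)
    (hG : PreservesHomotopies G) {n : ℤ} (hn : n ∈ S)
    (hb : ∀ X m, n < m → IsZero ((G.obj X).X m)) : KMinus A S ⥤ KMinus A' S :=
  (rightBounded (AMod A') S).lift ((rightBounded (AMod A) S).ι ⋙
    CategoryTheory.Quotient.lift _ (G ⋙ HomotopyCategory.quotient _ _)
      (fun _ _ f g ⟨H⟩ => HomotopyCategory.eq_of_homotopy _ _ (hG f g H).some))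
    (fun X => ⟨n, hn, hb X.obj.as⟩)

/-- The class of a map of complexes. -/
abbrev homK {X Y : KMinus A S} (φ : X.obj.as ⟶ Y.obj.as) : X ⟶ Y :=
  ⟨(HomotopyCategory.quotient (AMod A) (ComplexShape.up ℤ)).map φ⟩

lemma exists_homK {X Y : KMinus A S} (f : X ⟶ Y) :
    ∃ φ : X.obj.as ⟶ Y.obj.as, f = homK φ := by
  obtain ⟨φ, hφ⟩ := (HomotopyCategory.quotient (AMod A) (ComplexShape.up ℤ)).map_surjective f.hom
  exact ⟨φ, InducedCategory.hom_ext hφ.symm⟩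

lemma relQuasiIso_homK {X Y : KMinus A S} {φ : X.obj.as ⟶ Y.obj.as} (h : IsRelQuasiIso φ) :
    relQuasiIso A S (homK φ) :=
  ⟨φ, rfl, h⟩

/-- The natural transformation given by maps of complexes. -/
def natTransK {P P' : KMinus A S ⥤ KMinus A' S} (t : ∀ X, (P.obj X).obj.as ⟶ (P'.obj X).obj.as)
    (h : ∀ (X Y : KMinus A S) (φ : X.obj.as ⟶ Y.obj.as), ∃ a b,
      P.map (homK φ) = homK a ∧ P'.map (homK φ) = homK b ∧ a ≫ t Y = t X ≫ b) : P ⟶ P' where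
  app X := homK (t X)
  naturality X Y f := by
    obtain ⟨φ, rfl⟩ := exists_homK f
    obtain ⟨a, b, ha, hb, e⟩ := h X Y φ
    rw [ha, hb]
    refine InducedCategory.hom_ext ?_
    change (HomotopyCategory.quotient _ _).map a ≫ (HomotopyCategory.quotient _ _).map (t Y) =
      (HomotopyCategory.quotient _ _).map (t X) ≫ (HomotopyCategory.quotient _ _).map b
    rw [← Functor.map_comp, ← Functor.map_comp, e]

lemma relQuasiIso_inducedK_map (G : CochainComplex (AMod A) ℤ ⥤ CochainComplex (AMod A') ℤ)
    (hG : PreservesHomotopies G) {n : ℤ} (hn : n ∈ S)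
    (hb : ∀ X m, n < m → IsZero ((G.obj X).X m))
    (h : ∀ {X Y : CochainComplex (AMod A) ℤ} {φ : X ⟶ Y}, IsRelQuasiIso φ →
      IsRelQuasiIso (G.map φ)) ⦃X Y : KMinus A S⦄ (f : X ⟶ Y) (hf : relQuasiIso A S f) :
    relQuasiIso A' S ((inducedK G hG hn hb).map f) := by
  obtain ⟨φ, hφ, h'⟩ := hf
  obtain rfl : homK φ = f := InducedCategory.hom_ext hφ
  exact ⟨G.map φ, rfl, h h'⟩

end Homotopy

section FullyFaithful

variable {C : Type u} [SmallCategory C] {k : Type u} [CommRing k] (A : Cᵒᵖ ⥤ AlgCat.{u} k)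

/-- The termwise augmentation to ordinal sums. -/
def joinAugRow (N : CochainComplex (AMod (subdivision A)) ℤ) :
    N ⟶ mapObj ((joinFunctor A).cochain.R 0) N where
  f q := (joinAug A).app (N.X q)
  comm' q q' _ := ((joinAug A).naturality (N.d q q')).symm

/-- The augmentation to ordinal sums. -/
def joinAugHom (N : CochainComplex (AMod (subdivision A)) ℤ) :
    N ⟶ (joinFunctor A).cochain.tot N :=
  (joinFunctor A).cochain.augHom (joinAugRow A N) (fun _ => joinAug_comp A _)

lemma joinAugHom_totHom {N N' : CochainComplex (AMod (subdivision A)) ℤ} (φ : N ⟶ N') :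
    joinAugHom A N ≫ (joinFunctor A).cochain.totHom φ = φ ≫ joinAugHom A N' := by
  have h (q : ℤ) : (φ ≫ joinAugRow A N').f q ≫
      ((joinFunctor A).cochain.D 0).app (N'.X q) = 0 := by
    refine (Category.assoc _ _ _).trans ((congr_arg _ (joinAug_comp A _)).trans comp_zero)
  refine (CochainFunctor.augHom_totHom _ _ _ φ (φ ≫ joinAugRow A N') h ?_).trans
    (CochainFunctor.comp_augHom _ _ _ φ (φ ≫ joinAugRow A N') h rfl).symm
  ext q : 1
  exact (joinAug A).naturality (φ.f q)

lemma kanAugHom_totHom {M M' : CochainComplex (AMod A) ℤ} (φ : M ⟶ M') :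
    kanAugHom A M ≫ (kan A).cochain.totHom (mapHom (dStar A) φ) = φ ≫ kanAugHom A M' := by
  have h (q : ℤ) : (φ ≫ kanAugRow A M').f q ≫
      ((kan A).cochain.D 0).app ((mapObj (dStar A) M').X q) = 0 := by
    refine (Category.assoc _ _ _).trans ((congr_arg _ (kanAug_comp A _)).trans comp_zero)
  refine (CochainFunctor.augHom_totHom _ _ _ (mapHom (dStar A) φ) (φ ≫ kanAugRow A M') h ?_).trans
    (CochainFunctor.comp_augHom _ _ _ φ (φ ≫ kanAugRow A M') h rfl).symm
  ext q : 1
  exact (kanAug A).naturality (φ.f q)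

lemma SemiCosimplicialFunctor.whiskerRight_alternatingD {V W W' : Type*} [Category* V] [Category* W]
    [Category* W'] [Preadditive V] [Preadditive W] [Preadditive W']
    (R : SemiCosimplicialFunctor V W) (R' : SemiCosimplicialFunctor V W') (F : W ⥤ W')
    [F.Additive] (φ : ∀ p, R.R p ⋙ F ⟶ R'.R p)
    (hφ : ∀ {p q} (f : Fin (p + 1) ↪o Fin (q + 1)),
      Functor.whiskerRight (R.δ f) F ≫ φ q = φ p ≫ R'.δ f) (p : ℕ) :
    Functor.whiskerRight (R.alternatingD p) F ≫ φ (p + 1) = φ p ≫ R'.alternatingD p := by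
  ext N
  have h (i : Fin (p + 2)) : F.map ((R.face i).app N) ≫ (φ (p + 1)).app N =
      (φ p).app N ≫ (R'.face i).app N := NatTrans.congr_app (hφ _) N
  rw [NatTrans.comp_app, Functor.whiskerRight_app, NatTrans.comp_app, alternatingD, alternatingD,
    NatTrans.app_sum, NatTrans.app_sum, F.map_sum, Preadditive.sum_comp, Preadditive.comp_sum]
  refine Finset.sum_congr rfl fun i _ => ?_
  rw [NatTrans.app_zsmul, NatTrans.app_zsmul, F.map_zsmul, Preadditive.zsmul_comp,
    Preadditive.comp_zsmul, h]

lemma comparison_D (p : ℕ) :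
    ((kan A).cochain.postcomp (dStar A)).D p ≫ comparison A (p + 1) =
      comparison A p ≫ (joinFunctor A).cochain.D p :=
  (kan A).whiskerRight_alternatingD (joinFunctor A) (dStar A) (comparison A) (comparison_δ A) p

/-- The comparison of total complexes, as a natural transformation. -/
def totComparison : (kan A).cochain.totFunctor ⋙ (dStar A).mapHomologicalComplex _ ⟶
    (joinFunctor A).cochain.totFunctor :=
  (kan A).cochain.mapTotTrans (dStar A) ≫
    CochainFunctor.totTrans (R := (kan A).cochain.postcomp (dStar A))
      (R' := (joinFunctor A).cochain) (comparison A) (comparison_D A)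

instance isIso_totComparison_app (M : CochainComplex (AMod A) ℤ) :
    IsIso ((totComparison A).app (mapObj (dStar A) M)) := by
  have : IsIso (CochainFunctor.totTransApp (R := (kan A).cochain.postcomp (dStar A))
      (R' := (joinFunctor A).cochain) (comparison A) (comparison_D A) (mapObj (dStar A) M)) :=
    CochainFunctor.isIso_totTransApp _ _ _ fun p q => isIso_comparison A p (M.X q)
  exact IsIso.comp_isIso (f := (kan A).cochain.mapTot (dStar A) (mapObj (dStar A) M))
    (h := CochainFunctor.totTransApp (R := (kan A).cochain.postcomp (dStar A))
      (R' := (joinFunctor A).cochain) (comparison A) (comparison_D A) (mapObj (dStar A) M))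

/-- The pullback of the termwise augmentation. -/
def pullbackAugRow (M : CochainComplex (AMod A) ℤ) : mapObj (dStar A) M ⟶
    mapObj (((kan A).cochain.postcomp (dStar A)).R 0) (mapObj (dStar A) M) where
  f q := (dStar A).map ((kanAug A).app (M.X q))
  comm' q q' _ := ((dStar A).map_comp _ _).symm.trans ((congr_arg (dStar A).map
    ((kanAug A).naturality (M.d q q')).symm).trans ((dStar A).map_comp _ _))

lemma pullbackAugRow_comp (M : CochainComplex (AMod A) ℤ) (q : ℤ) : (pullbackAugRow A M).f q ≫
    (((kan A).cochain.postcomp (dStar A)).D 0).app ((mapObj (dStar A) M).X q) = 0 :=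
  ((dStar A).map_comp _ _).symm.trans
    ((congr_arg (dStar A).map (kanAug_comp A (M.X q))).trans ((dStar A).map_zero _ _))

lemma map_kanAugHom_mapTot_dStar (M : CochainComplex (AMod A) ℤ) :
    mapHom (dStar A) (kanAugHom A M) ≫ (kan A).cochain.mapTot (dStar A) (mapObj (dStar A) M) =
      ((kan A).cochain.postcomp (dStar A)).augHom (pullbackAugRow A M)
        (pullbackAugRow_comp A M) :=
  CochainFunctor.map_augHom_mapTot (kan A).cochain (dStar A) (N := mapObj (dStar A) M)
    (kanAugRow A M) (fun _ => kanAug_comp A _) (pullbackAugRow A M) (pullbackAugRow_comp A M)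
    (fun _ => rfl)

lemma map_kanAugHom_totComparison (M : CochainComplex (AMod A) ℤ) :
    mapHom (dStar A) (kanAugHom A M) ≫ (totComparison A).app (mapObj (dStar A) M) =
      joinAugHom A (mapObj (dStar A) M) := by
  refine (Category.assoc _ _ _).symm.trans
    ((congr_arg (· ≫ _) (map_kanAugHom_mapTot_dStar A M)).trans ?_)
  exact CochainFunctor.augHom_totTransApp (R := (kan A).cochain.postcomp (dStar A))
    (R' := (joinFunctor A).cochain) (pullbackAugRow A M) (pullbackAugRow_comp A M) (comparison A)
    (comparison_D A) (joinAugRow A (mapObj (dStar A) M)) (fun _ => joinAug_comp A _)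
    (fun q => (kanAug_comparison A (M.X q)).symm)

lemma isRelQuasiIso_joinAugHom (M : CochainComplex (AMod A) ℤ) :
    IsRelQuasiIso (joinAugHom A (mapObj (dStar A) M)) := by
  rw [← map_kanAugHom_totComparison]
  exact IsRelQuasiIso.comp (isRelQuasiIso_dStar A (isRelQuasiIso_kanAugHom A M))
    (isRelQuasiIso_of_isIso (isIso_totComparison_app A M))

section Truncated

variable (n : ℤ)

/-- The truncated total complex of the homotopy right Kan extension. -/
abbrev truncKan : CochainComplex (AMod (subdivision A)) ℤ ⥤ CochainComplex (AMod A) ℤ :=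
  (kan A).cochain.totFunctor ⋙ truncFunctor (AMod A) n

/-- The truncated total complex of the functor of ordinal sums. -/
abbrev truncJoin :
    CochainComplex (AMod (subdivision A)) ℤ ⥤ CochainComplex (AMod (subdivision A)) ℤ :=
  (joinFunctor A).cochain.totFunctor ⋙ truncFunctor (AMod (subdivision A)) n

lemma isZero_trunc {B : Type u} [SmallCategory B] {A₀ : Bᵒᵖ ⥤ AlgCat.{u} k}
    (X : CochainComplex (AMod A₀) ℤ) (m : ℤ) (hm : n < m) :
    IsZero (((truncFunctor (AMod A₀) n).obj X).X m) :=
  (isTrunc_truncι n X).isZero m hm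

lemma exists_pullbackTrunc (X : CochainComplex (AMod A) ℤ) :
    ∃ t : mapObj (dStar A) ((truncFunctor (AMod A) n).obj X) ⟶
      (truncFunctor (AMod (subdivision A)) n).obj (mapObj (dStar A) X),
      t ≫ truncι n _ = mapHom (dStar A) (truncι n X) :=
  (isTrunc_truncι n _).exists_homLift
    (fun m hm => (dStar A).map_isZero (isZero_trunc n X m hm)) _

lemma exists_truncComparison (N : CochainComplex (AMod (subdivision A)) ℤ) :
    ∃ t : mapObj (dStar A) ((truncKan A n).obj N) ⟶ (truncJoin A n).obj N,
      t ≫ truncι n _ = mapHom (dStar A) (truncι n _) ≫ (totComparison A).app N :=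
  (isTrunc_truncι n _).exists_homLift
    (fun m hm => (dStar A).map_isZero (isZero_trunc n _ m hm)) _

/-- The comparison of truncations. -/
def pullbackTrunc (X : CochainComplex (AMod A) ℤ) :
    mapObj (dStar A) ((truncFunctor (AMod A) n).obj X) ⟶
      (truncFunctor (AMod (subdivision A)) n).obj (mapObj (dStar A) X) :=
  (exists_pullbackTrunc A n X).choose

lemma pullbackTrunc_truncι (X : CochainComplex (AMod A) ℤ) :
    pullbackTrunc A n X ≫ truncι n _ = mapHom (dStar A) (truncι n X) :=
  (exists_pullbackTrunc A n X).choose_spec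

/-- The comparison of truncated total complexes. -/
def truncComparison (N : CochainComplex (AMod (subdivision A)) ℤ) :
    mapObj (dStar A) ((truncKan A n).obj N) ⟶ (truncJoin A n).obj N :=
  (exists_truncComparison A n N).choose

lemma truncComparison_truncι (N : CochainComplex (AMod (subdivision A)) ℤ) :
    truncComparison A n N ≫ truncι n _ = mapHom (dStar A) (truncι n _) ≫ (totComparison A).app N :=
  (exists_truncComparison A n N).choose_spec

lemma comp_comp_eq_of_squares {D : Type*} [Category* D] {P Q P' Q' P'' Q'' : D} {a : P ⟶ Q}
    {t : P ⟶ P'} {t' : Q ⟶ Q'} {b : P' ⟶ Q'} {i : P' ⟶ P''} {i' : Q' ⟶ Q''} {c : P'' ⟶ Q''}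
    {v : P ⟶ P''} {v' : Q ⟶ Q''} (h : t ≫ i = v) (h' : t' ≫ i' = v') (e : b ≫ i' = i ≫ c)
    (e' : a ≫ v' = v ≫ c) : (a ≫ t') ≫ i' = (t ≫ b) ≫ i' := by
  rw [Category.assoc, Category.assoc, h', e', e, ← h, Category.assoc]

lemma mapHom_truncFunctor_map_ι {X Y : CochainComplex (AMod A) ℤ} (φ : X ⟶ Y) :
    mapHom (dStar A) ((truncFunctor (AMod A) n).map φ) ≫ mapHom (dStar A) (truncι n Y) =
      mapHom (dStar A) (truncι n X) ≫ mapHom (dStar A) φ :=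
  (((dStar A).mapHomologicalComplex (ComplexShape.up ℤ)).map_comp _ _).symm.trans
    ((congr_arg (mapHom (dStar A)) (truncFunctor_map_ι n φ)).trans
      (((dStar A).mapHomologicalComplex (ComplexShape.up ℤ)).map_comp _ _))

lemma pullbackTrunc_naturality {X Y : CochainComplex (AMod A) ℤ} (φ : X ⟶ Y) :
    mapHom (dStar A) ((truncFunctor (AMod A) n).map φ) ≫ pullbackTrunc A n Y =
      pullbackTrunc A n X ≫ (truncFunctor (AMod (subdivision A)) n).map (mapHom (dStar A) φ) :=
  (isTrunc_truncι n (mapObj (dStar A) Y)).hom_ext (comp_comp_eq_of_squares (pullbackTrunc_truncι A n X)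
    (pullbackTrunc_truncι A n Y) (truncFunctor_map_ι n (mapHom (dStar A) φ))
      (mapHom_truncFunctor_map_ι A n φ))

lemma truncComparison_naturality {N N' : CochainComplex (AMod (subdivision A)) ℤ} (φ : N ⟶ N') :
    mapHom (dStar A) ((truncKan A n).map φ) ≫ truncComparison A n N' =
      truncComparison A n N ≫ (truncJoin A n).map φ :=
  (isTrunc_truncι n _).hom_ext (comp_comp_eq_of_squares (truncComparison_truncι A n N) (truncComparison_truncι A n N')
    (truncFunctor_map_ι n _) ((Category.assoc _ _ _).symm.trans
      ((congr_arg (· ≫ _) (mapHom_truncFunctor_map_ι A n _)).trans ((Category.assoc _ _ _).trans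
        ((congr_arg (_ ≫ ·) ((totComparison A).naturality φ)).trans
          (Category.assoc _ _ _).symm)))))

/-- The truncated augmentation. -/
abbrev truncKanAug (X : CochainComplex (AMod A) ℤ) : (truncFunctor (AMod A) n).obj X ⟶
    (truncKan A n).obj (mapObj (dStar A) X) :=
  (truncFunctor (AMod A) n).map (kanAugHom A X)

/-- The truncated augmentation to ordinal sums. -/
abbrev truncJoinAug (N : CochainComplex (AMod (subdivision A)) ℤ) :
    (truncFunctor (AMod (subdivision A)) n).obj N ⟶ (truncJoin A n).obj N :=
  (truncFunctor (AMod (subdivision A)) n).map (joinAugHom A N)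

lemma map_truncKanAug_truncComparison (X : CochainComplex (AMod A) ℤ) :
    mapHom (dStar A) (truncKanAug A n X) ≫ truncComparison A n (mapObj (dStar A) X) =
      pullbackTrunc A n X ≫ truncJoinAug A n (mapObj (dStar A) X) :=
  (isTrunc_truncι n _).hom_ext (comp_comp_eq_of_squares (pullbackTrunc_truncι A n X)
    (truncComparison_truncι A n (mapObj (dStar A) X)) (truncFunctor_map_ι n _) ((Category.assoc _ _ _).symm.trans
      ((congr_arg (· ≫ _) (mapHom_truncFunctor_map_ι A n _)).trans ((Category.assoc _ _ _).trans
        (congr_arg (_ ≫ ·) (map_kanAugHom_totComparison A X))))))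

end Truncated

end FullyFaithful

section Main

variable {C : Type u} [SmallCategory C] {k : Type u} [CommRing k] (A : Cᵒᵖ ⥤ AlgCat.{u} k)

lemma isRelQuasiIso_truncKan_map (n : ℤ) {X Y : CochainComplex (AMod (subdivision A)) ℤ}
    {φ : X ⟶ Y} (hφ : IsRelQuasiIso φ) : IsRelQuasiIso ((truncKan A n).map φ) :=
  isRelQuasiIso_truncFunctor_map n (isRelQuasiIso_totHom (kan A).cochain
    (fun _ => ProductData.preservesRelContractible
      (ProductData.isLinear_mkOfAlgebra _ _ _ _ _ _)) hφ)

lemma isRelQuasiIso_truncJoin_map (n : ℤ) {X Y : CochainComplex (AMod (subdivision A)) ℤ}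
    {φ : X ⟶ Y} (hφ : IsRelQuasiIso φ) : IsRelQuasiIso ((truncJoin A n).map φ) :=
  isRelQuasiIso_truncFunctor_map n (isRelQuasiIso_totHom (joinFunctor A).cochain
    (fun _ => ProductData.preservesRelContractible
      (ProductData.isLinear_mkOfAlgebra _ _ _ _ _ _)) hφ)

lemma preservesHomotopies_truncKan (n : ℤ) : PreservesHomotopies (truncKan A n) :=
  (kan A).cochain.preservesHomotopies_totFunctor.comp (preservesHomotopies_truncFunctor _ n)

lemma preservesHomotopies_truncJoin (n : ℤ) : PreservesHomotopies (truncJoin A n) :=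
  (joinFunctor A).cochain.preservesHomotopies_totFunctor.comp
    (preservesHomotopies_truncFunctor _ n)

variable {S : Set ℤ} {n : ℤ} (hn : n ∈ S)

/-- The truncation functor on homotopy categories. -/
abbrev truncK : KMinus A S ⥤ KMinus A S :=
  inducedK (truncFunctor (AMod A) n) (preservesHomotopies_truncFunctor _ n) hn (isZero_trunc n)

/-- The truncated homotopy right Kan extension on homotopy categories. -/
abbrev truncKanK : KMinus (subdivision A) S ⥤ KMinus A S :=
  inducedK (truncKan A n) (preservesHomotopies_truncKan A n) hn
    (fun _ => isZero_trunc n _)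

/-- The functor of ordinal sums on homotopy categories. -/
abbrev truncJoinK : KMinus (subdivision A) S ⥤ KMinus (subdivision A) S :=
  inducedK (truncJoin A n) (preservesHomotopies_truncJoin A n) hn
    (fun _ => isZero_trunc n _)

/-- The inclusion of truncations on homotopy categories. -/
def truncKι : truncK A hn ⟶ 𝟭 (KMinus A S) :=
  natTransK (fun X => truncι n X.obj.as) (fun _ _ φ => ⟨(truncFunctor (AMod A) n).map φ, φ, rfl, rfl,
    truncFunctor_map_ι n φ⟩)

lemma truncKanAug_naturality (n : ℤ) {X Y : CochainComplex (AMod A) ℤ} (φ : X ⟶ Y) :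
    (truncFunctor (AMod A) n).map φ ≫ truncKanAug A n Y =
      truncKanAug A n X ≫ (truncKan A n).map (mapHom (dStar A) φ) := by
  refine ((truncFunctor (AMod A) n).map_comp φ (kanAugHom A Y)).symm.trans ?_
  refine (congr_arg (truncFunctor (AMod A) n).map (kanAugHom_totHom A φ).symm).trans ?_
  exact (truncFunctor (AMod A) n).map_comp (kanAugHom A X)
    ((kan A).cochain.totHom (mapHom (dStar A) φ))

/-- The augmentation on homotopy categories. -/
def kanAugK : truncK A hn ⟶ dStarK A S ⋙ truncKanK A hn :=
  natTransK (fun X => truncKanAug A n X.obj.as) (fun _ _ φ =>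
    ⟨(truncFunctor (AMod A) n).map φ, (truncKan A n).map (mapHom (dStar A) φ), rfl, rfl,
      truncKanAug_naturality A n φ⟩)

/-- The augmentation to ordinal sums on homotopy categories. -/
def joinAugK : truncK (subdivision A) hn ⟶ truncJoinK A hn :=
  natTransK (fun X => truncJoinAug A n X.obj.as) (fun _ _ φ =>
    ⟨(truncFunctor (AMod (subdivision A)) n).map φ, (truncJoin A n).map φ, rfl, rfl,
      ((truncFunctor (AMod (subdivision A)) n).map_comp _ _).symm.trans
        ((congr_arg (truncFunctor (AMod (subdivision A)) n).map (joinAugHom_totHom A φ).symm).trans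
          ((truncFunctor (AMod (subdivision A)) n).map_comp _ _))⟩)

/-- The comparison map on homotopy categories. -/
def truncComparisonK : truncKanK A hn ⋙ dStarK A S ⟶ truncJoinK A hn :=
  natTransK (fun X => truncComparison A n X.obj.as) (fun _ _ φ =>
    ⟨mapHom (dStar A) ((truncKan A n).map φ), (truncJoin A n).map φ, rfl, rfl,
      truncComparison_naturality A n φ⟩)

/-- The comparison of truncations on homotopy categories. -/
def pullbackTruncK : truncK A hn ⋙ dStarK A S ⟶ dStarK A S ⋙ truncK (subdivision A) hn :=
  natTransK (fun X => pullbackTrunc A n X.obj.as) (fun _ _ φ =>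
    ⟨mapHom (dStar A) ((truncFunctor (AMod A) n).map φ),
      (truncFunctor (AMod (subdivision A)) n).map (mapHom (dStar A) φ), rfl, rfl,
      pullbackTrunc_naturality A n φ⟩)

lemma homK_comp_congr {X Y Y' Z : KMinus A S} {a : X.obj.as ⟶ Y.obj.as} {b : Y.obj.as ⟶ Z.obj.as}
    {c : X.obj.as ⟶ Y'.obj.as} {d : Y'.obj.as ⟶ Z.obj.as} (h : a ≫ b = c ≫ d) :
    homK a ≫ homK b = homK c ≫ homK d := by
  refine InducedCategory.hom_ext ?_
  refine ((HomotopyCategory.quotient _ _).map_comp a b).symm.trans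
    ((congr_arg _ h).trans ((HomotopyCategory.quotient _ _).map_comp c d))

lemma homK_comp_eq {X Y Z : KMinus A S} {a : X.obj.as ⟶ Y.obj.as} {b : Y.obj.as ⟶ Z.obj.as}
    {c : X.obj.as ⟶ Z.obj.as} (h : a ≫ b = c) : homK a ≫ homK b = homK c := by
  refine InducedCategory.hom_ext ?_
  exact ((HomotopyCategory.quotient _ _).map_comp a b).symm.trans (congr_arg _ h)

lemma relQuasiIso_truncKι {X : KMinus A S} (hX : ∀ i, n < i → IsZero (X.obj.as.X i)) :
    relQuasiIso A S ((truncKι A hn).app X) :=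
  relQuasiIso_homK (isRelQuasiIso_of_isIso ((isTrunc_truncι n X.obj.as).isIso_of_isZero hX))

lemma bijective_dStarD_map (hn : n ∈ S) {X Y : KMinus A S} (hX : ∀ i, n < i → IsZero (X.obj.as.X i))
    (hY : ∀ i, n < i → IsZero (Y.obj.as.X i)) :
    Function.Bijective (fun g : (relQuasiIso A S).Q.obj X ⟶ (relQuasiIso A S).Q.obj Y =>
      (dStarD A S).map g) :=
  bijective_map_of_localization (W := relQuasiIso A S) (W' := relQuasiIso (subdivision A) S)
    (L' := (relQuasiIso (subdivision A) S).Q) (F := dStarK A S)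
    (eqToIso (Localization.Construction.fac _ _))
    (relQuasiIso_inducedK_map _ _ hn _ (isRelQuasiIso_truncFunctor_map n))
    (relQuasiIso_inducedK_map _ _ hn _ (isRelQuasiIso_truncKan_map A n))
    (relQuasiIso_inducedK_map _ _ hn _ (isRelQuasiIso_truncJoin_map A n))
    (relQuasiIso_inducedK_map _ _ hn _ (isRelQuasiIso_truncFunctor_map n))
    (truncKι A hn) (truncKι (subdivision A) hn) (kanAugK A hn)
    (fun X => relQuasiIso_homK
      (isRelQuasiIso_truncFunctor_map n (isRelQuasiIso_kanAugHom A X.obj.as)))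
    (joinAugK A hn)
    (fun X => relQuasiIso_homK
      (isRelQuasiIso_truncFunctor_map n (isRelQuasiIso_joinAugHom A X.obj.as)))
    (truncComparisonK A hn) (pullbackTruncK A hn)
    (fun X => homK_comp_congr (subdivision A) (map_truncKanAug_truncComparison A n X.obj.as))
    (fun X => homK_comp_eq (subdivision A) (pullbackTrunc_truncι A n X.obj.as))
    X Y (relQuasiIso_truncKι A hn hX) (relQuasiIso_truncKι A hn hY)

variable (S) in
lemma full_and_faithful_dStarD (hS : DirectedOn (· ≤ ·) S) :
    (dStarD A S).Full ∧ (dStarD A S).Faithful := by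
  have h (X Y : RelDerived A S) : Function.Bijective (fun g : X ⟶ Y => (dStarD A S).map g) := by
    obtain ⟨X, rfl⟩ := (Localization.Construction.objEquiv (relQuasiIso A S)).surjective X
    obtain ⟨Y, rfl⟩ := (Localization.Construction.objEquiv (relQuasiIso A S)).surjective Y
    obtain ⟨a, ha, hX⟩ := X.property
    obtain ⟨b, hb, hY⟩ := Y.property
    obtain ⟨n, hn, han, hbn⟩ := hS a ha b hb
    exact bijective_dStarD_map A hn (fun i hi => hX i (lt_of_le_of_lt han hi))
      (fun i hi => hY i (lt_of_le_of_lt hbn hi))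
  exact ⟨⟨(h _ _).2⟩, ⟨fun e => (h _ _).1 e⟩⟩

end Main

end DiagramOfAlgebras

end

theorem theorem3p9 {C : Type u} [SmallCategory C] {k : Type u} [CommRing k]
    (A : Cᵒᵖ ⥤ AlgCat.{u} k) :
    -- `d^*` is exact
    (PreservesFiniteLimits (DiagramOfAlgebras.dStar A) ∧
      PreservesFiniteColimits (DiagramOfAlgebras.dStar A)) ∧
    -- `d^*` preserves allowable maps
    (∀ (M N : DiagramOfAlgebras.AMod A) (η : M ⟶ N), DiagramOfAlgebras.Allowable η →
      DiagramOfAlgebras.Allowable ((DiagramOfAlgebras.dStar A).map η)) ∧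
    -- `d^*` preserves relative quasi-isomorphisms
    (∀ (M N : CochainComplex (DiagramOfAlgebras.AMod A) ℤ) (φ : M ⟶ N),
      DiagramOfAlgebras.IsRelQuasiIso φ → DiagramOfAlgebras.IsRelQuasiIso
        (((DiagramOfAlgebras.dStar A).mapHomologicalComplex (ComplexShape.up ℤ)).map φ)) ∧
    -- the induced functor is full and faithful on relative derived categories of complexes bounded on the right
    ((DiagramOfAlgebras.dStarD A Set.univ).Full ∧
      (DiagramOfAlgebras.dStarD A Set.univ).Faithful) ∧
    -- the same for complexes `⋯ ⟶ M_1 ⟶ M_0 ⟶ 0`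
    ((DiagramOfAlgebras.dStarD A {0}).Full ∧
      (DiagramOfAlgebras.dStarD A {0}).Faithful) := by
  refine ⟨⟨DiagramOfAlgebras.preservesFiniteLimits_dStar A,
    DiagramOfAlgebras.preservesFiniteColimits_dStar A⟩, fun M N η h τ => h (τ.functor.obj 0),
    fun M N φ => DiagramOfAlgebras.isRelQuasiIso_dStar A,
    DiagramOfAlgebras.full_and_faithful_dStarD A _ fun a _ b _ =>
      ⟨max a b, Set.mem_univ _, le_max_left a b, le_max_right a b⟩,
    DiagramOfAlgebras.full_and_faithful_dStarD A _ fun a ha b hb =>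
      ⟨0, rfl, le_of_eq ha, le_of_eq hb⟩⟩
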